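/- **Setting.** All objects are $\mathbb Z_2$-graded; "manifold" means smooth supermanifold, and parities are denoted by a tilde. Let $M$ be a supermanifold and $E\to M$ a (super) vector bundle of finite rank with local frame $(s_\alpha)$, $\widetilde{s_\alpha}=\widetilde\alpha$, over local coordinates $x^A$ of $M$. Let $\xi^\alpha$ and $\eta_\alpha$ (both of parity $\widetilde\alpha+1$) be the induced fibre coordinates on $\Pi E$ and $\Pi E^*$; under $s_\beta=T_\beta{}^\alpha\bar s_\alpha$ they change by $\bar\xi^\alpha=\xi^\beta T_\beta{}^\alpha$, $\eta_\beta=T_\beta{}^\alpha\bar\eta_\alpha$. Lie algebroid forms are arbitrary smooth functions on $\Pi E$ (not necessarily polynomial along the fibres); $C^\infty(\Pi E)$ is a supercommutative unital algebra. Let $E$ be a Lie algebroid, i.e. the sections of $E$ carry a Lie (super)bracket and an anchor $a:E\to TM$ with $[u,fv]=a(u)(f)\,v+(-1)^{\tilde f\tilde u}f[u,v]$ and $a([u,v])=[a(u),a(v)]$. Define local functions by $a(s_\alpha)=Q_\alpha^A\,\partial/\partial x^A$ and $[s_\alpha,s_\beta]=(-1)^{\tilde\beta}Q_{\alpha\beta}^\gamma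 s_\gamma$, and put $$d_E=\xi^\alpha Q^A_\alpha\frac{\partial}{\partial x^A}+\tfrac12\,\xi^\alpha\xi^\beta Q^\gamma_{\beta\alpha}\frac{\partial}{\partial\xi^\gamma}.$$ With $S^A_\alpha=(-1)^{\tilde\alpha}Q^A_\alpha$ and $S^\gamma_{\alpha\beta}=(-1)^{\tilde\alpha+\tilde\beta}Q^\gamma_{\alpha\beta}$, the Schouten bracket on $C^\infty(\Pi E^*)$ is $$[\![X,Y]\!]_S=S^A_\alpha\Big((-1)^{(\tilde X+1)(\tilde A+1)+\tilde A\tilde\alpha}\frac{\partial X}{\partial\eta_\alpha}\frac{\partial Y}{\partial x^A}-(-1)^{\tilde X\tilde\alpha}\frac{\partial X}{\partial x^A}\frac{\partial Y}{\partial\eta_\alpha}\Big)-(-1)^{\tilde X\tilde\alpha}S^\gamma_{\alpha\beta}\,\eta_\gamma\frac{\partial X}{\partial\eta_\beta}\frac{\partial Y}{\partial\eta_\alpha}.$$ A *higher Poisson structure* on $E$ is an even function $P\in C^\infty(\Pi E^*)$ with $[\![P,P]\!]_S=0$. Let $\sum_{k\ge0}P_k$, $P_k=\frac1{k!}P^{\alpha_1\cdots\alpha_k}(x)\,\eta_{\alpha_k}\cdots\eta_{\alpha_1}$,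 be its fibrewise Taylor expansion along the zero section, and let $$i_{P_k}=\frac1{k!}P^{\alpha_1\cdots\alpha_k}\frac{\partial}{\partial\xi^{\alpha_k}}\cdots\frac{\partial}{\partial\xi^{\alpha_1}},\qquad L_{P_k}=d_E\circ i_{P_k}-i_{P_k}\circ d_E .$$ The Koszul–Brylinski operator is the Lie derivative along $P$, $\Delta_P=L_P=[d_E,i_P]=\sum_k L_{P_k}$; in general this infinite sum is understood formally, i.e. as the operator $\Delta_P=\sum_k\hbar^kL_{P_k}$ on $C^\infty(\Pi E)[[\hbar]]$ with $\hbar$ a formal even parameter. Where the sum is finite locally on $M$, $\hbar$ is not needed. A *homotopy BV-algebra* is a pair $(\mathcal A,\Delta)$ of a supercommutative, associative, unital algebra and an odd linear operator with $\Delta^2=0$ such that the brackets $[a_1,\dots,a_n]_\Delta=[\cdots[[\Delta,a_1],a_2],\cdots,a_n](1)$, $n\ge0$ (iterated supercommutators, with $a_i$ acting by multiplication), make $\mathcal A$ an $L_\infty$-algebra: they are odd, multilinear, symmetric in the graded sense, and satisfy, for all $n\ge 0$ and homogeneous $a_1,\dots,a_n$, $$\sum_{k+l=n}\ \sum_{(k,l)\text{-shuffles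 }\sigma}\pm\,[[a_{\sigma(1)},\dots,a_{\sigma(k)}]_\Delta,a_{\sigma(k+1)},\dots,a_{\sigma(n)}]_\Delta=0$$ with the Koszul sign $\pm$ of the permutation of the $a_i$. **Theorem.** Let $E\to M$ be a Lie algebroid equipped with a higher Poisson structure $P\in C^\infty(\Pi E^*)$. The operators $L_{P_k}$ are well defined on $C^\infty(\Pi E)$, independently of the local coordinates, and $(C^\infty(\Pi E),\Delta_P)$ is a homotopy BV-algebra. Precisely: 1. $\big(C^\infty(\Pi E)[[\hbar]],\ \sum_k\hbar^kL_{P_k}\big)$ is a homotopy BV-algebra. 2. If $\Delta_P$ is an operator on $C^\infty(\Pi E)$ such that, for every form $\omega$, the sum $\Delta_P\,\omega=\sum_kL_{P_k}\omega$ is finite locally on $M$, then $(C^\infty(\Pi E),\Delta_P)$ is a homotopy BV-algebra. 3. If, locally on $M$, only finitely many $P_k$ are non-zero (for example, if $P$ is polynomial along the fibres, or if $E$ has no odd fibre directions), then there is exactly one operator $\Delta_P$ as in 2. The brackets generated by $\Delta_P$ are the higher Koszul–Schouten brackets. -/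

import Mathlib

open TopologicalSpace
open scoped TensorProduct ContDiff

universe u v

noncomputable section

namespace HigherPoisson

/-! ### Signs, superalgebras, `L∞`-algebras and homotopy BV-algebras -/

/-- The sign `(-1)^i` of a parity. -/
def sgn (i : ZMod 2) : ℝ := (-1) ^ i.val

/-- `A` with the `ℤ/2`-grading `gr` is a supercommutative, associative, unital superalgebra. -/
structure IsSuperCommAlgebra {A : Type*} [Ring A] [Algebra ℝ A]
    (gr : ZMod 2 → Submodule ℝ A) : Prop where
  isCompl : IsCompl (gr 0) (gr 1)
  one_mem : (1 : A) ∈ gr 0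
  mul_mem : ∀ {i j : ZMod 2} {a b : A}, a ∈ gr i → b ∈ gr j → a * b ∈ gr (i + j)
  supercomm : ∀ {i j : ZMod 2} {a b : A}, a ∈ gr i → b ∈ gr j → a * b = sgn (i * j) • (b * a)

/-- The Koszul sign of the unshuffle `(a₁, …, aₙ) ↦ (a_i for i ∈ S; a_j for j ∉ S)` of homogeneous
elements of parities `ε`: every pair `j < i` with `i ∈ S`, `j ∉ S` is interchanged. -/
def koszulSign {n : ℕ} (ε : Fin n → ZMod 2) (S : Finset (Fin n)) : ℝ :=
  ∏ i ∈ S, ∏ j ∈ Sᶜ, if j < i then sgn (ε i * ε j) else 1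

/-- A sequence of odd, (super)symmetric, `n`-linear brackets, `n ≥ 0`, on a super vector space
subject to the generalised Jacobi identities. A `(k, l)`-shuffle of `n = k + l` indices is the same
as the subset `S` of the first `k` of the shuffled indices: both `S` and its complement are listed
in increasing order. -/
structure IsLInfinity {V : Type*} [AddCommGroup V] [Module ℝ V] (gr : ZMod 2 → Submodule ℝ V)
    (b : ∀ n : ℕ, MultilinearMap ℝ (fun _ : Fin n => V) V) : Prop where
  isCompl : IsCompl (gr 0) (gr 1)
  odd : ∀ (n : ℕ) (ε : Fin n → ZMod 2) (a : Fin n → V), (∀ i, a i ∈ gr (ε i)) →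
    b n a ∈ gr (∑ i, ε i + 1)
  symm : ∀ (n : ℕ) (ε : Fin n → ZMod 2) (a : Fin n → V), (∀ i, a i ∈ gr (ε i)) →
    ∀ i j : Fin n, (i : ℕ) + 1 = j →
      b n a = sgn (ε i * ε j) • b n (a ∘ Equiv.swap i j)
  jacobi : ∀ (n : ℕ) (ε : Fin n → ZMod 2) (a : Fin n → V), (∀ i, a i ∈ gr (ε i)) →
    ∑ S : Finset (Fin n), koszulSign ε S •
      b (Sᶜ.card + 1) (Fin.cons (b S.card (fun i => a (S.orderEmbOfFin rfl i)))
        (fun j => a (Sᶜ.orderEmbOfFin rfl j))) = 0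

/-- For an operator `D` of parity `d` and a list of homogeneous elements with their parities,
the iterated supercommutator `[⋯[[D, a₁], a₂], ⋯, aₙ]`, where the elements of `A` act by left
multiplication. -/
def iteratedCommutator {A : Type*} [Ring A] [Algebra ℝ A] :
    Module.End ℝ A → ZMod 2 → List (ZMod 2 × A) → Module.End ℝ A
  | D, _, [] => D
  | D, d, (ε, a) :: l =>
      iteratedCommutator
        (D * LinearMap.mulLeft ℝ a - sgn (d * ε) • (LinearMap.mulLeft ℝ a * D)) (d + ε) l

/-- `(A, Δ)` is a homotopy BV-algebra: `A` is a supercommutative unital algebra, `Δ` is an odd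
operator that squares to zero, and the (multilinear) brackets given on homogeneous elements by
`[a₁, …, aₙ]_Δ = [⋯[[Δ, a₁], a₂], ⋯, aₙ](1)` make `A` an `L∞`-algebra. -/
structure IsHomotopyBV {A : Type*} [Ring A] [Algebra ℝ A] (gr : ZMod 2 → Submodule ℝ A)
    (Δ : Module.End ℝ A) : Prop where
  superCommAlgebra : IsSuperCommAlgebra gr
  odd : ∀ (i : ZMod 2) (a : A), a ∈ gr i → Δ a ∈ gr (i + 1)
  sq_zero : Δ * Δ = 0
  lInfinity : ∃ b : ∀ n : ℕ, MultilinearMap ℝ (fun _ : Fin n => A) A,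
    (∀ (n : ℕ) (ε : Fin n → ZMod 2) (a : Fin n → A), (∀ i, a i ∈ gr (ε i)) →
      b n a = iteratedCommutator Δ 1 (List.ofFn fun i => (ε i, a i)) 1) ∧
    IsLInfinity gr b

/-! ### Functions on superdomains -/

section Superdomain

/-- Extension by zero of a function on an open subset of `ℝ^κ`. -/
def extZero {κ : Type} {Ω : Opens (κ → ℝ)} (f : Ω → ℝ) : (κ → ℝ) → ℝ := Function.extend Subtype.val f 0

theorem extZero_apply {κ : Type} {Ω : Opens (κ → ℝ)} (f : Ω → ℝ) {y : κ → ℝ} (hy : y ∈ Ω) :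
    extZero f y = f ⟨y, hy⟩ :=
  Subtype.val_injective.extend_apply f 0 (⟨y, hy⟩ : Ω)

variable {κ κ' ν ν' : Type} [Fintype κ] [Fintype κ'] [Fintype ν] [Fintype ν']

/-- The algebra `C^∞(Ω)` of an open subset `Ω` of `ℝ^κ`. -/
def smooth (Ω : Opens (κ → ℝ)) : Subalgebra ℝ (Ω → ℝ) where
  carrier := {f | ContDiffOn ℝ ∞ (extZero f) Ω}
  mul_mem' {f g} hf hg := by
    refine (ContDiffOn.mul hf hg).congr fun y hy => ?_
    simp only [extZero_apply _ hy, Pi.mul_apply]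
  add_mem' {f g} hf hg := by
    refine (ContDiffOn.add hf hg).congr fun y hy => ?_
    simp only [extZero_apply _ hy, Pi.add_apply]
  algebraMap_mem' c := by
    refine (contDiffOn_const (c := c)).congr fun y hy => ?_
    simp only [extZero_apply _ hy, Pi.algebraMap_apply, Algebra.algebraMap_self, RingHom.id_apply]

/-- The coordinate function `x_i` on `Ω`. -/
def smoothCoord (Ω : Opens (κ → ℝ)) (i : κ) : smooth Ω :=
  ⟨fun y => y.1 i, by
    refine (contDiff_apply ℝ ℝ i).contDiffOn.congr fun y hy => ?_
    simp only [extZero_apply _ hy]⟩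

open scoped Classical in
/-- The partial derivative `∂/∂x_i` on `C^∞(Ω)`. -/
def smoothPartial (Ω : Opens (κ → ℝ)) (i : κ) : smooth Ω →ₗ[ℝ] smooth Ω where
  toFun f := ⟨fun y => fderiv ℝ (extZero f.1) y.1 (Pi.single i 1), by
    have h : ContDiffOn ℝ ∞ (fderiv ℝ (extZero f.1)) Ω :=
      ContDiffOn.fderiv_of_isOpen f.2 Ω.isOpen (by simp)
    refine (h.clm_apply (contDiffOn_const (c := (Pi.single i 1 : κ → ℝ)))).congr fun y hy => ?_
    simp only [extZero_apply _ hy]⟩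
  map_add' f g := by
    ext y
    have hd : ∀ f : smooth Ω, DifferentiableAt ℝ (extZero f.1) y.1 := fun f =>
      (f.2.differentiableOn (by simp)).differentiableAt (Ω.isOpen.mem_nhds y.2)
    have h : extZero (f + g).1 =ᶠ[nhds y.1] extZero f.1 + extZero g.1 := by
      filter_upwards [Ω.isOpen.mem_nhds y.2] with z hz
      have hz' : z ∈ Ω := hz
      simp [extZero_apply _ hz']
    change fderiv ℝ (extZero (f + g).1) y.1 (Pi.single i 1) = _
    rw [h.fderiv_eq, fderiv_add (hd f) (hd g)]
    rfl
  map_smul' c f := by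
    ext y
    have hd : DifferentiableAt ℝ (extZero f.1) y.1 :=
      (f.2.differentiableOn (by simp)).differentiableAt (Ω.isOpen.mem_nhds y.2)
    have h : extZero (c • f).1 =ᶠ[nhds y.1] c • extZero f.1 := by
      filter_upwards [Ω.isOpen.mem_nhds y.2] with z hz
      have hz' : z ∈ Ω := hz
      simp [extZero_apply _ hz']
    change fderiv ℝ (extZero (c • f).1) y.1 (Pi.single i 1) = _
    rw [h.fderiv_eq, fderiv_const_smul hd c]
    rfl

/-- Pull-back of smooth functions along a linear map that sends `Ω'` into `Ω`. -/
def smoothPullback {Ω : Opens (κ → ℝ)} {Ω' : Opens (κ' → ℝ)} (L : (κ' → ℝ) →ₗ[ℝ] (κ → ℝ))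
    (hL : ∀ y ∈ Ω', L y ∈ Ω) : smooth Ω →ₐ[ℝ] smooth Ω' where
  toFun f := ⟨fun y => f.1 ⟨L y.1, hL y.1 y.2⟩, by
    have h : ContDiffOn ℝ ∞ (extZero f.1 ∘ L.toContinuousLinearMap) Ω' :=
      ContDiffOn.comp f.2 L.toContinuousLinearMap.contDiff.contDiffOn fun y hy => hL y hy
    refine h.congr fun y hy => ?_
    have hy' : L y ∈ Ω := hL y hy
    simp [extZero_apply _ hy, extZero_apply _ hy']⟩
  map_one' := rfl
  map_mul' _ _ := rfl
  map_zero' := rfl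
  map_add' _ _ := rfl
  commutes' _ := rfl

/-- Functions `C^∞(Ω) ⊗ Λ(θ_b : b ∈ ν)` on the superdomain with body `Ω ⊆ ℝ^κ` and odd coordinates
indexed by `ν`. -/
def SuperFun (Ω : Opens (κ → ℝ)) (ν : Type) [Fintype ν] : Type :=
  smooth Ω ⊗[ℝ] ExteriorAlgebra ℝ (ν → ℝ)

instance (Ω : Opens (κ → ℝ)) (ν : Type) [Fintype ν] : Ring (SuperFun Ω ν) :=
  inferInstanceAs (Ring (smooth Ω ⊗[ℝ] ExteriorAlgebra ℝ (ν → ℝ)))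

instance (Ω : Opens (κ → ℝ)) (ν : Type) [Fintype ν] : Algebra ℝ (SuperFun Ω ν) :=
  inferInstanceAs (Algebra ℝ (smooth Ω ⊗[ℝ] ExteriorAlgebra ℝ (ν → ℝ)))

/-- The even (`i = 0`) and the odd (`i = 1`) functions on a superdomain. -/
def SuperFun.gr (Ω : Opens (κ → ℝ)) (ν : Type) [Fintype ν] (i : ZMod 2) :
    Submodule ℝ (SuperFun Ω ν) :=
  LinearMap.range (LinearMap.lTensor (smooth Ω)
    (CliffordAlgebra.evenOdd (0 : QuadraticForm ℝ (ν → ℝ)) i).subtype)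

open scoped Classical in
/-- The coordinates of a superdomain: the even ones are indexed by `κ`, the odd ones by `ν`. -/
def SuperFun.coord (Ω : Opens (κ → ℝ)) (ν : Type) [Fintype ν] : κ ⊕ ν → SuperFun Ω ν
  | Sum.inl i => smoothCoord Ω i ⊗ₜ[ℝ] 1
  | Sum.inr b => 1 ⊗ₜ[ℝ] ExteriorAlgebra.ι ℝ (Pi.single b 1 : ν → ℝ)

/-- The (left) partial derivatives with respect to the coordinates of a superdomain. -/
def SuperFun.partialD (Ω : Opens (κ → ℝ)) (ν : Type) [Fintype ν] :
    κ ⊕ ν → Module.End ℝ (SuperFun Ω ν)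
  | Sum.inl i => LinearMap.rTensor (ExteriorAlgebra ℝ (ν → ℝ)) (smoothPartial Ω i)
  | Sum.inr b => LinearMap.lTensor (smooth Ω)
      (CliffordAlgebra.contractLeft (Q := (0 : QuadraticForm ℝ (ν → ℝ)))
        (LinearMap.proj b : (ν → ℝ) →ₗ[ℝ] ℝ))

/-- Pull-back of functions on superdomains along a linear map of the bodies and a linear
substitution of the odd coordinates. -/
def SuperFun.pullback {Ω : Opens (κ → ℝ)} {Ω' : Opens (κ' → ℝ)} (L : (κ' → ℝ) →ₗ[ℝ] (κ → ℝ))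
    (hL : ∀ y ∈ Ω', L y ∈ Ω) (M : (ν → ℝ) →ₗ[ℝ] (ν' → ℝ)) :
    SuperFun Ω ν →ₐ[ℝ] SuperFun Ω' ν' :=
  Algebra.TensorProduct.map (smoothPullback L hL) (ExteriorAlgebra.map M)

/-- Restriction to a smaller superdomain. -/
def SuperFun.res {Ω Ω' : Opens (κ → ℝ)} (h : Ω' ≤ Ω) : SuperFun Ω ν →ₐ[ℝ] SuperFun Ω' ν :=
  SuperFun.pullback LinearMap.id (fun _ hy => h hy) LinearMap.id

end Superdomain

/-! ### Local calculus on `ΠE` and `ΠE*`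

`Ω` is an open subset of `ℝ^p`, the base superdomain has `q` odd coordinates, and the fibre
coordinates of `ΠE` and of `ΠE*` are indexed by `Fin s ⊕ Fin r`: `s` even ones and `r` odd ones,
where `E` has rank `r|s`. -/

section Local

variable {p q r s : ℕ}

/-- Parity of a coordinate: even ones on the left, odd ones on the right. -/
def coordParity {m n : ℕ} : Fin m ⊕ Fin n → ZMod 2
  | Sum.inl _ => 0
  | Sum.inr _ => 1

/-- Parity `α` of the basis section `s_α` of `E`; the fibre coordinates `ξ^α` of `ΠE` and `η_α` of
`ΠE*` have parity `α + 1`. -/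
def frameParity (α : Fin s ⊕ Fin r) : ZMod 2 := coordParity α + 1

/-- The tube `Ω × ℝ^s` over `Ω`. -/
def tube (s : ℕ) (Ω : Opens (Fin p → ℝ)) : Opens (Fin p ⊕ Fin s → ℝ) :=
  ⟨{y | (fun i => y (Sum.inl i)) ∈ Ω},
    Ω.isOpen.preimage (continuous_pi fun i => continuous_apply (Sum.inl i))⟩

theorem tube_mono (s : ℕ) {Ω Ω' : Opens (Fin p → ℝ)} (h : Ω' ≤ Ω) : tube s Ω' ≤ tube s Ω :=
  fun _ hy => h hy

/-- The base coordinates among the coordinates of the total space. -/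
def baseIdx : Fin p ⊕ Fin q → (Fin p ⊕ Fin s) ⊕ (Fin q ⊕ Fin r) := Sum.map Sum.inl Sum.inl

/-- The fibre coordinates among the coordinates of the total space. -/
def fibreIdx : Fin s ⊕ Fin r → (Fin p ⊕ Fin s) ⊕ (Fin q ⊕ Fin r) := Sum.map Sum.inr Sum.inr

/-- `v ↦ (v, 0)`. -/
def extendByZero (m n : ℕ) : (Fin m → ℝ) →ₗ[ℝ] (Fin m ⊕ Fin n → ℝ) where
  toFun v := Sum.elim v 0
  map_add' v w := by ext (i | i) <;> simp
  map_smul' c v := by ext (i | i) <;> simp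

/-- Functions on the total space of `ΠE` (or of `ΠE*`) in a local trivialisation. -/
abbrev TotalFun (q r s : ℕ) (Ω : Opens (Fin p → ℝ)) : Type :=
  SuperFun (tube s Ω) (Fin q ⊕ Fin r)

variable {Ω : Opens (Fin p → ℝ)}

/-- Pull-back of functions on the base to the total space. -/
def fromBase : SuperFun Ω (Fin q) →ₐ[ℝ] TotalFun q r s Ω :=
  SuperFun.pullback (LinearMap.funLeft ℝ ℝ Sum.inl) (fun _ hy => hy) (extendByZero q r)

/-- Restriction of functions on the total space to the zero section. -/
def toZeroSection : TotalFun q r s Ω →ₐ[ℝ] SuperFun Ω (Fin q) :=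
  SuperFun.pullback (extendByZero p s)
    (fun y hy => by simpa [tube, extendByZero] using hy) (LinearMap.funLeft ℝ ℝ Sum.inl)

/-- The fibre coordinates `ξ^α` of `ΠE` (or `η_α` of `ΠE*`). -/
def fibreCoord (α : Fin s ⊕ Fin r) : TotalFun q r s Ω := SuperFun.coord _ _ (fibreIdx α)

/-- `∂/∂ξ^α` (or `∂/∂η_α`). -/
def fibreD (α : Fin s ⊕ Fin r) : Module.End ℝ (TotalFun q r s Ω) :=
  SuperFun.partialD _ _ (fibreIdx α)

/-- `∂/∂x^A` on the total space. -/
def baseD (A : Fin p ⊕ Fin q) : Module.End ℝ (TotalFun q r s Ω) :=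
  SuperFun.partialD _ _ (baseIdx A)

/-- The structure functions `Q_α^A` and `Q_{αβ}^γ` of a Lie algebroid in local coordinates. -/
structure StructureFunctions (q r s : ℕ) (Ω : Opens (Fin p → ℝ)) where
  anchor : (Fin s ⊕ Fin r) → (Fin p ⊕ Fin q) → SuperFun Ω (Fin q)
  bracket : (Fin s ⊕ Fin r) → (Fin s ⊕ Fin r) → (Fin s ⊕ Fin r) → SuperFun Ω (Fin q)

/-- The de Rham differential
`d_E = ξ^α Q_α^A ∂/∂x^A + ½ ξ^α ξ^β Q_{βα}^γ ∂/∂ξ^γ`. -/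
def deRham (c : StructureFunctions q r s Ω) : Module.End ℝ (TotalFun q r s Ω) :=
  (∑ α, ∑ A, LinearMap.mulLeft ℝ (fibreCoord α * fromBase (c.anchor α A)) * baseD A) +
  (1 / 2 : ℝ) • ∑ α, ∑ β, ∑ γ,
    LinearMap.mulLeft ℝ (fibreCoord α * fibreCoord β * fromBase (c.bracket β α γ)) * fibreD γ

/-- The coefficient `X^{α₁⋯α_k}(x)` in the fibrewise Taylor expansion
`X = ∑_k 1/k! X^{α₁⋯α_k} η_{α_k} ⋯ η_{α₁}` along the zero section of an even function `X` on `ΠE*`,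
i.e. `∂/∂η_{α₁} ⋯ ∂/∂η_{α_k} X` at `η = 0`, up to the sign `(-1)^{∑ (α_i + 1)}` that arises because
the coefficient stands on the left of the `η`'s. -/
def taylorCoeff (X : TotalFun q r s Ω) {k : ℕ} (α : Fin k → Fin s ⊕ Fin r) :
    SuperFun Ω (Fin q) :=
  sgn (∑ i, coordParity (α i)) • toZeroSection (((List.ofFn α).map fibreD).prod X)

/-- The `k`-th term of the interior product with an even function `X` on `ΠE*`:
`1/k! X^{α₁⋯α_k} ∂/∂ξ^{α_k} ⋯ ∂/∂ξ^{α₁}`. -/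
def interior (X : TotalFun q r s Ω) (k : ℕ) : Module.End ℝ (TotalFun q r s Ω) :=
  (1 / (k.factorial : ℝ)) • ∑ α : Fin k → Fin s ⊕ Fin r,
    LinearMap.mulLeft ℝ (fromBase (taylorCoeff X α)) * ((List.ofFn α).reverse.map fibreD).prod

/-- The `k`-th term of the Lie derivative `L_X = d_E ∘ i_X - i_X ∘ d_E` along an even function `X`
on `ΠE*`. -/
def lieDerivative (c : StructureFunctions q r s Ω) (X : TotalFun q r s Ω) (k : ℕ) :
    Module.End ℝ (TotalFun q r s Ω) :=
  deRham c * interior X k - interior X k * deRham c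

/-- The Schouten bracket `⟦X, Y⟧_S` on `ΠE*`, for `X` of parity `x`, where
`S_α^A = (-1)^α Q_α^A` and `S_{αβ}^γ = (-1)^{α + β} Q_{αβ}^γ`:
`S_α^A ((-1)^{(x+1)(A+1)+Aα} ∂X/∂η_α ∂Y/∂x^A - (-1)^{xα} ∂X/∂x^A ∂Y/∂η_α)
  - (-1)^{xα} S_{αβ}^γ η_γ ∂X/∂η_β ∂Y/∂η_α`. -/
def schouten (c : StructureFunctions q r s Ω) (x : ZMod 2) (X Y : TotalFun q r s Ω) :
    TotalFun q r s Ω :=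
  (∑ α : Fin s ⊕ Fin r, ∑ A : Fin p ⊕ Fin q,
    fromBase (sgn (frameParity α) • c.anchor α A) *
      (sgn ((x + 1) * (coordParity A + 1) + coordParity A * frameParity α) •
          (fibreD α X * baseD A Y) -
        sgn (x * frameParity α) • (baseD A X * fibreD α Y))) -
  ∑ α : Fin s ⊕ Fin r, ∑ β : Fin s ⊕ Fin r, ∑ γ : Fin s ⊕ Fin r,
    sgn (x * frameParity α) •
      (fromBase (sgn (frameParity α + frameParity β) • c.bracket α β γ) * fibreCoord γ *
        fibreD β X * fibreD α Y)

end Local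

/-! ### Sheaves, supermanifolds and vector bundles -/

/-- A sheaf of supercommutative real superalgebras. -/
structure SuperSheaf (X : Type u) [TopologicalSpace X] where
  sec : Opens X → Type v
  [ring : ∀ U, Ring (sec U)]
  [algebra : ∀ U, Algebra ℝ (sec U)]
  gr : ∀ U, ZMod 2 → Submodule ℝ (sec U)
  isSuperCommAlgebra : ∀ U, IsSuperCommAlgebra (gr U)
  res : ∀ {U V : Opens X}, V ≤ U → sec U →ₐ[ℝ] sec V
  res_mem : ∀ {U V : Opens X} (h : V ≤ U) {i : ZMod 2} {f : sec U},
    f ∈ gr U i → res h f ∈ gr V i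
  res_self : ∀ {U : Opens X} (f : sec U), res (le_refl U) f = f
  res_res : ∀ {U V W : Opens X} (h : V ≤ U) (h' : W ≤ V) (f : sec U),
    res h' (res h f) = res (h'.trans h) f
  locality : ∀ {ι : Type u} (U : Opens X) (V : ι → Opens X) (hV : ∀ i, V i ≤ U),
    (∀ x ∈ U, ∃ i, x ∈ V i) → ∀ f g : sec U, (∀ i, res (hV i) f = res (hV i) g) → f = g
  gluing : ∀ {ι : Type u} (U : Opens X) (V : ι → Opens X) (hV : ∀ i, V i ≤ U),
    (∀ x ∈ U, ∃ i, x ∈ V i) → ∀ f : ∀ i, sec (V i),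
    (∀ i j, res (inf_le_left : V i ⊓ V j ≤ V i) (f i) =
      res (inf_le_right : V i ⊓ V j ≤ V j) (f j)) →
    ∃ g : sec U, ∀ i, res (hV i) g = f i

attribute [instance] SuperSheaf.ring SuperSheaf.algebra

/-- A sheaf of (left) super modules over a sheaf of superalgebras. -/
structure SuperModuleSheaf {X : Type u} [TopologicalSpace X] (O : SuperSheaf.{u, v} X) where
  sec : Opens X → Type v
  [addCommGroup : ∀ U, AddCommGroup (sec U)]
  [moduleReal : ∀ U, Module ℝ (sec U)]
  [module : ∀ U, Module (O.sec U) (sec U)]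
  [isScalarTower : ∀ U, IsScalarTower ℝ (O.sec U) (sec U)]
  gr : ∀ U, ZMod 2 → Submodule ℝ (sec U)
  isCompl : ∀ U, IsCompl (gr U 0) (gr U 1)
  smul_mem : ∀ {U : Opens X} {i j : ZMod 2} {f : O.sec U} {w : sec U},
    f ∈ O.gr U i → w ∈ gr U j → f • w ∈ gr U (i + j)
  res : ∀ {U V : Opens X}, V ≤ U → sec U →ₗ[ℝ] sec V
  res_smul : ∀ {U V : Opens X} (h : V ≤ U) (f : O.sec U) (w : sec U),
    res h (f • w) = O.res h f • res h w
  res_mem : ∀ {U V : Opens X} (h : V ≤ U) {i : ZMod 2} {w : sec U},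
    w ∈ gr U i → res h w ∈ gr V i
  res_self : ∀ {U : Opens X} (w : sec U), res (le_refl U) w = w
  res_res : ∀ {U V W : Opens X} (h : V ≤ U) (h' : W ≤ V) (w : sec U),
    res h' (res h w) = res (h'.trans h) w
  locality : ∀ {ι : Type u} (U : Opens X) (V : ι → Opens X) (hV : ∀ i, V i ≤ U),
    (∀ x ∈ U, ∃ i, x ∈ V i) → ∀ f g : sec U, (∀ i, res (hV i) f = res (hV i) g) → f = g
  gluing : ∀ {ι : Type u} (U : Opens X) (V : ι → Opens X) (hV : ∀ i, V i ≤ U),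
    (∀ x ∈ U, ∃ i, x ∈ V i) → ∀ f : ∀ i, sec (V i),
    (∀ i j, res (inf_le_left : V i ⊓ V j ≤ V i) (f i) =
      res (inf_le_right : V i ⊓ V j ≤ V j) (f j)) →
    ∃ g : sec U, ∀ i, res (hV i) g = f i

attribute [instance] SuperModuleSheaf.addCommGroup SuperModuleSheaf.moduleReal
  SuperModuleSheaf.module SuperModuleSheaf.isScalarTower

section Geometry

variable {X : Type u} [TopologicalSpace X]

/-- An isomorphism, over the open set `src`, between a sheaf of superalgebras and the sheaf of
functions on superdomains `W ↦ C^∞(dom W) ⊗ Λ(θ_b : b ∈ ν)`. -/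
structure LocalModel (F : SuperSheaf.{u, v} X) (src : Opens X) {κ : Type} [Fintype κ]
    (ν : Type) [Fintype ν] (dom : Opens X → Opens (κ → ℝ))
    (dom_mono : ∀ {W W' : Opens X}, W' ≤ W → dom W' ≤ dom W) where
  iso : ∀ W : Opens X, W ≤ src → (F.sec W ≃ₐ[ℝ] SuperFun (dom W) ν)
  iso_res : ∀ {W W' : Opens X} (hW : W ≤ src) (h : W' ≤ W) (f : F.sec W),
    iso W' (h.trans hW) (F.res h f) = SuperFun.res (dom_mono h) (iso W hW f)
  iso_mem : ∀ {W : Opens X} (hW : W ≤ src) (i : ZMod 2) (f : F.sec W),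
    iso W hW f ∈ SuperFun.gr (dom W) ν i ↔ f ∈ F.gr W i

/-- The image in `ℝ^p` of (the part in the chart domain of) an open set. -/
def chartImage {p : ℕ} (e : OpenPartialHomeomorph X (Fin p → ℝ)) (W : Opens X) :
    Opens (Fin p → ℝ) :=
  ⟨e.target ∩ e.symm ⁻¹' W, e.isOpen_inter_preimage_symm W.isOpen⟩

theorem chartImage_mono {p : ℕ} (e : OpenPartialHomeomorph X (Fin p → ℝ)) {W W' : Opens X}
    (h : W' ≤ W) : chartImage e W' ≤ chartImage e W :=
  fun _ hy => ⟨hy.1, h hy.2⟩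

/-- The domain of a chart of the underlying space. -/
def chartSource {p : ℕ} (e : OpenPartialHomeomorph X (Fin p → ℝ)) : Opens X :=
  ⟨e.source, e.open_source⟩

/-- A chart of dimension `p|q`: an isomorphism of ringed spaces between an open subspace and a
superdomain. -/
structure SuperChart (O : SuperSheaf.{u, v} X) (p q : ℕ) where
  body : OpenPartialHomeomorph X (Fin p → ℝ)
  model : LocalModel O (chartSource body) (Fin q) (chartImage body) (chartImage_mono body)

/-- The domain of a chart. -/
abbrev SuperChart.source {O : SuperSheaf.{u, v} X} {p q : ℕ} (c : SuperChart O p q) : Opens X :=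
  chartSource c.body

/-- A (smooth) supermanifold of dimension `p|q` with underlying space `X`. -/
structure Supermanifold (X : Type u) [TopologicalSpace X] (p q : ℕ) where
  functions : SuperSheaf.{u, v} X
  exists_chart : ∀ x : X, ∃ c : SuperChart functions p q, x ∈ c.source

/-- A local trivialisation, over a chart of the base, of a vector bundle `E` of rank `r|s` and of the
associated bundles `ΠE` and `ΠE*`. Here `sections` is the sheaf of sections of `E`, and `forms` and
`multivectors` are the direct images on the base of the sheaves of functions on the total spaces of
`ΠE` and `ΠE*`; the maps `pF` and `pM` are the pull-backs along the projections to the base. -/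
structure BundleChart {p q : ℕ} (M : Supermanifold.{u, v} X p q) (r s : ℕ)
    (sections : SuperModuleSheaf M.functions) (forms multivectors : SuperSheaf.{u, v} X)
    (pF : ∀ U : Opens X, M.functions.sec U →ₐ[ℝ] forms.sec U)
    (pM : ∀ U : Opens X, M.functions.sec U →ₐ[ℝ] multivectors.sec U) where
  base : SuperChart M.functions p q
  /-- The basis sections `s_α` of `E`. -/
  frame : ∀ W : Opens X, W ≤ base.source →
    Module.Basis (Fin s ⊕ Fin r) (M.functions.sec W) (sections.sec W)
  frame_mem : ∀ {W : Opens X} (hW : W ≤ base.source) (α : Fin s ⊕ Fin r),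
    frame W hW α ∈ sections.gr W (frameParity α)
  frame_res : ∀ {W W' : Opens X} (hW : W ≤ base.source) (h : W' ≤ W) (α : Fin s ⊕ Fin r),
    frame W' (h.trans hW) α = sections.res h (frame W hW α)
  /-- Natural coordinates `x^A`, `ξ^α` on `ΠE`. -/
  formsModel : LocalModel forms base.source (Fin q ⊕ Fin r)
    (fun W => tube s (chartImage base.body W))
    (fun h => tube_mono s (chartImage_mono base.body h))
  formsModel_base : ∀ {W : Opens X} (hW : W ≤ base.source) (f : M.functions.sec W),
    formsModel.iso W hW (pF W f) = fromBase (base.model.iso W hW f)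
  /-- Natural coordinates `x^A`, `η_α` on `ΠE*`. -/
  multivectorsModel : LocalModel multivectors base.source (Fin q ⊕ Fin r)
    (fun W => tube s (chartImage base.body W))
    (fun h => tube_mono s (chartImage_mono base.body h))
  multivectorsModel_base : ∀ {W : Opens X} (hW : W ≤ base.source) (f : M.functions.sec W),
    multivectorsModel.iso W hW (pM W f) = fromBase (base.model.iso W hW f)

namespace BundleChart

variable {p q r s : ℕ} {M : Supermanifold.{u, v} X p q}
  {sections : SuperModuleSheaf M.functions} {forms multivectors : SuperSheaf.{u, v} X}
  {pF : ∀ U : Opens X, M.functions.sec U →ₐ[ℝ] forms.sec U}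
  {pM : ∀ U : Opens X, M.functions.sec U →ₐ[ℝ] multivectors.sec U}

/-- The domain (in the base) of a local trivialisation. -/
abbrev source (c : BundleChart M r s sections forms multivectors pF pM) : Opens X := c.base.source

/-- The fibre coordinate `ξ^α` on `ΠE`. -/
def xi (c : BundleChart M r s sections forms multivectors pF pM) (W : Opens X)
    (hW : W ≤ c.source) (α : Fin s ⊕ Fin r) : forms.sec W :=
  (c.formsModel.iso W hW).symm (fibreCoord α)

/-- The fibre coordinate `η_α` on `ΠE*`. -/
def eta (c : BundleChart M r s sections forms multivectors pF pM) (W : Opens X)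
    (hW : W ≤ c.source) (α : Fin s ⊕ Fin r) : multivectors.sec W :=
  (c.multivectorsModel.iso W hW).symm (fibreCoord α)

end BundleChart

/-- A vector bundle `E → M` of rank `r|s` over a supermanifold, together with the total spaces of
`ΠE` and `ΠE*`, given by an atlas of local trivialisations. On overlaps
`s_β = T_β^α s̄_α`, `ξ̄^α = ξ^β T_β^α` and `η_β = T_β^α η̄_α`, i.e. `η̄_α = (T⁻¹)_α^β η_β`. -/
structure SuperVectorBundle {p q : ℕ} (M : Supermanifold.{u, v} X p q) (r s : ℕ) where
  sections : SuperModuleSheaf M.functions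
  forms : SuperSheaf.{u, v} X
  multivectors : SuperSheaf.{u, v} X
  formsPullback : ∀ U : Opens X, M.functions.sec U →ₐ[ℝ] forms.sec U
  formsPullback_res : ∀ {U V : Opens X} (h : V ≤ U) (f : M.functions.sec U),
    formsPullback V (M.functions.res h f) = forms.res h (formsPullback U f)
  multivectorsPullback : ∀ U : Opens X, M.functions.sec U →ₐ[ℝ] multivectors.sec U
  multivectorsPullback_res : ∀ {U V : Opens X} (h : V ≤ U) (f : M.functions.sec U),
    multivectorsPullback V (M.functions.res h f) =
      multivectors.res h (multivectorsPullback U f)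
  atlas : Set (BundleChart M r s sections forms multivectors formsPullback multivectorsPullback)
  exists_mem_atlas : ∀ x : X, ∃ c ∈ atlas, x ∈ c.source
  compatible : ∀ c ∈ atlas, ∀ c' ∈ atlas, ∀ (W : Opens X) (h : W ≤ c.source) (h' : W ≤ c'.source),
    ∃ T : Fin s ⊕ Fin r → Fin s ⊕ Fin r → M.functions.sec W,
      (∀ β, c.frame W h β = ∑ α, T β α • c'.frame W h' α) ∧
      (∀ α, c'.xi W h' α = ∑ β, c.xi W h β * formsPullback W (T β α)) ∧
      (∀ β, c.eta W h β = ∑ α, multivectorsPullback W (T β α) * c'.eta W h' α)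

/-! ### Lie algebroids and higher Poisson structures -/

/-- A Lie algebroid structure on `E → M`: a Lie (super)bracket on the sections of `E` and an anchor
`E → TM` (both given on the sections over all open sets, compatibly with restriction) with
`[u, f v] = a(u)(f) v + (-1)^{f u} f [u, v]` and `a([u, v]) = [a(u), a(v)]`. -/
structure LieAlgebroid {p q r s : ℕ} {M : Supermanifold.{u, v} X p q}
    (E : SuperVectorBundle M r s) where
  bracket : ∀ U : Opens X, E.sections.sec U →ₗ[ℝ] E.sections.sec U →ₗ[ℝ] E.sections.sec U
  anchor : ∀ U : Opens X, E.sections.sec U →ₗ[ℝ] Module.End ℝ (M.functions.sec U)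
  bracket_res : ∀ {U V : Opens X} (h : V ≤ U) (w w' : E.sections.sec U),
    E.sections.res h (bracket U w w') = bracket V (E.sections.res h w) (E.sections.res h w')
  anchor_res : ∀ {U V : Opens X} (h : V ≤ U) (w : E.sections.sec U) (f : M.functions.sec U),
    M.functions.res h (anchor U w f) = anchor V (E.sections.res h w) (M.functions.res h f)
  /-- `a(u)` is a vector field, of the same parity as `u`, and `a` is linear over functions. -/
  anchor_mem : ∀ {U : Opens X} {i j : ZMod 2} {w : E.sections.sec U} {f : M.functions.sec U},
    w ∈ E.sections.gr U i → f ∈ M.functions.gr U j → anchor U w f ∈ M.functions.gr U (i + j)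
  anchor_mul : ∀ {U : Opens X} {i j : ZMod 2} {w : E.sections.sec U} {f : M.functions.sec U}
    (g : M.functions.sec U), w ∈ E.sections.gr U i → f ∈ M.functions.gr U j →
    anchor U w (f * g) = anchor U w f * g + sgn (i * j) • (f * anchor U w g)
  anchor_smul : ∀ {U : Opens X} (f : M.functions.sec U) (w : E.sections.sec U)
    (g : M.functions.sec U), anchor U (f • w) g = f * anchor U w g
  bracket_mem : ∀ {U : Opens X} {i j : ZMod 2} {w w' : E.sections.sec U},
    w ∈ E.sections.gr U i → w' ∈ E.sections.gr U j → bracket U w w' ∈ E.sections.gr U (i + j)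
  skew : ∀ {U : Opens X} {i j : ZMod 2} {w w' : E.sections.sec U},
    w ∈ E.sections.gr U i → w' ∈ E.sections.gr U j →
    bracket U w w' = -(sgn (i * j) • bracket U w' w)
  jacobi : ∀ {U : Opens X} {i j k : ZMod 2} {w w' w'' : E.sections.sec U},
    w ∈ E.sections.gr U i → w' ∈ E.sections.gr U j → w'' ∈ E.sections.gr U k →
    bracket U w (bracket U w' w'') =
      bracket U (bracket U w w') w'' + sgn (i * j) • bracket U w' (bracket U w w'')
  leibniz : ∀ {U : Opens X} {i j : ZMod 2} {w w' : E.sections.sec U} {f : M.functions.sec U},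
    w ∈ E.sections.gr U i → f ∈ M.functions.gr U j →
    bracket U w (f • w') = anchor U w f • w' + sgn (j * i) • (f • bracket U w w')
  anchor_bracket : ∀ {U : Opens X} {i j : ZMod 2} {w w' : E.sections.sec U}
    (f : M.functions.sec U), w ∈ E.sections.gr U i → w' ∈ E.sections.gr U j →
    anchor U (bracket U w w') f =
      anchor U w (anchor U w' f) - sgn (i * j) • anchor U w' (anchor U w f)

namespace LieAlgebroid

variable {p q r s : ℕ} {M : Supermanifold.{u, v} X p q} {E : SuperVectorBundle M r s}

/-- The structure functions in a local trivialisation: `a(s_α) = Q_α^A ∂/∂x^A` and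
`[s_α, s_β] = (-1)^β Q_{αβ}^γ s_γ`. -/
def structureFunctions (L : LieAlgebroid E)
    (c : BundleChart M r s E.sections E.forms E.multivectors E.formsPullback
      E.multivectorsPullback) :
    StructureFunctions q r s (chartImage c.base.body c.source) where
  anchor α A := c.base.model.iso c.source le_rfl
    (L.anchor c.source (c.frame c.source le_rfl α)
      ((c.base.model.iso c.source le_rfl).symm (SuperFun.coord _ _ A)))
  bracket α β γ := sgn (frameParity β) • c.base.model.iso c.source le_rfl
    ((c.frame c.source le_rfl).repr
      (L.bracket c.source (c.frame c.source le_rfl α) (c.frame c.source le_rfl β)) γ)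

/-- A higher Poisson structure: an even function `P` on `ΠE*` with `⟦P, P⟧_S = 0`. -/
def IsHigherPoisson (L : LieAlgebroid E) (P : E.multivectors.sec ⊤) : Prop :=
  P ∈ E.multivectors.gr ⊤ 0 ∧
  ∀ c ∈ E.atlas,
    schouten (L.structureFunctions c) 0
      (c.multivectorsModel.iso c.source le_rfl (E.multivectors.res le_top P))
      (c.multivectorsModel.iso c.source le_rfl (E.multivectors.res le_top P)) = 0

/-- `Δ` is the `k`-th term of the Lie derivative `L_P` along the even function `P` on `ΠE*`, i.e. the
Lie derivative along the component of weight `k` of (the fibrewise Taylor expansion of) `P`: an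
operator on functions on `ΠE` with the prescribed expression in all natural coordinates. -/
def IsLieDerivative (L : LieAlgebroid E) (P : E.multivectors.sec ⊤) (k : ℕ)
    (Δ : Module.End ℝ (E.forms.sec ⊤)) : Prop :=
  ∀ c ∈ E.atlas, ∀ f : E.forms.sec ⊤,
    c.formsModel.iso c.source le_rfl (E.forms.res le_top (Δ f)) =
      lieDerivative (L.structureFunctions c)
        (c.multivectorsModel.iso c.source le_rfl (E.multivectors.res le_top P)) k
        (c.formsModel.iso c.source le_rfl (E.forms.res le_top f))

end LieAlgebroid

/-- Locally on the base, only finitely many components (with respect to the weight) of the fibrewise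
Taylor expansion of a function on `ΠE*` are non-zero. -/
def HasLocallyFiniteExpansion {p q r s : ℕ} {M : Supermanifold.{u, v} X p q}
    (E : SuperVectorBundle M r s) (P : E.multivectors.sec ⊤) : Prop :=
  ∀ x : X, ∃ c ∈ E.atlas, ∃ (W : Opens X) (hW : W ≤ c.source), x ∈ W ∧ ∃ N : ℕ, ∀ k ≥ N,
    ∀ α : Fin k → Fin s ⊕ Fin r,
      taylorCoeff (c.multivectorsModel.iso W hW (E.multivectors.res le_top P)) α = 0

/-- `D = ∑_k Δ_k`, where the sum is locally finite on every section. -/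
def IsLocallyFiniteSum (F : SuperSheaf.{u, v} X) (Δ : ℕ → Module.End ℝ (F.sec ⊤))
    (D : Module.End ℝ (F.sec ⊤)) : Prop :=
  ∀ (f : F.sec ⊤) (x : X), ∃ W : Opens X, x ∈ W ∧ ∃ N : ℕ, ∀ n ≥ N,
    F.res (le_top : W ≤ ⊤) (D f) = F.res le_top (∑ k ∈ Finset.range n, Δ k f)

end Geometry

/-! ### Formal sums of operators -/

section Formal

variable {A : Type*} [Ring A] [Algebra ℝ A]

/-- The `ℤ/2`-grading of `A⟦ħ⟧` with `ħ` even. -/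
def formalGr (gr : ZMod 2 → Submodule ℝ A) (i : ZMod 2) : Submodule ℝ (PowerSeries A) where
  carrier := {f | ∀ n, PowerSeries.coeff n f ∈ gr i}
  add_mem' hf hg n := by rw [map_add]; exact add_mem (hf n) (hg n)
  zero_mem' n := by rw [map_zero]; exact zero_mem _
  smul_mem' c f hf n := by
    have h : PowerSeries.coeff n (c • f) = c • PowerSeries.coeff n f := rfl
    rw [h]; exact Submodule.smul_mem _ c (hf n)

/-- The formal sum `∑_k ħ^k Δ_k` as an operator on `A⟦ħ⟧`. -/
def formalSum (Δ : ℕ → Module.End ℝ A) : Module.End ℝ (PowerSeries A) where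
  toFun f := PowerSeries.mk fun n =>
    ∑ kl ∈ Finset.HasAntidiagonal.antidiagonal n, Δ kl.1 (PowerSeries.coeff kl.2 f)
  map_add' f g := by
    ext n
    simp [Finset.sum_add_distrib]
  map_smul' c f := by
    have h : ∀ (n : ℕ) (g : PowerSeries A),
      PowerSeries.coeff n (c • g) = c • PowerSeries.coeff n g := fun _ _ => rfl
    ext n
    simp only [h, PowerSeries.coeff_mk, map_smul, Finset.smul_sum, RingHom.id_apply]

end Formal

end HigherPoisson

end

/-! Two facts of different nature are combined.

The first is pure algebra. An odd operator `Δ` with `Δ² = 0` on a supercommutative algebra always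
generates an L∞-structure by iterated supercommutators (`isHomotopyBV_of_sq_zero`). The Leibniz rule
expands `[⋯[Δ², a₁], ⋯, aₙ](1) = 0` into a sum over unshuffles, which differs from the Jacobi sum
only by products of two brackets; these cancel in pairs when an unshuffle is exchanged with its
complement (`jacobi_of_sq_zero`). Hence only oddness and square zero remain to be shown, for the
formal and for the locally finite sum alike.

The second is the identity `∑_{k+l=n} L_{P_k} L_{P_l} = 0` (`sum_lieDerivative_mul_lieDerivative`).
The series `X ↦ ∑ t^k i_{X_k}` is multiplicative from functions on `ΠE*` to power series of
operators on forms and replaces `η_α` by `t ∂/∂ξ^α` (`jet_mul`, `jetSeries_mul`). Let `F` be the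
image of `P`. Up to sign, the commutator with `F` sends `ξ^α` to `t` times the image of `∂P/∂η_α`
and `∂/∂x^A` to the image of `∂P/∂x^A`; it kills base functions and `∂/∂ξ^γ`. Therefore `[F, [F,
d_E]]` is `-t` times the image of `⟦P, P⟧_S` (`ad_ad_deRham`), which is zero. So `F` commutes with
`[F, d_E]`, and together with `d_E² = 0` this forces `[F, d_E]² = 0` (`commutator_sq_eq_zero`). Its
coefficients are the required identities.

That `d_E² = 0`, and that `d_E` and `i_P` do not depend on the trivialisation, is checked on
generators: by Hadamard's lemma a superderivation is determined by its values on coordinates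
(`SuperFun.derivation_ext`). On base functions `d_E²` vanishes because the anchor preserves
brackets, on the `ξ^γ` because of the Jacobi identity (`TotalChart.deRham_mul_deRham`). The chart
expressions agree on overlaps (`lift_deRham_eq`, `lift_jet_eq`), so they glue to global operators.
For locally finite sums, square zero follows by regrouping a finite double sum near each point. -/

noncomputable section

namespace HigherPoisson

/-! ### Signs of parities. -/

section Signs

@[simp] theorem sgn_zero : sgn 0 = 1 := by simp [sgn]

@[simp] theorem sgn_one : sgn 1 = -1 := by simp [sgn, ZMod.val_one]

theorem eq_zero_or_one (a : ZMod 2) : a = 0 ∨ a = 1 := by revert a; decide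

theorem sgn_add (a b : ZMod 2) : sgn (a + b) = sgn a * sgn b := by
  rcases eq_zero_or_one a with rfl | rfl
  · simp
  · rcases eq_zero_or_one b with rfl | rfl
    · simp
    · rw [CharTwo.add_self_eq_zero]; simp

theorem sgn_mul_self (a : ZMod 2) : sgn a * sgn a = 1 := by
  rw [← sgn_add, CharTwo.add_self_eq_zero, sgn_zero]

theorem sgn_add_one (a : ZMod 2) : sgn (a + 1) = -sgn a := by
  rw [sgn_add, sgn_one, mul_neg_one]

theorem sgn_sum {ι : Type*} (s : Finset ι) (f : ι → ZMod 2) :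
    sgn (∑ i ∈ s, f i) = ∏ i ∈ s, sgn (f i) := by
  classical
  induction s using Finset.induction_on with
  | empty => simp
  | insert a s ha ih => rw [Finset.sum_insert ha, Finset.prod_insert ha, sgn_add, ih]

end Signs

/-! ### Iterated supercommutators of an operator with multiplications. -/

section Operators

variable {A : Type*} [Ring A] [Algebra ℝ A] {gr : ZMod 2 → Submodule ℝ A}

/-- `D` is homogeneous of parity `d` as an operator. -/
def IsHomogeneousOp {A B : Type*} [AddCommGroup A] [Module ℝ A] [AddCommGroup B] [Module ℝ B]
    (gr : ZMod 2 → Submodule ℝ A) (gr' : ZMod 2 → Submodule ℝ B)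
    (d : ZMod 2) (D : A →ₗ[ℝ] B) : Prop :=
  ∀ i, ∀ a ∈ gr i, D a ∈ gr' (i + d)

/-- The supercommutator of an operator of parity `d` with an element of parity `ε`. -/
def superComm (D : Module.End ℝ A) (d ε : ZMod 2) (a : A) : Module.End ℝ A :=
  D * LinearMap.mulLeft ℝ a - sgn (d * ε) • (LinearMap.mulLeft ℝ a * D)

theorem iteratedCommutator_cons (D : Module.End ℝ A) (d : ZMod 2) (x : ZMod 2 × A)
    (l : List (ZMod 2 × A)) :
    iteratedCommutator D d (x :: l) = iteratedCommutator (superComm D d x.1 x.2) (d + x.1) l := rfl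

theorem superComm_add (D D' : Module.End ℝ A) (d ε : ZMod 2) (a : A) :
    superComm (D + D') d ε a = superComm D d ε a + superComm D' d ε a := by
  simp only [superComm, add_mul, mul_add, smul_add]; abel

theorem superComm_smul (r : ℝ) (D : Module.End ℝ A) (d ε : ZMod 2) (a : A) :
    superComm (r • D) d ε a = r • superComm D d ε a := by
  simp only [superComm, smul_mul_assoc, mul_smul_comm, smul_sub]
  rw [smul_comm]

theorem iteratedCommutator_add (l : List (ZMod 2 × A)) :
    ∀ (D D' : Module.End ℝ A) (d : ZMod 2),
    iteratedCommutator (D + D') d l = iteratedCommutator D d l + iteratedCommutator D' d l := by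
  induction l with
  | nil => intro D D' d; rfl
  | cons x l ih => intro D D' d; simp only [iteratedCommutator_cons, superComm_add, ih]

theorem iteratedCommutator_smul (l : List (ZMod 2 × A)) :
    ∀ (r : ℝ) (D : Module.End ℝ A) (d : ZMod 2),
    iteratedCommutator (r • D) d l = r • iteratedCommutator D d l := by
  induction l with
  | nil => intro D D' d; rfl
  | cons x l ih => intro D D' d; simp only [iteratedCommutator_cons, superComm_smul, ih]

theorem iteratedCommutator_append (l l' : List (ZMod 2 × A)) :
    ∀ (D : Module.End ℝ A) (d : ZMod 2),
    iteratedCommutator D d (l ++ l') =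
      iteratedCommutator (iteratedCommutator D d l) (d + (l.map Prod.fst).sum) l' := by
  induction l with
  | nil => intro D d; simp [iteratedCommutator]
  | cons x l ih =>
    intro D d
    simp only [List.cons_append, iteratedCommutator_cons, ih, List.map_cons, List.sum_cons,
      add_assoc]

/-- This is the super Jacobi identity for `D` and two left multiplications, whose own
supercommutator vanishes because the algebra is supercommutative. It is the source of the symmetry
of the brackets. -/
theorem superComm_superComm (hA : IsSuperCommAlgebra gr) (D : Module.End ℝ A) (d : ZMod 2)
    {x y : ZMod 2 × A} (hx : x.2 ∈ gr x.1) (hy : y.2 ∈ gr y.1) :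
    superComm (superComm D d x.1 x.2) (d + x.1) y.1 y.2 =
      sgn (x.1 * y.1) • superComm (superComm D d y.1 y.2) (d + y.1) x.1 x.2 := by
  have h : LinearMap.mulLeft ℝ x.2 * LinearMap.mulLeft ℝ y.2 =
      sgn (x.1 * y.1) • (LinearMap.mulLeft ℝ y.2 * LinearMap.mulLeft ℝ x.2) := by
    ext a
    simp only [Module.End.mul_apply, LinearMap.mulLeft_apply, LinearMap.smul_apply, ← mul_assoc,
      hA.supercomm hx hy, smul_mul_assoc]
  have e1 : LinearMap.mulLeft ℝ y.2 * LinearMap.mulLeft ℝ x.2 =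
      sgn (x.1 * y.1) • (LinearMap.mulLeft ℝ x.2 * LinearMap.mulLeft ℝ y.2) := by
    rw [h, smul_smul, sgn_mul_self, one_smul]
  obtain ⟨i, x⟩ := x
  obtain ⟨j, y⟩ := y
  dsimp only [superComm] at h e1 ⊢
  clear hx hy
  generalize LinearMap.mulLeft ℝ x = X at h e1 ⊢
  generalize LinearMap.mulLeft ℝ y = Y at h e1 ⊢
  have h1 : D * X * Y = sgn (i * j) • (D * Y * X) := by
    rw [mul_assoc, h, mul_smul_comm, ← mul_assoc]
  have h2 : Y * X * D = sgn (i * j) • (X * Y * D) := by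
    rw [e1, smul_mul_assoc]
  simp only [sub_mul, mul_sub, smul_sub, smul_mul_assoc, mul_smul_comm, ← mul_assoc, h1,
    h2, smul_smul, add_mul, sgn_add]
  rw [mul_comm j i]
  have e := sgn_mul_self (i * j)
  generalize sgn (i * j) = k at e ⊢
  -- After `h1` and `h2` only four independent words in `D`, `X`, `Y` remain; their coefficients
  -- agree up to `k * k = 1`.
  match_scalars <;> first | ring1 | linear_combination sgn (d * i) * e

theorem iteratedCommutator_swap (hA : IsSuperCommAlgebra gr) (D : Module.End ℝ A) (d : ZMod 2)
    {x y : ZMod 2 × A} (hx : x.2 ∈ gr x.1) (hy : y.2 ∈ gr y.1) (l : List (ZMod 2 × A)) :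
    iteratedCommutator D d (x :: y :: l) =
      sgn (x.1 * y.1) • iteratedCommutator D d (y :: x :: l) := by
  simp only [iteratedCommutator_cons]
  rw [superComm_superComm hA D d hx hy, iteratedCommutator_smul, add_right_comm]

/-- In the Jacobi identity the inner bracket is the first argument, whereas it is the last
commutator that can be evaluated at `1` explicitly. Repeated adjacent swaps carry it there. -/
theorem iteratedCommutator_cons_eq_append (hA : IsSuperCommAlgebra gr) {x : ZMod 2 × A}
    (hx : x.2 ∈ gr x.1) (l : List (ZMod 2 × A)) (hl : ∀ y ∈ l, y.2 ∈ gr y.1) :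
    ∀ (D : Module.End ℝ A) (d : ZMod 2), iteratedCommutator D d (x :: l) =
      sgn (x.1 * (l.map Prod.fst).sum) • iteratedCommutator D d (l ++ [x]) := by
  induction l with
  | nil => intro D d; simp
  | cons y l ih =>
    intro D d
    rw [iteratedCommutator_swap hA D d hx (hl y (by simp)), iteratedCommutator_cons,
      ih (fun z hz => hl z (by simp [hz])), smul_smul, List.cons_append, List.map_cons,
      List.sum_cons, mul_add, sgn_add, iteratedCommutator_cons]

theorem isHomogeneousOp_superComm (hA : IsSuperCommAlgebra gr) {D : Module.End ℝ A} {d ε : ZMod 2}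
    (hD : IsHomogeneousOp gr gr d D) {a : A} (ha : a ∈ gr ε) :
    IsHomogeneousOp gr gr (d + ε) (superComm D d ε a) := by
  intro i b hb
  simp only [superComm, LinearMap.sub_apply, LinearMap.smul_apply, Module.End.mul_apply,
    LinearMap.mulLeft_apply]
  refine sub_mem ?_ (Submodule.smul_mem _ _ ?_)
  · have := hD _ _ (hA.mul_mem ha hb)
    rwa [show ε + i + d = i + (d + ε) by abel] at this
  · have := hA.mul_mem ha (hD _ _ hb)
    rwa [show ε + (i + d) = i + (d + ε) by abel] at this

theorem isHomogeneousOp_iteratedCommutator (hA : IsSuperCommAlgebra gr) (l : List (ZMod 2 × A))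
    (hl : ∀ y ∈ l, y.2 ∈ gr y.1) : ∀ {D : Module.End ℝ A} {d : ZMod 2},
    IsHomogeneousOp gr gr d D →
    IsHomogeneousOp gr gr (d + (l.map Prod.fst).sum) (iteratedCommutator D d l) := by
  induction l with
  | nil => intro D d hD; simpa [iteratedCommutator] using hD
  | cons y l ih =>
    intro D d hD
    have := ih (fun z hz => hl z (by simp [hz]))
      (isHomogeneousOp_superComm hA hD (hl y (by simp)))
    rwa [add_assoc] at this

end Operators

/-! ### Unshuffles as subsets of `Fin n`, with their Koszul signs. -/

section Shuffles

/-- Splits unshuffles by the block that receives the letter `0`; this drives the induction in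
`iteratedCommutator_mul`. -/
theorem sum_finset_fin_succ {M : Type*} [AddCommMonoid M] {n : ℕ} (F : Finset (Fin (n + 1)) → M) :
    ∑ S, F S = ∑ S : Finset (Fin n),
      (F (insert 0 (S.map (Fin.succEmb n))) + F (S.map (Fin.succEmb n))) := by
  classical
  rw [Finset.sum_add_distrib, ← Finset.powerset_univ, Fin.univ_succ, Finset.cons_eq_insert,
    Finset.sum_powerset_insert (by simp), add_comm]
  have h : ∀ G : Finset (Fin (n + 1)) → M,
      ∑ S ∈ (Finset.univ.map ⟨Fin.succ, Fin.succ_injective n⟩).powerset, G S =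
        ∑ S ∈ (Finset.univ : Finset (Fin n)).powerset, G (S.map (Fin.succEmb n)) := by
    intro G
    refine (Finset.sum_bij (fun S _ => S.map (Fin.succEmb n)) ?_ ?_ ?_ ?_).symm
    · intro S _
      rw [Finset.mem_powerset]
      exact Finset.map_subset_map.2 (Finset.subset_univ _)
    · intro S _ T _ h
      exact Finset.map_injective _ h
    · intro S hS
      rw [Finset.mem_powerset] at hS
      obtain ⟨T, -, rfl⟩ := Finset.subset_map_iff.1 hS
      exact ⟨T, by simp, rfl⟩
    · intro S _
      rfl
  rw [h, Finset.powerset_univ]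
  exact congrArg _ (h F)

theorem compl_map_succ {n : ℕ} (S : Finset (Fin n)) :
    (S.map (Fin.succEmb n))ᶜ = insert 0 (Sᶜ.map (Fin.succEmb n)) := by
  ext i
  refine Fin.cases ?_ (fun i => ?_) i <;> simp [Fin.succ_ne_zero]

theorem compl_insert_zero_map_succ {n : ℕ} (S : Finset (Fin n)) :
    (insert 0 (S.map (Fin.succEmb n)))ᶜ = Sᶜ.map (Fin.succEmb n) := by
  ext i
  refine Fin.cases ?_ (fun i => ?_) i <;> simp [Fin.succ_ne_zero]

theorem koszulSign_insert_zero {n : ℕ} (ε : Fin (n + 1) → ZMod 2) (S : Finset (Fin n)) :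
    koszulSign ε (insert 0 (S.map (Fin.succEmb n))) = koszulSign (ε ∘ Fin.succ) S := by
  rw [koszulSign, compl_insert_zero_map_succ, Finset.prod_insert (by simp)]
  simp [koszulSign]

/-- When `0` lies in the complement, every element of `S` is moved past it. When it lies in `S`, it
already stands in front and passes nothing (`koszulSign_insert_zero`). -/
theorem koszulSign_map_succ {n : ℕ} (ε : Fin (n + 1) → ZMod 2) (S : Finset (Fin n)) :
    koszulSign ε (S.map (Fin.succEmb n)) =
      sgn (ε 0 * ∑ i ∈ S, ε i.succ) * koszulSign (ε ∘ Fin.succ) S := by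
  rw [koszulSign, compl_map_succ, Finset.mul_sum, sgn_sum, koszulSign, Finset.prod_map,
    ← Finset.prod_mul_distrib]
  refine Finset.prod_congr rfl fun i _ => ?_
  rw [Finset.prod_insert (by simp)]
  simp [mul_comm]

/-- A pair with one index in `S` and one outside is out of order for exactly one of `S` and `Sᶜ`. So
the two signs multiply to the sign of interchanging the whole blocks, and each squares to one. -/
theorem koszulSign_compl {n : ℕ} (ε : Fin n → ZMod 2) (S : Finset (Fin n)) :
    koszulSign ε Sᶜ = sgn ((∑ i ∈ S, ε i) * ∑ i ∈ Sᶜ, ε i) * koszulSign ε S := by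
  have h : koszulSign ε Sᶜ * koszulSign ε S = sgn ((∑ i ∈ S, ε i) * ∑ i ∈ Sᶜ, ε i) := by
    rw [koszulSign, compl_compl, Finset.prod_comm, koszulSign, ← Finset.prod_mul_distrib,
      Finset.sum_mul, sgn_sum]
    refine Finset.prod_congr rfl fun i hi => ?_
    rw [Finset.mul_sum, sgn_sum, ← Finset.prod_mul_distrib]
    refine Finset.prod_congr rfl fun j hj => ?_
    have hij : i ≠ j := by
      rintro rfl
      simp [hi] at hj
    rcases lt_or_gt_of_ne hij with h | h
    · simp [h, h.le.not_gt, mul_comm]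
    · simp [h, h.le.not_gt]
  have h2 : koszulSign ε S * koszulSign ε S = 1 := by
    rw [koszulSign, ← Finset.prod_mul_distrib]
    refine Finset.prod_eq_one fun i _ => ?_
    rw [← Finset.prod_mul_distrib]
    refine Finset.prod_eq_one fun j _ => ?_
    split_ifs
    · exact sgn_mul_self _
    · simp
  rw [← h, mul_assoc, h2, mul_one]

/-- The values of `f` on the elements of `S`, in increasing order. -/
def sublistOf {α : Type*} {n : ℕ} (f : Fin n → α) (S : Finset (Fin n)) : List α :=
  List.ofFn fun i => f (S.orderEmbOfFin rfl i)

/-- Two sorted lists with the same entries coincide. The filtered form makes recursion on `n`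
immediate. -/
theorem sublistOf_eq {α : Type*} {n : ℕ} (f : Fin n → α) (S : Finset (Fin n)) :
    sublistOf f S = ((List.finRange n).filter (· ∈ S)).map f := by
  have h : List.ofFn (S.orderEmbOfFin rfl) = (List.finRange n).filter (· ∈ S) := by
    refine List.Perm.eq_of_sortedLE (List.sortedLE_ofFn_iff.2 (S.orderEmbOfFin rfl).monotone)
      ((List.pairwise_le_finRange n).filter _).sortedLE ?_
    rw [List.perm_ext_iff_of_nodup]
    · intro i
      simp [List.mem_ofFn']
    · exact List.nodup_ofFn.2 (S.orderEmbOfFin rfl).injective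
    · exact (List.nodup_finRange n).filter _
  rw [← h, List.map_ofFn]
  rfl

theorem sublistOf_insert_zero {α : Type*} {n : ℕ} (f : Fin (n + 1) → α) (S : Finset (Fin n)) :
    sublistOf f (insert 0 (S.map (Fin.succEmb n))) = f 0 :: sublistOf (f ∘ Fin.succ) S := by
  simp [sublistOf_eq, List.finRange_succ, List.filter_map, Function.comp_def, Fin.succ_ne_zero]

theorem sublistOf_map_succ {α : Type*} {n : ℕ} (f : Fin (n + 1) → α) (S : Finset (Fin n)) :
    sublistOf f (S.map (Fin.succEmb n)) = sublistOf (f ∘ Fin.succ) S := by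
  simp [sublistOf_eq, List.finRange_succ, List.filter_map, Function.comp_def]

theorem sum_map_fst_sublistOf {α : Type*} {n : ℕ} (f : Fin n → ZMod 2 × α) (S : Finset (Fin n)) :
    ((sublistOf f S).map Prod.fst).sum = ∑ i ∈ S, (f i).1 := by
  rw [sublistOf, List.map_ofFn, List.sum_ofFn]
  conv_rhs => rw [← Finset.map_orderEmbOfFin_univ S rfl, Finset.sum_map]
  rfl

end Shuffles

/-! ### Derived brackets of an odd operator of square zero. -/

section Brackets

variable {A : Type*} [Ring A] [Algebra ℝ A] {gr : ZMod 2 → Submodule ℝ A}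

/-- Taking the supercommutator with `a` is a superderivation of the composition of operators. -/
theorem superComm_mul (D D' : Module.End ℝ A) (d d' ε : ZMod 2) (a : A) :
    superComm (D * D') (d + d') ε a =
      D * superComm D' d' ε a + sgn (d' * ε) • (superComm D d ε a * D') := by
  simp only [superComm, mul_sub, sub_mul, smul_sub, mul_smul_comm, smul_mul_assoc, add_mul, sgn_add,
    smul_smul, mul_assoc, mul_comm (sgn (d' * ε))]
  abel

/-- By the Leibniz rule each argument is absorbed by `D` or by `D'`; `S` collects those absorbed by
`D'`. The scalar is the sign of bringing `D D' a₁ ⋯ aₙ` into the order `D`, arguments of `D`, `D'`,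
arguments of `D'`. -/
theorem iteratedCommutator_mul : ∀ {n : ℕ} (f : Fin n → ZMod 2 × A) (D D' : Module.End ℝ A)
    (d d' : ZMod 2),
    iteratedCommutator (D * D') (d + d') (List.ofFn f) =
      ∑ S : Finset (Fin n),
        (koszulSign (fun i => (f i).1) Sᶜ * sgn (d' * ∑ i ∈ Sᶜ, (f i).1)) •
          (iteratedCommutator D d (sublistOf f Sᶜ) * iteratedCommutator D' d' (sublistOf f S))
  | 0, f, D, D', d, d' => by
    have h : (default : Finset (Fin 0))ᶜ = ∅ := Finset.eq_empty_of_isEmpty _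
    simp [iteratedCommutator, koszulSign, sublistOf_eq, h]
  | n + 1, f, D, D', d, d' => by
    rw [List.ofFn_succ, iteratedCommutator_cons, superComm_mul, iteratedCommutator_add,
      iteratedCommutator_smul, add_assoc]
    -- In `h1` the letter `0` has gone to `D'`, in `h2` to `D`; these are the summands with `0` in
    -- `S` and outside `S`.
    have h1 := iteratedCommutator_mul (f ∘ Fin.succ) D (superComm D' d' (f 0).1 (f 0).2) d
      (d' + (f 0).1)
    have h2 := iteratedCommutator_mul (f ∘ Fin.succ) (superComm D d (f 0).1 (f 0).2) D'
      (d + (f 0).1) d'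
    rw [add_assoc, add_comm (f 0).1 d'] at h2
    simp only [Function.comp_def] at h1 h2
    rw [h1, h2, sum_finset_fin_succ, Finset.sum_add_distrib, Finset.smul_sum]
    congr 1
    · refine Finset.sum_congr rfl fun S _ => ?_
      rw [compl_insert_zero_map_succ, koszulSign_map_succ, sublistOf_map_succ,
        sublistOf_insert_zero, iteratedCommutator_cons, Finset.sum_map]
      simp only [Function.comp_def, Fin.coe_succEmb, add_mul, sgn_add]
      congr 1
      ring
    · refine Finset.sum_congr rfl fun S _ => ?_
      rw [compl_map_succ, koszulSign_insert_zero, sublistOf_map_succ,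
        sublistOf_insert_zero, iteratedCommutator_cons, Finset.sum_insert (by simp), Finset.sum_map,
        smul_smul]
      simp only [Function.comp_def, Fin.coe_succEmb, mul_add, sgn_add]
      congr 1
      ring

/-- The parity involution of a super vector space. -/
def parityInvolution (h : IsCompl (gr 0) (gr 1)) : Module.End ℝ A :=
  (gr 0).projection (gr 1) h - (gr 1).projection (gr 0) h.symm

theorem parityInvolution_apply (h : IsCompl (gr 0) (gr 1)) {i : ZMod 2} {a : A} (ha : a ∈ gr i) :
    parityInvolution h a = sgn i • a := by
  rcases eq_zero_or_one i with rfl | rfl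
  · rw [parityInvolution, LinearMap.sub_apply, Submodule.projection_apply_of_mem_left h ha,
      Submodule.projection_apply_of_mem_right h.symm ha]
    simp
  · rw [parityInvolution, LinearMap.sub_apply, Submodule.projection_apply_of_mem_right h ha,
      Submodule.projection_apply_of_mem_left h.symm ha]
    simp

theorem eq_zero_of_eq_neg {V : Type*} [AddCommGroup V] [Module ℝ V] {x : V} (h : x = -x) :
    x = 0 := by
  have h2 : (2 : ℝ) • x = 0 := by
    rw [two_smul]
    nth_rewrite 2 [h]
    exact add_neg_cancel x
  exact (smul_eq_zero.1 h2).resolve_left two_ne_zero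

theorem linearMap_ext_of_homogeneous {B : Type*} [AddCommGroup B] [Module ℝ B]
    (h : IsCompl (gr 0) (gr 1)) {D D' : A →ₗ[ℝ] B}
    (hD : ∀ i, ∀ a ∈ gr i, D a = D' a) : D = D' := by
  ext a
  obtain ⟨x, hx, y, hy, rfl⟩ := Submodule.mem_sup.1 (h.sup_eq_top ▸ Submodule.mem_top (x := a))
  rw [map_add, map_add, hD _ _ hx, hD _ _ hy]

/-- The supercommutator with elements of `A`, extended bilinearly to inhomogeneous operators
and elements. -/
def superCommBilin (h : IsCompl (gr 0) (gr 1)) :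
    Module.End ℝ A →ₗ[ℝ] A →ₗ[ℝ] Module.End ℝ A :=
  LinearMap.mk₂ ℝ (fun D a => D * LinearMap.mulLeft ℝ a -
      (LinearMap.mulLeft ℝ ((gr 0).projection (gr 1) h a) * D + LinearMap.mulLeft ℝ ((gr 1).projection (gr 0) h.symm a) *
        (parityInvolution h * D * parityInvolution h)))
    (fun D D' a => by simp only [add_mul, mul_add]; abel)
    (fun c D a => by simp only [smul_mul_assoc, mul_smul_comm, smul_sub, smul_add])
    (fun D a b => by
      have e : ∀ x y : A, LinearMap.mulLeft ℝ (x + y) =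
        LinearMap.mulLeft ℝ x + LinearMap.mulLeft ℝ y := fun x y => by ext; simp [add_mul]
      simp only [map_add, e, mul_add, add_mul]; abel)
    (fun c D a => by
      have e : ∀ x : A, LinearMap.mulLeft ℝ (c • x) =
        c • LinearMap.mulLeft ℝ x := fun x => by ext; simp
      simp only [map_smul, e, smul_mul_assoc, mul_smul_comm, smul_sub, smul_add])

theorem superCommBilin_apply (hA : IsSuperCommAlgebra gr) {D : Module.End ℝ A} {d ε : ZMod 2}
    {a : A} (hD : IsHomogeneousOp gr gr d D) (ha : a ∈ gr ε) :
    superCommBilin hA.isCompl D a = superComm D d ε a := by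
  -- Conjugation by the parity involution yields `sgn d` without prior knowledge of `d`. This is why
  -- `superCommBilin` can be bilinear and still produce the sign `sgn (d * ε)` for odd `a`.
  have e : parityInvolution hA.isCompl * D * parityInvolution hA.isCompl = sgn d • D := by
    refine linearMap_ext_of_homogeneous hA.isCompl fun i b hb => ?_
    rw [Module.End.mul_apply, Module.End.mul_apply, parityInvolution_apply hA.isCompl hb, map_smul,
      map_smul, parityInvolution_apply hA.isCompl (hD i b hb), smul_smul, sgn_add, ← mul_assoc,
      sgn_mul_self, one_mul, LinearMap.smul_apply]
  rw [superCommBilin, LinearMap.mk₂_apply, e, superComm]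
  have z : LinearMap.mulLeft ℝ (0 : A) = 0 := by ext; simp
  congr 1
  rcases eq_zero_or_one ε with rfl | rfl
  · simp [Submodule.projection_apply_of_mem_left hA.isCompl ha, z,
      Submodule.projection_apply_of_mem_right hA.isCompl.symm ha]
  · simp [Submodule.projection_apply_of_mem_right hA.isCompl ha, z,
      Submodule.projection_apply_of_mem_left hA.isCompl.symm ha]

/-- The brackets `[a₁, …, aₙ]_D` as multilinear maps, linearly in `D`. -/
def derivedBrackets (h : IsCompl (gr 0) (gr 1)) :
    ∀ n : ℕ, Module.End ℝ A →ₗ[ℝ] MultilinearMap ℝ (fun _ : Fin n => A) A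
  | 0 => (MultilinearMap.constLinearEquivOfIsEmpty (R := ℝ) (S := ℝ) (M₁ := fun _ : Fin 0 => A)
      (M₂ := A)).toLinearMap ∘ₗ LinearMap.applyₗ (1 : A)
  | n + 1 => (multilinearCurryLeftEquiv ℝ (fun _ : Fin (n + 1) => A) A).symm.toLinearMap ∘ₗ
      (LinearMap.llcomp ℝ A _ _ (derivedBrackets h n)) ∘ₗ superCommBilin h

theorem derivedBrackets_apply (hA : IsSuperCommAlgebra gr) : ∀ (n : ℕ) {D : Module.End ℝ A}
    {d : ZMod 2} (_ : IsHomogeneousOp gr gr d D) (ε : Fin n → ZMod 2) (a : Fin n → A),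
    (∀ i, a i ∈ gr (ε i)) → derivedBrackets hA.isCompl n D a =
      iteratedCommutator D d (List.ofFn fun i => (ε i, a i)) 1
  | 0, D, d, hD, ε, a, ha => by
    simp [derivedBrackets, iteratedCommutator]
  | n + 1, D, d, hD, ε, a, ha => by
    rw [List.ofFn_succ, iteratedCommutator_cons]
    rw [← derivedBrackets_apply hA n (isHomogeneousOp_superComm hA hD (ha 0)) _ _
      (fun i => ha i.succ), ← superCommBilin_apply hA hD (ha 0)]
    rfl

theorem list_ofFn_eq_take_append_drop {α : Type*} {n : ℕ} (f : Fin n → α) (i j : Fin n)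
    (hij : (i : ℕ) + 1 = j) :
    List.ofFn f = (List.ofFn f).take i ++ f i :: f j :: (List.ofFn f).drop (i + 2) := by
  have h1 : (List.ofFn f).drop i = f i :: (List.ofFn f).drop (i + 1) := by
    rw [List.drop_eq_getElem_cons (by simp)]; simp
  have h2 : (List.ofFn f).drop (i + 1) = f j :: (List.ofFn f).drop (i + 2) := by
    rw [List.drop_eq_getElem_cons (by simp; omega)]; simp only [List.getElem_ofFn]; congr 2; exact Fin.ext hij
  conv_lhs => rw [← List.take_append_drop i (List.ofFn f), h1, h2]

theorem list_ofFn_comp_swap {α : Type*} {n : ℕ} (f : Fin n → α) (i j : Fin n)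
    (hij : (i : ℕ) + 1 = j) :
    List.ofFn (f ∘ Equiv.swap i j) =
      (List.ofFn f).take i ++ f j :: f i :: (List.ofFn f).drop (i + 2) := by
  rw [list_ofFn_eq_take_append_drop _ i j hij]
  congr 1
  · refine List.ext_getElem (by simp) fun k hk hk' => ?_
    simp only [List.length_take, List.length_ofFn, lt_min_iff] at hk
    simp only [List.getElem_take, List.getElem_ofFn, Function.comp]
    rw [Equiv.swap_apply_of_ne_of_ne]
    · intro h; rw [Fin.ext_iff] at h; simp at h; omega
    · intro h; rw [Fin.ext_iff] at h; simp at h; omega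
  · congr 1
    · simp
    congr 1
    · simp
    refine List.ext_getElem (by simp) fun k hk hk' => ?_
    simp only [List.getElem_drop, List.getElem_ofFn, Function.comp]
    rw [Equiv.swap_apply_of_ne_of_ne]
    · intro h; rw [Fin.ext_iff] at h; simp at h; omega
    · intro h; rw [Fin.ext_iff] at h; simp at h; omega

/-- Expanding `Δ * Δ = 0` and evaluating at `1` gives a vanishing signed sum of `D Sᶜ (m S)`. Each
summand differs from the nested bracket by a multiple of `m S * m Sᶜ`, and these products cancel
between `S` and `Sᶜ`. -/
theorem jacobi_of_sq_zero (hA : IsSuperCommAlgebra gr) {Δ : Module.End ℝ A}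
    (hΔ : IsHomogeneousOp gr gr 1 Δ) (hsq : Δ * Δ = 0) {n : ℕ} (f : Fin n → ZMod 2 × A)
    (hf : ∀ i, (f i).2 ∈ gr (f i).1) :
    ∑ S : Finset (Fin n), koszulSign (fun i => (f i).1) S •
      iteratedCommutator Δ 1 ((∑ i ∈ S, (f i).1 + 1, iteratedCommutator Δ 1 (sublistOf f S) 1) ::
        sublistOf f Sᶜ) 1 = 0 := by
  have hl : ∀ S, ∀ y ∈ sublistOf f S, y.2 ∈ gr y.1 := by
    intro S y hy
    rw [sublistOf, List.mem_ofFn'] at hy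
    obtain ⟨i, rfl⟩ := hy
    exact hf _
  set k : Finset (Fin n) → ℝ := koszulSign fun i => (f i).1 with hk
  set p : Finset (Fin n) → ZMod 2 := fun S => ∑ i ∈ S, (f i).1 with hp
  set D : Finset (Fin n) → Module.End ℝ A := fun S => iteratedCommutator Δ 1 (sublistOf f S)
    with hD
  set m : Finset (Fin n) → A := fun S => D S 1 with hm
  have hm_mem : ∀ S, m S ∈ gr (p S + 1) := by
    intro S
    have := isHomogeneousOp_iteratedCommutator hA _ (hl S) hΔ 0 1 hA.one_mem
    rw [sum_map_fst_sublistOf] at this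
    rwa [show (0 : ZMod 2) + (1 + ∑ i ∈ S, (f i).1) = p S + 1 by simp [hp, add_comm]] at this
  have hkc : ∀ S, k Sᶜ = sgn (p S * p Sᶜ) * k S := fun S => koszulSign_compl _ S
  -- With the inner bracket `m S` moved to the last place, the outer bracket is the supercommutator
  -- of `D Sᶜ` with `m S` evaluated at `1`: the value `D Sᶜ (m S)` and a correction proportional to
  -- `m S * D Sᶜ 1`.
  have key : ∀ S, k S • iteratedCommutator Δ 1 ((p S + 1, m S) :: sublistOf f Sᶜ) 1 =
      (k Sᶜ * sgn (1 * p Sᶜ)) • (D Sᶜ * D S) 1 - (k S * sgn (1 + p S)) • (m S * m Sᶜ) := by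
    intro S
    rw [iteratedCommutator_cons_eq_append hA (x := (p S + 1, m S)) (hm_mem S) _ (hl Sᶜ),
      iteratedCommutator_append, sum_map_fst_sublistOf, iteratedCommutator_cons]
    simp only [iteratedCommutator, superComm, LinearMap.smul_apply, LinearMap.sub_apply,
      Module.End.mul_apply, LinearMap.mulLeft_apply, mul_one, smul_sub, smul_smul]
    rw [hkc S]
    change (_ • D Sᶜ (m S) - _ • (m S * m Sᶜ) : A) = _
    change ((k S * sgn ((p S + 1) * p Sᶜ)) • D Sᶜ (m S) -
      (k S * (sgn ((p S + 1) * p Sᶜ) * sgn ((1 + p Sᶜ) * (p S + 1)))) • (m S * m Sᶜ) : A) =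
      (sgn (p S * p Sᶜ) * k S * sgn (1 * p Sᶜ)) • D Sᶜ (m S) - _
    rw [← sgn_add]
    have e1 : k S * sgn ((p S + 1) * p Sᶜ) = sgn (p S * p Sᶜ) * k S * sgn (1 * p Sᶜ) := by
      rw [add_mul, sgn_add]; ring
    rw [e1]
    congr 4
    · generalize p S = a
      generalize p Sᶜ = b
      revert a b; decide
  rw [Finset.sum_congr rfl fun S _ => key S, Finset.sum_sub_distrib]
  have h1 : ∑ S, (k Sᶜ * sgn (1 * p Sᶜ)) • (D Sᶜ * D S) 1 = 0 := by
    have := iteratedCommutator_mul f Δ Δ 1 1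
    rw [hsq] at this
    have h0 : iteratedCommutator (0 : Module.End ℝ A) (1 + 1) (List.ofFn f) = 0 := by
      have := iteratedCommutator_smul (List.ofFn f) 0 (0 : Module.End ℝ A) (1 + 1)
      rwa [zero_smul, zero_smul] at this
    rw [h0] at this
    have := congrArg (fun T : Module.End ℝ A => T 1) this.symm
    simpa [LinearMap.sum_apply] using this
  have h2 : ∑ S, (k S * sgn (1 + p S)) • (m S * m Sᶜ) = 0 := by
    -- Reindexing by `S ↦ Sᶜ` and interchanging the factors, of parities `p S + 1` and `p Sᶜ + 1`,
    -- reverses the sign of every term.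
    have e : ∑ S, (k S * sgn (1 + p S)) • (m S * m Sᶜ) =
        -∑ S, (k S * sgn (1 + p S)) • (m S * m Sᶜ) := by
      conv_lhs => rw [← Equiv.sum_comp (compl_involutive (α := Finset (Fin n))).toPerm]
      rw [← Finset.sum_neg_distrib]
      refine Finset.sum_congr rfl fun S _ => ?_
      change (k Sᶜ * sgn (1 + p Sᶜ)) • (m Sᶜ * m Sᶜᶜ) = _
      rw [compl_compl, hkc, hA.supercomm (hm_mem Sᶜ) (hm_mem S), smul_smul, ← neg_smul]
      congr 1
      have : sgn (p S * p Sᶜ) * sgn (1 + p Sᶜ) * sgn ((p Sᶜ + 1) * (p S + 1)) = - sgn (1 + p S) := by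
        rw [← sgn_add, ← sgn_add, ← sgn_add_one]
        congr 1
        generalize p S = a
        generalize p Sᶜ = b
        revert a b; decide
      linear_combination k S * this
    exact eq_zero_of_eq_neg e
  rw [h1, h2, sub_zero]

/-- An odd operator of square zero on a supercommutative algebra generates a homotopy
BV-algebra. -/
theorem isHomotopyBV_of_sq_zero (hA : IsSuperCommAlgebra gr) {Δ : Module.End ℝ A}
    (hΔ : IsHomogeneousOp gr gr 1 Δ) (hsq : Δ * Δ = 0) : IsHomotopyBV gr Δ where
  superCommAlgebra := hA
  odd := hΔ
  sq_zero := hsq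
  lInfinity := by
    have hb := fun n => derivedBrackets_apply hA n hΔ
    have hodd : ∀ (n : ℕ) (ε : Fin n → ZMod 2) (a : Fin n → A), (∀ i, a i ∈ gr (ε i)) →
        derivedBrackets hA.isCompl n Δ a ∈ gr (∑ i, ε i + 1) := by
      intro n ε a ha
      rw [hb n ε a ha]
      have := isHomogeneousOp_iteratedCommutator hA (List.ofFn fun i => (ε i, a i))
        (by simp only [List.mem_ofFn']; rintro _ ⟨i, rfl⟩; exact ha i) hΔ 0 1 hA.one_mem
      rw [List.map_ofFn, List.sum_ofFn] at this
      rwa [zero_add, add_comm] at this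
    refine ⟨fun n => derivedBrackets hA.isCompl n Δ, hb, hA.isCompl, hodd, ?_, ?_⟩
    · intro n ε a ha i j hij
      rw [hb n ε a ha, hb n (ε ∘ Equiv.swap i j) (a ∘ Equiv.swap i j) fun k => ha _]
      have e := list_ofFn_comp_swap (fun i => (ε i, a i)) i j hij
      simp only [Function.comp_def] at e ⊢
      rw [e]
      conv_lhs => rw [list_ofFn_eq_take_append_drop (fun i => (ε i, a i)) i j hij]
      rw [iteratedCommutator_append, iteratedCommutator_append,
        iteratedCommutator_swap hA _ _ (x := (ε i, a i)) (y := (ε j, a j)) (ha i) (ha j)]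
      simp
    · intro n ε a ha
      rw [← jacobi_of_sq_zero hA hΔ hsq (fun i => (ε i, a i)) ha]
      refine Finset.sum_congr rfl fun S _ => ?_
      congr 1
      have hS : derivedBrackets hA.isCompl S.card Δ (fun i => a (S.orderEmbOfFin rfl i)) =
          iteratedCommutator Δ 1 (sublistOf (fun i => (ε i, a i)) S) 1 :=
        hb _ (fun i => ε (S.orderEmbOfFin rfl i)) _ fun i => ha _
      have hSm := hodd S.card (fun i => ε (S.orderEmbOfFin rfl i))
        (fun i => a (S.orderEmbOfFin rfl i)) fun i => ha _
      have hs : ∑ i, ε (S.orderEmbOfFin rfl i) = ∑ i ∈ S, ε i := by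
        conv_rhs => rw [← Finset.map_orderEmbOfFin_univ S rfl, Finset.sum_map]
        rfl
      rw [hs] at hSm
      rw [hb (Sᶜ.card + 1) (Fin.cons (∑ i ∈ S, ε i + 1) fun i => ε (Sᶜ.orderEmbOfFin rfl i)),
        List.ofFn_succ]
      · simp only [Fin.cons_zero, Fin.cons_succ, hS]
        rfl
      · refine Fin.cases hSm fun i => ?_
        simpa using ha _

end Brackets

/-! ### Superderivations of a superalgebra. -/

section SuperDerivations

variable {A : Type*} [Ring A] [Algebra ℝ A] {gr : ZMod 2 → Submodule ℝ A}

/-- `D` is a derivation of parity `d` of a superalgebra. -/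
structure IsSuperDerivation (gr : ZMod 2 → Submodule ℝ A) (d : ZMod 2) (D : Module.End ℝ A) :
    Prop where
  mem : ∀ {i : ZMod 2} {a : A}, a ∈ gr i → D a ∈ gr (i + d)
  leibniz : ∀ {i : ZMod 2} {a : A}, a ∈ gr i → ∀ b : A, D (a * b) = D a * b + sgn (d * i) • (a * D b)

namespace IsSuperDerivation

variable {d : ZMod 2} {D D' : Module.End ℝ A}

theorem map_one (h : IsSuperDerivation gr d D) (h1 : (1 : A) ∈ gr 0) : D 1 = 0 := by
  have := h.leibniz h1 1
  simpa using this

protected theorem zero : IsSuperDerivation gr d (0 : Module.End ℝ A) where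
  mem _ := by simp
  leibniz _ _ := by simp

protected theorem add (h : IsSuperDerivation gr d D) (h' : IsSuperDerivation gr d D') :
    IsSuperDerivation gr d (D + D') where
  mem ha := add_mem (h.mem ha) (h'.mem ha)
  leibniz ha b := by
    simp only [LinearMap.add_apply, h.leibniz ha, h'.leibniz ha, add_mul, mul_add, smul_add]; abel

protected theorem smul (c : ℝ) (h : IsSuperDerivation gr d D) :
    IsSuperDerivation gr d (c • D) where
  mem ha := Submodule.smul_mem _ _ (h.mem ha)
  leibniz ha b := by
    simp only [LinearMap.smul_apply, h.leibniz ha, smul_mul_assoc, mul_smul_comm, smul_add,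
      smul_comm c]

protected theorem sub (h : IsSuperDerivation gr d D) (h' : IsSuperDerivation gr d D') :
    IsSuperDerivation gr d (D - D') := by
  have e : D - D' = D + (-1 : ℝ) • D' := by
    ext a
    simp [sub_eq_add_neg]
  rw [e]
  exact h.add (h'.smul (-1))

protected theorem sum {ι : Type*} (s : Finset ι) {F : ι → Module.End ℝ A}
    (h : ∀ i ∈ s, IsSuperDerivation gr d (F i)) : IsSuperDerivation gr d (∑ i ∈ s, F i) := by
  classical
  induction s using Finset.induction_on with
  | empty => simpa using IsSuperDerivation.zero
  | insert i s hi ih =>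
    rw [Finset.sum_insert hi]
    exact (h i (by simp)).add (ih fun j hj => h j (by simp [hj]))

theorem mulLeft_mul (hA : IsSuperCommAlgebra gr) {j : ZMod 2} {f : A} (hf : f ∈ gr j)
    (h : IsSuperDerivation gr d D) : IsSuperDerivation gr (j + d) (LinearMap.mulLeft ℝ f * D) where
  mem {i a} ha := by
    have := hA.mul_mem hf (h.mem ha)
    rwa [show j + (i + d) = i + (j + d) by abel] at this
  leibniz {i a} ha b := by
    simp only [Module.End.mul_apply, LinearMap.mulLeft_apply, h.leibniz ha, mul_add, mul_smul_comm,
      ← mul_assoc, hA.supercomm hf ha, smul_mul_assoc, smul_smul, add_mul, sgn_add]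
    rw [mul_comm (sgn (j * i))]

/-- For odd `D` the two mixed terms `D a * D b` cancel, so the square is half the supercommutator of
`D` with itself and again a derivation. -/
theorem sq (h : IsSuperDerivation gr 1 D) : IsSuperDerivation gr 0 (D * D) where
  mem {i a} ha := by
    have := h.mem (h.mem ha)
    rwa [add_assoc, CharTwo.add_self_eq_zero] at this
  leibniz {i a} ha b := by
    simp only [Module.End.mul_apply, h.leibniz ha, map_add, h.leibniz (h.mem ha), map_smul, smul_add,
      smul_smul, one_mul, zero_mul, sgn_zero, one_smul, sgn_add_one, sgn_mul_self, neg_smul]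
    abel

/-- Transport along an isomorphism. -/
theorem conj {B : Type*} [Ring B] [Algebra ℝ B] {gr' : ZMod 2 → Submodule ℝ B} (e : B ≃ₐ[ℝ] A)
    (he : ∀ i b, e b ∈ gr i ↔ b ∈ gr' i) (h : IsSuperDerivation gr d D) :
    IsSuperDerivation gr' d (e.toLinearEquiv.symm.conj D) where
  mem {i b} hb := by
    rw [← he]
    simpa [LinearEquiv.conj_apply] using h.mem ((he i b).2 hb)
  leibniz {i a} ha b := by
    apply e.injective
    have := h.leibniz ((he i a).2 ha) (e b)
    simpa [LinearEquiv.conj_apply] using this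

end IsSuperDerivation

end SuperDerivations

/-! ### The exterior algebra: supercommutativity and contractions. -/

section Exterior

open CliffordAlgebra

variable {V : Type*} [AddCommGroup V] [Module ℝ V]

/-- The exterior algebra with its `ℤ/2`-grading. -/
abbrev extGr (V : Type*) [AddCommGroup V] [Module ℝ V] (i : ZMod 2) :
    Submodule ℝ (ExteriorAlgebra ℝ V) :=
  CliffordAlgebra.evenOdd (0 : QuadraticForm ℝ V) i

theorem ι_mul_eq_involute_mul_ι (m : V) (b : ExteriorAlgebra ℝ V) :
    ExteriorAlgebra.ι ℝ m * b = involute b * ExteriorAlgebra.ι ℝ m := by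
  induction b using CliffordAlgebra.induction with
  | algebraMap r => simp [Algebra.commutes]
  | ι n =>
    rw [involute_ι, neg_mul, eq_neg_iff_add_eq_zero]
    exact ExteriorAlgebra.ι_add_mul_swap m n
  | add a b ha hb => rw [mul_add, ha, hb, map_add, add_mul]
  | mul a b ha hb => rw [← mul_assoc, ha, mul_assoc, hb, map_mul, mul_assoc]

theorem involute_eq_sgn_smul {i : ZMod 2} {a : ExteriorAlgebra ℝ V} (ha : a ∈ extGr V i) :
    involute a = sgn i • a := by
  rcases eq_zero_or_one i with rfl | rfl
  · simp [involute_eq_of_mem_even ha]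
  · simp [involute_eq_of_mem_odd ha]

theorem isSuperCommAlgebra_exterior : IsSuperCommAlgebra (extGr V) where
  isCompl := evenOdd_isCompl _
  one_mem := SetLike.GradedOne.one_mem
  mul_mem ha hb := SetLike.mul_mem_graded (A := extGr V) ha hb
  supercomm {i j a b} ha hb := by
    -- For fixed homogeneous `b`, moving `a` past `b` applies either the identity or the grade
    -- involution to `a`. Both are algebra homomorphisms, so generators suffice and `a` need not be
    -- homogeneous.
    have h0 : ∀ a : ExteriorAlgebra ℝ V, a * b = b * (if j = 0 then a else involute a) := by
      intro a
      induction a using CliffordAlgebra.induction with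
      | algebraMap r => simp [Algebra.commutes]
      | ι n =>
        have := ι_mul_eq_involute_mul_ι n b
        rw [involute_eq_sgn_smul hb] at this
        rw [show CliffordAlgebra.ι _ n = ExteriorAlgebra.ι ℝ n from rfl, this]
        rcases eq_zero_or_one j with rfl | rfl
        · simp
        · simp only [sgn_one, neg_smul, one_smul, one_ne_zero, if_false, ExteriorAlgebra.ι, involute_ι,
            neg_mul, mul_neg]
      | add a b ha hb => split_ifs with h <;> simp_all [add_mul, mul_add]
      | mul a c ha hc =>
        split_ifs with h
        · simp only [h, if_true] at ha hc
          rw [mul_assoc, hc, ← mul_assoc, ha, mul_assoc]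
        · simp only [h, if_false] at ha hc
          rw [mul_assoc, hc, ← mul_assoc, ha, mul_assoc, map_mul]
    rw [h0 a]
    rcases eq_zero_or_one j with rfl | rfl
    · simp
    · rw [if_neg one_ne_zero, involute_eq_sgn_smul ha, mul_one, mul_smul_comm]

theorem contractLeft_mul (d : Module.Dual ℝ V) (a b : ExteriorAlgebra ℝ V) :
    contractLeft (Q := (0 : QuadraticForm ℝ V)) d (a * b) =
      contractLeft (Q := (0 : QuadraticForm ℝ V)) d a * b +
        involute a * contractLeft (Q := (0 : QuadraticForm ℝ V)) d b := by
  induction a using CliffordAlgebra.left_induction with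
  | algebraMap r =>
    rw [contractLeft_algebraMap_mul, contractLeft_algebraMap, zero_mul, zero_add, AlgHom.commutes]
  | add x y hx hy => simp only [add_mul, map_add, hx, hy]; abel
  | ι_mul x m hx =>
    rw [mul_assoc, contractLeft_ι_mul, hx, contractLeft_ι_mul, map_mul, involute_ι]
    simp only [sub_mul, mul_add, smul_mul_assoc, neg_mul, mul_assoc]
    abel

theorem isSuperDerivation_contractLeft (d : Module.Dual ℝ V) :
    IsSuperDerivation (extGr V) 1 (contractLeft (Q := (0 : QuadraticForm ℝ V)) d) where
  mem {i a} ha := by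
    induction a, ha using evenOdd_induction (Q := (0 : QuadraticForm ℝ V)) with
    | range_ι_pow v h =>
      rcases eq_zero_or_one i with rfl | rfl
      · simp only [ZMod.val_zero, pow_zero, Submodule.mem_one] at h
        obtain ⟨r, rfl⟩ := h
        rw [contractLeft_algebraMap]
        exact zero_mem _
      · simp only [ZMod.val_one, pow_one, LinearMap.mem_range] at h
        obtain ⟨m, rfl⟩ := h
        rw [contractLeft_ι, CharTwo.add_self_eq_zero]
        exact SetLike.algebraMap_mem_graded _ _
    | add x y hx hy h1 h2 => rw [map_add]; exact add_mem h1 h2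
    | ι_mul_ι_mul m n x hx ih =>
      rw [mul_assoc, contractLeft_ι_mul, contractLeft_ι_mul, mul_sub, mul_smul_comm]
      have h1 : ∀ (m : V) {j} {y : ExteriorAlgebra ℝ V}, y ∈ extGr V j →
          ExteriorAlgebra.ι ℝ m * y ∈ extGr V (1 + j) := fun m j y hy =>
        isSuperCommAlgebra_exterior.mul_mem (ι_mem_evenOdd_one _ m) hy
      refine sub_mem (Submodule.smul_mem _ _ ?_) (sub_mem (Submodule.smul_mem _ _ ?_) ?_)
      · rw [add_comm]; exact h1 n hx
      · rw [add_comm]; exact h1 m hx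
      · have := h1 m (h1 n ih)
        rwa [← add_assoc, CharTwo.add_self_eq_zero, zero_add] at this
  leibniz {i a} ha b := by
    rw [contractLeft_mul, involute_eq_sgn_smul ha, one_mul, smul_mul_assoc]

theorem contractLeft_map {W : Type*} [AddCommGroup W] [Module ℝ W] (M : V →ₗ[ℝ] W)
    (d : Module.Dual ℝ W) (a : ExteriorAlgebra ℝ V) :
    contractLeft (Q := (0 : QuadraticForm ℝ W)) d (ExteriorAlgebra.map M a) =
      ExteriorAlgebra.map M (contractLeft (Q := (0 : QuadraticForm ℝ V)) (d ∘ₗ M) a) := by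
  induction a using CliffordAlgebra.left_induction with
  | algebraMap r => rw [AlgHom.commutes, contractLeft_algebraMap, contractLeft_algebraMap, map_zero]
  | add x y hx hy => simp only [map_add, hx, hy]
  | ι_mul x m hx =>
    have e : ExteriorAlgebra.map M (CliffordAlgebra.ι 0 m) = CliffordAlgebra.ι 0 (M m) :=
      ExteriorAlgebra.map_apply_ι M m
    rw [map_mul, e, contractLeft_ι_mul, contractLeft_ι_mul, hx, map_sub, map_smul, map_mul, e]
    rfl

theorem map_mem_extGr {W : Type*} [AddCommGroup W] [Module ℝ W] (M : V →ₗ[ℝ] W) {i : ZMod 2}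
    {a : ExteriorAlgebra ℝ V} (ha : a ∈ extGr V i) : ExteriorAlgebra.map M a ∈ extGr W i := by
  induction a, ha using evenOdd_induction (Q := (0 : QuadraticForm ℝ V)) with
  | range_ι_pow v h =>
    rcases eq_zero_or_one i with rfl | rfl
    · simp only [ZMod.val_zero, pow_zero, Submodule.mem_one] at h
      obtain ⟨r, rfl⟩ := h
      rw [AlgHom.commutes]
      exact SetLike.algebraMap_mem_graded _ _
    · simp only [ZMod.val_one, pow_one, LinearMap.mem_range] at h
      obtain ⟨m, rfl⟩ := h
      have e : ExteriorAlgebra.map M (CliffordAlgebra.ι 0 m) = CliffordAlgebra.ι 0 (M m) :=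
        ExteriorAlgebra.map_apply_ι M m
      rw [e]
      exact ι_mem_evenOdd_one _ _
  | add x y hx hy h1 h2 => rw [map_add]; exact add_mem h1 h2
  | ι_mul_ι_mul m n x hx ih =>
    have e : ∀ m, ExteriorAlgebra.map M (CliffordAlgebra.ι 0 m) = CliffordAlgebra.ι 0 (M m) :=
      ExteriorAlgebra.map_apply_ι M
    rw [map_mul, map_mul, e, e]
    have := isSuperCommAlgebra_exterior.mul_mem (ι_mul_ι_mem_evenOdd_zero _ (M m) (M n)) ih
    rwa [zero_add] at this

end Exterior

/-! ### Calculus of smooth functions on open sets. -/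

section Smooth

variable {κ κ' : Type} [Fintype κ] [Fintype κ']

theorem smooth_ext {Ω : Opens (κ → ℝ)} {f g : smooth Ω} (h : ∀ y, f.1 y = g.1 y) : f = g :=
  Subtype.ext (funext h)

theorem smooth_contDiffAt {Ω : Opens (κ → ℝ)} (f : smooth Ω) (y : Ω) :
    ContDiffAt ℝ ∞ (extZero f.1) y.1 :=
  ContDiffOn.contDiffAt f.2 (Ω.isOpen.mem_nhds y.2)

theorem smooth_differentiableAt {Ω : Opens (κ → ℝ)} (f : smooth Ω) (y : Ω) :
    DifferentiableAt ℝ (extZero f.1) y.1 :=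
  (smooth_contDiffAt f y).differentiableAt (by simp)

omit [Fintype κ] in
theorem extZero_eventuallyEq {Ω : Opens (κ → ℝ)} (f : Ω → ℝ) (F : (κ → ℝ) → ℝ) (y : Ω)
    (h : ∀ z (hz : z ∈ Ω), f ⟨z, hz⟩ = F z) : extZero f =ᶠ[nhds y.1] F := by
  filter_upwards [Ω.isOpen.mem_nhds y.2] with z hz
  have hz' : z ∈ Ω := hz
  rw [extZero_apply _ hz', h]

open scoped Classical in
theorem smoothPartial_apply {Ω : Opens (κ → ℝ)} (i : κ) (f : smooth Ω) (y : Ω) :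
    (smoothPartial Ω i f).1 y = fderiv ℝ (extZero f.1) y.1 (Pi.single i 1) := rfl

theorem smoothPartial_mul {Ω : Opens (κ → ℝ)} (i : κ) (f g : smooth Ω) :
    smoothPartial Ω i (f * g) = smoothPartial Ω i f * g + f * smoothPartial Ω i g := by
  refine smooth_ext fun y => ?_
  have h : extZero (f * g).1 =ᶠ[nhds y.1] extZero f.1 * extZero g.1 :=
    extZero_eventuallyEq _ _ y fun z hz => by simp [extZero_apply _ hz]
  rw [smoothPartial_apply, h.fderiv_eq, fderiv_mul (smooth_differentiableAt f y)
    (smooth_differentiableAt g y)]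
  simp only [Subalgebra.coe_add, Subalgebra.coe_mul, Pi.add_apply, Pi.mul_apply, smoothPartial_apply,
    extZero_apply _ y.2, add_apply, smul_apply, smul_eq_mul]
  ring

/-- The iterated partials are values of the second Fréchet derivative, which is symmetric. -/
theorem smoothPartial_comm {Ω : Opens (κ → ℝ)} (i j : κ) (f : smooth Ω) :
    smoothPartial Ω i (smoothPartial Ω j f) = smoothPartial Ω j (smoothPartial Ω i f) := by
  classical
  refine smooth_ext fun y => ?_
  have hd : DifferentiableAt ℝ (fderiv ℝ (extZero f.1)) y.1 :=
    ((smooth_contDiffAt f y).fderiv_right (m := ∞) (by simp)).differentiableAt (by simp)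
  have h : ∀ i j, (smoothPartial Ω i (smoothPartial Ω j f)).1 y =
      fderiv ℝ (fderiv ℝ (extZero f.1)) y.1 (Pi.single i 1) (Pi.single j 1) := by
    intro i j
    have e : extZero (smoothPartial Ω j f).1 =ᶠ[nhds y.1]
        fun z => fderiv ℝ (extZero f.1) z (Pi.single j 1) :=
      extZero_eventuallyEq _ _ y fun z hz => by rw [smoothPartial_apply]
    rw [smoothPartial_apply, e.fderiv_eq,
      fderiv_clm_apply hd (differentiableAt_const _)]
    simp only [fderiv_fun_const, Pi.zero_apply, ContinuousLinearMap.comp_zero, zero_add,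
      ContinuousLinearMap.flip_apply]
  rw [h, h]
  refine (smooth_contDiffAt f y).isSymmSndFDerivAt ?_ _ _
  rw [minSmoothness_of_isRCLikeNormedField]
  exact WithTop.coe_le_coe.2 le_top

open scoped Classical in
theorem smoothPartial_smoothCoord {Ω : Opens (κ → ℝ)} (i j : κ) :
    smoothPartial Ω i (smoothCoord Ω j) = if i = j then 1 else 0 := by
  refine smooth_ext fun y => ?_
  have e : extZero (smoothCoord Ω j).1 =ᶠ[nhds y.1]
      (ContinuousLinearMap.proj j : (κ → ℝ) →L[ℝ] ℝ) :=
    extZero_eventuallyEq _ _ y fun z hz => rfl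
  rw [smoothPartial_apply, e.fderiv_eq, ContinuousLinearMap.fderiv,
    ContinuousLinearMap.proj_apply, Pi.single_apply]
  split_ifs with h1 h2 h2
  · rfl
  · exact absurd h1.symm h2
  · exact absurd h2.symm h1
  · rfl

open scoped Classical in
theorem smoothPartial_smoothPullback {Ω : Opens (κ → ℝ)} {Ω' : Opens (κ' → ℝ)}
    (L : (κ' → ℝ) →ₗ[ℝ] (κ → ℝ)) (hL : ∀ y ∈ Ω', L y ∈ Ω) (i : κ') (f : smooth Ω) (y : Ω') :
    (smoothPartial Ω' i (smoothPullback L hL f)).1 y =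
      fderiv ℝ (extZero f.1) (L y) (L (Pi.single i 1)) := by
  have e : extZero (smoothPullback L hL f).1 =ᶠ[nhds y.1] extZero f.1 ∘ L.toContinuousLinearMap :=
    extZero_eventuallyEq _ _ y fun z hz => by
      have : L z ∈ Ω := hL z hz
      simp only [Function.comp, LinearMap.coe_toContinuousLinearMap', extZero_apply _ this]
      rfl
  have hd : DifferentiableAt ℝ (extZero f.1) (L.toContinuousLinearMap y) :=
    smooth_differentiableAt f ⟨L y, hL _ y.2⟩
  rw [smoothPartial_apply, e.fderiv_eq, fderiv_comp _ hd
    L.toContinuousLinearMap.differentiableAt, ContinuousLinearMap.fderiv]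
  rfl

open scoped Classical in
theorem smoothPartial_smoothPullback_of_single {Ω : Opens (κ → ℝ)} {Ω' : Opens (κ' → ℝ)}
    {L : (κ' → ℝ) →ₗ[ℝ] (κ → ℝ)} (hL : ∀ y ∈ Ω', L y ∈ Ω) {i : κ'} {j : κ}
    (h : L (Pi.single i 1) = Pi.single j 1) (f : smooth Ω) :
    smoothPartial Ω' i (smoothPullback L hL f) = smoothPullback L hL (smoothPartial Ω j f) := by
  refine smooth_ext fun y => ?_
  rw [smoothPartial_smoothPullback, h]
  rfl

open scoped Classical in
theorem smoothPartial_smoothPullback_of_zero {Ω : Opens (κ → ℝ)} {Ω' : Opens (κ' → ℝ)}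
    {L : (κ' → ℝ) →ₗ[ℝ] (κ → ℝ)} (hL : ∀ y ∈ Ω', L y ∈ Ω) {i : κ'}
    (h : L (Pi.single i 1) = 0) (f : smooth Ω) :
    smoothPartial Ω' i (smoothPullback L hL f) = 0 := by
  refine smooth_ext fun y => ?_
  rw [smoothPartial_smoothPullback, h, map_zero]
  rfl

end Smooth

/-! ### Functions on superdomains and their partial derivatives. -/

section SuperFunctions

variable {κ κ' ν ν' : Type} [Fintype κ] [Fintype κ'] [Fintype ν] [Fintype ν']
  {Ω : Opens (κ → ℝ)} {Ω' : Opens (κ' → ℝ)}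

namespace SuperFun

/-- The function `f ⊗ w`. -/
def tmul (f : smooth Ω) (w : ExteriorAlgebra ℝ (ν → ℝ)) : SuperFun Ω ν := f ⊗ₜ[ℝ] w

theorem tmul_mul_tmul (f g : smooth Ω) (w z : ExteriorAlgebra ℝ (ν → ℝ)) :
    tmul f w * tmul g z = tmul (f * g) (w * z) :=
  Algebra.TensorProduct.tmul_mul_tmul f g w z

theorem one_eq_tmul : (1 : SuperFun Ω ν) = tmul 1 1 := rfl

theorem tmul_smul (c : ℝ) (f : smooth Ω) (w : ExteriorAlgebra ℝ (ν → ℝ)) :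
    tmul f (c • w) = c • tmul f w :=
  TensorProduct.tmul_smul c f w

theorem tmul_add (f : smooth Ω) (w z : ExteriorAlgebra ℝ (ν → ℝ)) :
    tmul f (w + z) = tmul f w + tmul f z :=
  TensorProduct.tmul_add f w z

theorem add_tmul (f g : smooth Ω) (w : ExteriorAlgebra ℝ (ν → ℝ)) :
    tmul (f + g) w = tmul f w + tmul g w :=
  TensorProduct.add_tmul f g w

theorem tmul_zero (f : smooth Ω) : tmul f (0 : ExteriorAlgebra ℝ (ν → ℝ)) = 0 :=
  TensorProduct.tmul_zero _ f

theorem zero_tmul (w : ExteriorAlgebra ℝ (ν → ℝ)) : tmul (0 : smooth Ω) w = 0 :=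
  TensorProduct.zero_tmul _ w

@[elab_as_elim]
theorem induction {motive : SuperFun Ω ν → Prop} (zero : motive 0)
    (tmul : ∀ f w, motive (tmul f w)) (add : ∀ x y, motive x → motive y → motive (x + y))
    (x : SuperFun Ω ν) : motive x :=
  TensorProduct.induction_on x zero tmul add

theorem linearMap_ext {B : Type*} [AddCommGroup B] [Module ℝ B] {D D' : SuperFun Ω ν →ₗ[ℝ] B}
    (h : ∀ f w, D (tmul f w) = D' (tmul f w)) : D = D' :=
  TensorProduct.ext' h

theorem tmul_mem {i : ZMod 2} (f : smooth Ω) {w : ExteriorAlgebra ℝ (ν → ℝ)}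
    (hw : w ∈ extGr (ν → ℝ) i) : tmul f w ∈ gr Ω ν i :=
  ⟨f ⊗ₜ[ℝ] ⟨w, hw⟩, rfl⟩

@[elab_as_elim]
theorem gr_induction {i : ZMod 2} {motive : (x : SuperFun Ω ν) → x ∈ gr Ω ν i → Prop}
    (zero : motive 0 (zero_mem _))
    (tmul : ∀ f w (hw : w ∈ extGr (ν → ℝ) i), motive (tmul f w) (tmul_mem f hw))
    (add : ∀ x y hx hy, motive x hx → motive y hy → motive (x + y) (add_mem hx hy))
    (x : SuperFun Ω ν) (hx : x ∈ gr Ω ν i) : motive x hx := by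
  obtain ⟨t, ht⟩ := id hx
  induction t using TensorProduct.induction_on generalizing x with
  | zero =>
    have e : x = 0 := ht.symm.trans (LinearMap.map_zero (LinearMap.lTensor (smooth Ω)
      (CliffordAlgebra.evenOdd (0 : QuadraticForm ℝ (ν → ℝ)) i).subtype))
    subst e
    exact zero
  | tmul f w =>
    subst ht
    exact tmul f w.1 w.2
  | add y z hy hz =>
    have e := ht.symm.trans (LinearMap.map_add (LinearMap.lTensor (smooth Ω)
      (CliffordAlgebra.evenOdd (0 : QuadraticForm ℝ (ν → ℝ)) i).subtype) y z)
    subst e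
    exact add _ _ ⟨y, rfl⟩ ⟨z, rfl⟩ (hy _ _ rfl) (hz _ _ rfl)

theorem partialD_inl_tmul (i : κ) (f : smooth Ω) (w : ExteriorAlgebra ℝ (ν → ℝ)) :
    partialD Ω ν (Sum.inl i) (tmul f w) = tmul (smoothPartial Ω i f) w := rfl

theorem partialD_inr_tmul (b : ν) (f : smooth Ω) (w : ExteriorAlgebra ℝ (ν → ℝ)) :
    partialD Ω ν (Sum.inr b) (tmul f w) = tmul f (CliffordAlgebra.contractLeft
      (Q := (0 : QuadraticForm ℝ (ν → ℝ))) (LinearMap.proj b : (ν → ℝ) →ₗ[ℝ] ℝ) w) := rfl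

theorem pullback_tmul (L : (κ' → ℝ) →ₗ[ℝ] (κ → ℝ)) (hL : ∀ y ∈ Ω', L y ∈ Ω)
    (M : (ν → ℝ) →ₗ[ℝ] (ν' → ℝ)) (f : smooth Ω) (w : ExteriorAlgebra ℝ (ν → ℝ)) :
    pullback L hL M (tmul f w) = tmul (smoothPullback L hL f) (ExteriorAlgebra.map M w) := rfl

theorem coord_inl (i : κ) : coord Ω ν (Sum.inl i) = tmul (smoothCoord Ω i) 1 := rfl

open scoped Classical in
theorem coord_inr (b : ν) :
    coord Ω ν (Sum.inr b) = tmul 1 (ExteriorAlgebra.ι ℝ (Pi.single b 1 : ν → ℝ)) := rfl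

theorem isSuperCommAlgebra : IsSuperCommAlgebra (gr Ω ν) where
  isCompl := by
    have hE := isSuperCommAlgebra_exterior (V := ν → ℝ)
    constructor
    · rw [Submodule.disjoint_def]
      intro x h0 h1
      -- The grade involution of the exterior factor acts on parity `i` by `sgn i`, so an element of
      -- both parities equals its negative.
      set T : SuperFun Ω ν →ₗ[ℝ] SuperFun Ω ν :=
        LinearMap.lTensor (smooth Ω) (CliffordAlgebra.involute
          (Q := (0 : QuadraticForm ℝ (ν → ℝ)))).toLinearMap with hT
      have key : ∀ i, ∀ x ∈ gr Ω ν i, T x = sgn i • x := by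
        intro i x hx
        induction x, hx using gr_induction with
        | zero => simp
        | tmul f w hw =>
          rw [← tmul_smul, ← involute_eq_sgn_smul hw]
          rfl
        | add x y _ _ hx hy => rw [map_add, smul_add, hx, hy]
      have e0 := key 0 x h0
      have e1 := key 1 x h1
      rw [e0, sgn_zero, sgn_one, one_smul, neg_smul, one_smul] at e1
      exact eq_zero_of_eq_neg e1
    · rw [codisjoint_iff, eq_top_iff]
      intro x _
      induction x using SuperFun.induction with
      | zero => exact zero_mem _
      | tmul f w =>
        obtain ⟨a, ha, b, hb, rfl⟩ := Submodule.mem_sup.1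
          (hE.isCompl.sup_eq_top ▸ Submodule.mem_top (x := w))
        rw [tmul_add]
        exact Submodule.add_mem_sup (tmul_mem f ha) (tmul_mem f hb)
      | add x y hx hy => exact add_mem (hx trivial) (hy trivial)
  one_mem := tmul_mem 1 isSuperCommAlgebra_exterior.one_mem
  mul_mem {i j a b} ha hb := by
    induction a, ha using gr_induction with
    | zero => simp
    | add x y _ _ hx hy => rw [add_mul]; exact add_mem hx hy
    | tmul f w hw =>
      induction b, hb using gr_induction with
      | zero => simp
      | add x y _ _ hx hy => rw [mul_add]; exact add_mem hx hy
      | tmul g z hz =>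
        rw [tmul_mul_tmul]
        exact tmul_mem _ (isSuperCommAlgebra_exterior.mul_mem hw hz)
  supercomm {i j a b} ha hb := by
    induction a, ha using gr_induction with
    | zero => simp
    | add x y _ _ hx hy => rw [add_mul, mul_add, smul_add, hx, hy]
    | tmul f w hw =>
      induction b, hb using gr_induction with
      | zero => simp
      | add x y _ _ hx hy => rw [add_mul, mul_add, smul_add, hx, hy]
      | tmul g z hz =>
        rw [tmul_mul_tmul, tmul_mul_tmul, isSuperCommAlgebra_exterior.supercomm hw hz, tmul_smul,
          mul_comm f g]

/-- Parity of a coordinate of a superdomain. -/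
def idxParity : κ ⊕ ν → ZMod 2
  | Sum.inl _ => 0
  | Sum.inr _ => 1

theorem isSuperDerivation_partialD : ∀ i : κ ⊕ ν,
    IsSuperDerivation (gr Ω ν) (idxParity i) (partialD Ω ν i)
  | Sum.inl i =>
    { mem := fun {j x} hx => by
        induction x, hx using gr_induction with
        | zero => simp
        | add x y _ _ hx hy => rw [map_add]; exact add_mem hx hy
        | tmul f w hw =>
          rw [partialD_inl_tmul, idxParity, add_zero]
          exact tmul_mem _ hw
      leibniz := fun {j a} ha b => by
        rw [idxParity, zero_mul, sgn_zero, one_smul]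
        clear ha
        induction a using SuperFun.induction with
        | zero => simp
        | add x y hx hy => simp only [add_mul, map_add, hx, hy]; abel
        | tmul f w =>
          induction b using SuperFun.induction with
          | zero => simp
          | add x y hx hy => simp only [mul_add, map_add, hx, hy]; abel
          | tmul g z =>
            simp only [tmul_mul_tmul, partialD_inl_tmul, smoothPartial_mul, add_tmul] }
  | Sum.inr b =>
    { mem := fun {j x} hx => by
        induction x, hx using gr_induction with
        | zero => simp
        | add x y _ _ hx hy => rw [map_add]; exact add_mem hx hy
        | tmul f w hw =>
          rw [partialD_inr_tmul, idxParity]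
          exact tmul_mem _ ((isSuperDerivation_contractLeft _).mem hw)
      leibniz := fun {j a} ha c => by
        induction a, ha using gr_induction with
        | zero => simp
        | add x y _ _ hx hy => simp only [add_mul, map_add, hx, hy, smul_add]; abel
        | tmul f w hw =>
          induction c using SuperFun.induction with
          | zero => simp
          | add x y hx hy => simp only [mul_add, map_add, hx, hy, smul_add]; abel
          | tmul g z =>
            simp only [tmul_mul_tmul, partialD_inr_tmul,
              (isSuperDerivation_contractLeft _).leibniz hw, tmul_add, tmul_smul]
            rfl }

theorem partialD_comm (i j : κ ⊕ ν) (x : SuperFun Ω ν) :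
    partialD Ω ν i (partialD Ω ν j x) =
      sgn (idxParity i * idxParity j) • partialD Ω ν j (partialD Ω ν i x) := by
  induction x using SuperFun.induction with
  | zero => simp
  | add x y hx hy => simp only [map_add, hx, hy, smul_add]
  | tmul f w =>
    rcases i with i | i <;> rcases j with j | j <;>
    simp only [partialD_inl_tmul, partialD_inr_tmul, idxParity, mul_zero, sgn_zero,
      one_smul, mul_one, sgn_one, neg_smul]
    · rw [smoothPartial_comm]
    · rw [CliffordAlgebra.contractLeft_comm, ← neg_one_smul ℝ, tmul_smul, neg_one_smul]

open scoped Classical in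
theorem partialD_coord (i j : κ ⊕ ν) :
    partialD Ω ν i (coord Ω ν j) = if i = j then 1 else 0 := by
  rcases i with i | i <;> rcases j with j | j
  · rw [coord_inl, partialD_inl_tmul, smoothPartial_smoothCoord]
    split_ifs with h1 h2 h2
    · rfl
    · simp [h1] at h2
    · simp at h2; exact absurd h2 h1
    · exact zero_tmul _
  · rw [coord_inr, partialD_inl_tmul, if_neg (by simp)]
    have : smoothPartial Ω i 1 = 0 := by
      have := smoothPartial_mul i (1 : smooth Ω) 1
      rw [mul_one, mul_one, one_mul] at this
      exact left_eq_add.1 this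
    rw [this, zero_tmul]
  · rw [coord_inl, partialD_inr_tmul, if_neg (by simp), CliffordAlgebra.contractLeft_one, tmul_zero]
  · rw [coord_inr, partialD_inr_tmul, ExteriorAlgebra.ι, CliffordAlgebra.contractLeft_ι,
      LinearMap.proj_apply, Pi.single_apply]
    split_ifs with h1 h2 h2
    · simp; rfl
    · simp [h1] at h2
    · simp at h2; exact absurd h2 h1
    · simp [tmul_zero]

theorem coord_mem : ∀ i : κ ⊕ ν, coord Ω ν i ∈ gr Ω ν (idxParity i)
  | Sum.inl _ => tmul_mem _ isSuperCommAlgebra_exterior.one_mem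
  | Sum.inr _ => tmul_mem _ (CliffordAlgebra.ι_mem_evenOdd_one _ _)

theorem pullback_mem {L : (κ' → ℝ) →ₗ[ℝ] (κ → ℝ)} {hL : ∀ y ∈ Ω', L y ∈ Ω}
    {M : (ν → ℝ) →ₗ[ℝ] (ν' → ℝ)} {i : ZMod 2} {x : SuperFun Ω ν} (hx : x ∈ gr Ω ν i) :
    pullback L hL M x ∈ gr Ω' ν' i := by
  induction x, hx using gr_induction with
  | zero => simp
  | add x y _ _ hx hy => rw [map_add]; exact add_mem hx hy
  | tmul f w hw =>
    rw [pullback_tmul]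
    exact tmul_mem _ (map_mem_extGr M hw)

section Pullback

variable {L : (κ' → ℝ) →ₗ[ℝ] (κ → ℝ)} {hL : ∀ y ∈ Ω', L y ∈ Ω} {M : (ν → ℝ) →ₗ[ℝ] (ν' → ℝ)}

open scoped Classical in
theorem partialD_inl_pullback {i : κ'} {j : κ} (h : L (Pi.single i 1) = Pi.single j 1)
    (x : SuperFun Ω ν) : partialD Ω' ν' (Sum.inl i) (pullback L hL M x) =
      pullback L hL M (partialD Ω ν (Sum.inl j) x) := by
  induction x using SuperFun.induction with
  | zero => simp
  | add x y hx hy => simp only [map_add, hx, hy]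
  | tmul f w =>
    simp only [pullback_tmul, partialD_inl_tmul, smoothPartial_smoothPullback_of_single hL h]

open scoped Classical in
theorem partialD_inl_pullback_of_zero {i : κ'} (h : L (Pi.single i 1) = 0)
    (x : SuperFun Ω ν) : partialD Ω' ν' (Sum.inl i) (pullback L hL M x) = 0 := by
  induction x using SuperFun.induction with
  | zero => simp
  | add x y hx hy => simp only [map_add, hx, hy, add_zero]
  | tmul f w =>
    simp only [pullback_tmul, partialD_inl_tmul, smoothPartial_smoothPullback_of_zero hL h, zero_tmul]

theorem partialD_inr_pullback {b : ν'} {c : ν}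
    (h : (LinearMap.proj b : (ν' → ℝ) →ₗ[ℝ] ℝ) ∘ₗ M = LinearMap.proj c)
    (x : SuperFun Ω ν) : partialD Ω' ν' (Sum.inr b) (pullback L hL M x) =
      pullback L hL M (partialD Ω ν (Sum.inr c) x) := by
  induction x using SuperFun.induction with
  | zero => simp
  | add x y hx hy => simp only [map_add, hx, hy]
  | tmul f w => simp only [pullback_tmul, partialD_inr_tmul, contractLeft_map, h]

theorem partialD_inr_pullback_of_zero {b : ν'}
    (h : (LinearMap.proj b : (ν' → ℝ) →ₗ[ℝ] ℝ) ∘ₗ M = 0)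
    (x : SuperFun Ω ν) : partialD Ω' ν' (Sum.inr b) (pullback L hL M x) = 0 := by
  induction x using SuperFun.induction with
  | zero => simp
  | add x y hx hy => simp only [map_add, hx, hy, add_zero]
  | tmul f w =>
    simp only [pullback_tmul, partialD_inr_tmul, contractLeft_map, h, map_zero,
      LinearMap.zero_apply, tmul_zero]

end Pullback

section Restriction

variable {U V : Opens (κ → ℝ)} (h : V ≤ U)

theorem res_partialD (i : κ ⊕ ν) (x : SuperFun U ν) :
    res h (partialD U ν i x) = partialD V ν i (res h x) := by
  classical
  rcases i with i | b
  · exact (partialD_inl_pullback (L := LinearMap.id) rfl x).symm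
  · exact (partialD_inr_pullback (M := LinearMap.id) rfl x).symm

theorem res_coord (i : κ ⊕ ν) : res h (coord U ν i) = coord V ν i := by
  rcases i with i | b
  · rw [coord_inl, coord_inl, res, pullback_tmul, map_one]
    rfl
  · rw [coord_inr, coord_inr, res, pullback_tmul, map_one, ExteriorAlgebra.map_apply_ι]
    rfl

end Restriction

end SuperFun

end SuperFunctions

/-! ### Hadamard's lemma. -/

section Hadamard

open MeasureTheory

variable {κ : Type} [Fintype κ]

/-- The integral is the value at `0` of the convolution of the indicator of `(0, 1]` with `s ↦ χ s *
h (x, -s)`. The bump `χ` makes this factor compactly supported; since `χ` is `1` on the ball of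
radius `2`, it changes nothing where the indicator is non-zero. Smoothness of convolutions in a
parameter then applies. -/
theorem contDiff_parametric_integral {E : Type*} [NormedAddCommGroup E] [NormedSpace ℝ E]
    (h : E × ℝ → ℝ) (hh : ContDiff ℝ ∞ h) : ContDiff ℝ ∞ fun x => ∫ t in (0 : ℝ)..1, h (x, t) := by
  let χ : ContDiffBump (0 : ℝ) := ⟨2, 3, by norm_num, by norm_num⟩
  let f : ℝ → ℝ := Set.indicator (Set.Ioc 0 1) 1
  have hf : LocallyIntegrable f := by
    refine (IntegrableOn.integrable_indicator ?_ measurableSet_Ioc).locallyIntegrable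
    exact (continuous_const (y := (1 : ℝ))).integrableOn_Ioc
  have key := contDiffOn_convolution_right_with_param_comp (n := ⊤) (μ := volume)
    (ContinuousLinearMap.mul ℝ ℝ) (s := (Set.univ : Set E)) (v := fun _ : E => (0 : ℝ))
    contDiffOn_const (f := f) (g := fun x s => χ s * h (x, -s)) (k := Metric.closedBall 0 3)
    isOpen_univ (isCompact_closedBall 0 3) (fun p x _ hx => by
      have : χ x = 0 := χ.zero_of_le_dist (not_le.1 hx).le
      simp [this]) hf (by
      refine ContDiff.contDiffOn ?_
      exact (χ.contDiff.comp contDiff_snd).mul (hh.comp (contDiff_fst.prodMk contDiff_snd.neg)))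
  rw [contDiffOn_univ] at key
  refine (congrArg (ContDiff ℝ ∞) (funext fun x => ?_)).mp key
  symm
  rw [intervalIntegral.integral_of_le zero_le_one, convolution_def,
    ← integral_indicator measurableSet_Ioc]
  refine integral_congr_ae (Filter.Eventually.of_forall fun t => ?_)
  simp only [ContinuousLinearMap.mul_apply', zero_sub, neg_neg, f]
  by_cases ht : t ∈ Set.Ioc (0 : ℝ) 1
  · have : χ (-t) = 1 := χ.one_of_mem_closedBall (by
      rw [Metric.mem_closedBall, dist_zero_right, norm_neg, Real.norm_eq_abs, abs_of_pos ht.1]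
      exact ht.2.trans (by norm_num [χ]))
    simp [ht, this]
  · simp [ht]

open scoped Classical in
-- The fundamental theorem of calculus along the segment from `a` to `x`; `G i` is the average of
-- the `i`-th partial derivative over that segment.
theorem exists_hadamard_of_contDiff (F : (κ → ℝ) → ℝ) (hF : ContDiff ℝ ∞ F) (a : κ → ℝ) :
    ∃ G : κ → (κ → ℝ) → ℝ, (∀ i, ContDiff ℝ ∞ (G i)) ∧
      ∀ x, F x = F a + ∑ i, (x i - a i) * G i x := by
  have hseg : ContDiff ℝ ∞ fun z : (κ → ℝ) × ℝ => a + z.2 • (z.1 - a) :=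
    contDiff_const.add (contDiff_snd.smul (contDiff_fst.sub contDiff_const))
  have hF' : ContDiff ℝ ∞ (fderiv ℝ F) := hF.fderiv_right (by simp)
  have hh : ∀ i, ContDiff ℝ ∞ fun z : (κ → ℝ) × ℝ =>
      fderiv ℝ F (a + z.2 • (z.1 - a)) (Pi.single i 1) := fun i =>
    (hF'.comp hseg).clm_apply contDiff_const
  refine ⟨fun i x => ∫ t in (0 : ℝ)..1, fderiv ℝ F (a + t • (x - a)) (Pi.single i 1),
    fun i => contDiff_parametric_integral _ (hh i), fun x => ?_⟩
  have hc : ∀ i, Continuous fun t : ℝ => fderiv ℝ F (a + t • (x - a)) (Pi.single i 1) := fun i =>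
    (hh i).continuous.comp (Continuous.prodMk continuous_const continuous_id)
  have hsum : ∀ t : ℝ, fderiv ℝ F (a + t • (x - a)) (x - a) =
      ∑ i, (x i - a i) * fderiv ℝ F (a + t • (x - a)) (Pi.single i 1) := by
    intro t
    have e : x - a = ∑ i, (x i - a i) • (Pi.single i 1 : κ → ℝ) := by
      ext j
      simp [Finset.sum_apply, Pi.single_apply]
    conv_lhs => rw [e, map_sum, ← e]
    simp only [map_smul, smul_eq_mul]
  have hd : ∀ t : ℝ, HasDerivAt (fun t : ℝ => F (a + t • (x - a)))
      (fderiv ℝ F (a + t • (x - a)) (x - a)) t := by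
    intro t
    have h1 : HasDerivAt (fun t : ℝ => a + t • (x - a)) (x - a) t := by
      simpa using ((hasDerivAt_id t).smul_const (x - a)).const_add a
    exact ((hF.differentiable (by simp)) _).hasFDerivAt.comp_hasDerivAt t h1
  have hint := intervalIntegral.integral_eq_sub_of_hasDerivAt (a := 0) (b := 1)
    (fun t _ => hd t) (by
      simp only [hsum]
      exact (continuous_finsetSum _ fun i _ => continuous_const.mul (hc i)).intervalIntegrable _ _)
  simp only [hsum, one_smul, zero_smul, add_zero, add_sub_cancel] at hint
  have hi : ∀ i ∈ Finset.univ, IntervalIntegrable (fun t : ℝ => (x i - a i) *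
      fderiv ℝ F (a + t • (x - a)) (Pi.single i 1)) volume 0 1 := fun i _ =>
    (continuous_const.mul (hc i)).intervalIntegrable _ _
  rw [intervalIntegral.integral_finsetSum hi] at hint
  simp only [intervalIntegral.integral_const_mul] at hint
  rw [hint]
  ring

/-- Hadamard's lemma. -/
theorem exists_hadamard {Ω : Opens (κ → ℝ)} (f : smooth Ω) (a : Ω) :
    ∃ g : κ → smooth Ω, f = algebraMap ℝ _ (f.1 a) +
      ∑ i, (smoothCoord Ω i - algebraMap ℝ _ (a.1 i)) * g i := by
  -- `Ω` need not be star-shaped around `a`, so a cutoff with `χ a = 1` supported in `Ω` is used.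
  -- The global lemma applies to `χ f` and to `χ`; writing `f = χ f + (1 - χ) f` gives the
  -- coefficients `G i - H i * f`.
  obtain ⟨χ, hχs, -, hχ, -, hχa⟩ :=
    exists_contDiff_tsupport_subset (n := ⊤) (Ω.isOpen.mem_nhds a.2)
  have hF : ContDiff ℝ ∞ (χ * extZero f.1) := by
    refine contDiff_iff_contDiffAt.2 fun y => ?_
    by_cases hy : y ∈ tsupport χ
    · exact hχ.contDiffAt.mul (smooth_contDiffAt f ⟨y, hχs hy⟩)
    · refine (contDiffAt_const (c := (0 : ℝ))).congr_of_eventuallyEq ?_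
      filter_upwards [notMem_tsupport_iff_eventuallyEq.1 hy] with z hz
      simp [hz]
  obtain ⟨G, hG, hGe⟩ := exists_hadamard_of_contDiff _ hF a.1
  obtain ⟨H, hH, hHe⟩ := exists_hadamard_of_contDiff _ hχ a.1
  have mk : ∀ G : (κ → ℝ) → ℝ, ContDiff ℝ ∞ G → (fun y : Ω => G y.1) ∈ smooth Ω := fun G hG =>
    hG.contDiffOn.congr fun y hy => by
      have hy' : y ∈ Ω := hy
      rw [extZero_apply _ hy']
  refine ⟨fun i => ⟨_, mk _ (hG i)⟩ - ⟨_, mk _ (hH i)⟩ * f, smooth_ext fun y => ?_⟩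
  have h1 := hGe y.1
  have h2 := hHe y.1
  rw [hχa] at h2
  simp only [Pi.mul_apply, extZero_apply _ y.2, extZero_apply _ a.2, hχa, one_mul] at h1
  have h3 : f.1 y = χ y.1 * f.1 y + (1 - χ y.1) * f.1 y := by ring
  rw [h3, h1, h2]
  have e : ∀ x : κ → smooth Ω, (∑ i, x i).1 y = ∑ i, (x i).1 y := by
    intro x
    rw [AddSubmonoidClass.coe_finsetSum, Finset.sum_apply]
  simp only [Subalgebra.coe_add, Pi.add_apply, e, Subalgebra.coe_mul, Pi.mul_apply,
    AddSubgroupClass.coe_sub, Pi.sub_apply, Subalgebra.coe_algebraMap, Pi.algebraMap_apply,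
    Algebra.algebraMap_self, RingHom.id_apply, smoothCoord, mul_sub, Finset.sum_sub_distrib]
  rw [sub_add_cancel_left, neg_mul, Finset.sum_mul]
  simp only [mul_assoc]
  ring

end Hadamard

/-! ### Derivations and homomorphisms are determined by the coordinates. -/

section Uniqueness

variable {κ κ' ν ν' : Type} [Fintype κ] [Fintype κ'] [Fintype ν] [Fintype ν']
  {Ω : Opens (κ → ℝ)} {Ω' : Opens (κ' → ℝ)}

/-- Evaluation of a smooth function at a point. -/
def smoothEval (a : Ω) : smooth Ω →ₐ[ℝ] ℝ := (Pi.evalAlgHom ℝ (fun _ : Ω => ℝ) a).comp (smooth Ω).val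

namespace SuperFun

/-- Evaluation of (the coefficients of) a function at a point of the body. -/
def evalAt (ν : Type) [Fintype ν] (a : Ω) : SuperFun Ω ν →ₐ[ℝ] ExteriorAlgebra ℝ (ν → ℝ) :=
  (Algebra.TensorProduct.lid ℝ (ExteriorAlgebra ℝ (ν → ℝ))).toAlgHom.comp
    (Algebra.TensorProduct.map (smoothEval a) (AlgHom.id ℝ _))

theorem evalAt_tmul (a : Ω) (f : smooth Ω) (w : ExteriorAlgebra ℝ (ν → ℝ)) :
    evalAt ν a (tmul f w) = f.1 a • w := rfl

/-- In a basis of the exterior factor an element becomes a finite family of smooth functions, which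
are determined by their values. -/
theorem eq_zero_of_evalAt {x : SuperFun Ω ν} (h : ∀ a, evalAt ν a x = 0) : x = 0 := by
  let b := Module.Free.chooseBasis ℝ (ExteriorAlgebra ℝ (ν → ℝ))
  let e := TensorProduct.equivFinsuppOfBasisRight (M := smooth Ω) b
  refine e.injective ((?_ : e x = 0).trans e.map_zero.symm)
  ext i a
  have key : ∀ x : SuperFun Ω ν, ((e x) i).1 a = b.repr (evalAt ν a x) i := by
    intro x
    induction x using SuperFun.induction with
    | zero => rw [map_zero, map_zero]; exact congrArg (fun z => (z i).1 a) e.map_zero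
    | tmul f w =>
      rw [evalAt_tmul, map_smul]
      have : e (tmul f w) i = b.repr w i • f :=
        TensorProduct.equivFinsuppOfBasisRight_apply_tmul_apply b f w i
      rw [this]
      exact mul_comm _ _
    | add x y hx hy =>
      have : e (x + y) = e x + e y := e.map_add x y
      rw [this, map_add, map_add]
      simp only [Finsupp.add_apply, Subalgebra.coe_add, Pi.add_apply, hx, hy]
  rw [key, h, map_zero]
  rfl

theorem tmul_one_hadamard (f : smooth Ω) (a : Ω) : ∃ g : κ → smooth Ω,
    tmul f (1 : ExteriorAlgebra ℝ (ν → ℝ)) = algebraMap ℝ _ (f.1 a) +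
      ∑ i, (coord Ω ν (Sum.inl i) - algebraMap ℝ _ (a.1 i)) * tmul (g i) 1 := by
  obtain ⟨g, hg⟩ := exists_hadamard f a
  refine ⟨g, ?_⟩
  let φ : smooth Ω →ₐ[ℝ] SuperFun Ω ν := Algebra.TensorProduct.includeLeft
  change φ f = _
  conv_lhs => rw [hg]
  rw [map_add, map_sum, AlgHom.commutes]
  simp only [map_mul, map_sub, AlgHom.commutes]
  rfl

theorem tmul_one_ι (m : ν → ℝ) : tmul (1 : smooth Ω) (ExteriorAlgebra.ι ℝ m) =
    ∑ b, m b • coord Ω ν (Sum.inr b) := by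
  classical
  let φ : ExteriorAlgebra ℝ (ν → ℝ) →ₐ[ℝ] SuperFun Ω ν := Algebra.TensorProduct.includeRight
  have e : ∀ w, tmul (1 : smooth Ω) w = φ w := fun _ => rfl
  conv_lhs => rw [pi_eq_sum_univ' m, map_sum, e, map_sum]
  refine Finset.sum_congr rfl fun b _ => ?_
  rw [map_smul, map_smul, coord_inr, e]

theorem tmul_eq_mul (f : smooth Ω) (w : ExteriorAlgebra ℝ (ν → ℝ)) :
    tmul f w = tmul f 1 * tmul 1 w := by
  rw [tmul_mul_tmul, mul_one, one_mul]

/-- No continuity is assumed. At a point `a`, Hadamard's lemma writes `f` as a constant plus terms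
`(x_i - a_i) g_i`; `D` kills the constant and the coordinates, and what remains has the factor `x_i
- a_i`, which vanishes at `a`. The odd generators are handled by the Leibniz rule. -/
theorem derivation_eq_zero {d : ZMod 2} {D : Module.End ℝ (SuperFun Ω ν)}
    (hD : IsSuperDerivation (gr Ω ν) d D) (h : ∀ i, D (coord Ω ν i) = 0) : D = 0 := by
  have h1 : D 1 = 0 := hD.map_one isSuperCommAlgebra.one_mem
  have hc : ∀ c : ℝ, D (algebraMap ℝ _ c) = 0 := fun c => by
    rw [Algebra.algebraMap_eq_smul_one, map_smul, h1, smul_zero]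
  have hf : ∀ f : smooth Ω, D (tmul f 1) = 0 := by
    intro f
    refine eq_zero_of_evalAt fun a => ?_
    obtain ⟨g, hg⟩ := tmul_one_hadamard (ν := ν) f a
    rw [hg, map_add, hc, zero_add, map_sum, map_sum]
    refine Finset.sum_eq_zero fun i _ => ?_
    have hm : coord Ω ν (Sum.inl i) - algebraMap ℝ _ (a.1 i) ∈ gr Ω ν 0 :=
      sub_mem (coord_mem (Sum.inl i)) (by
        rw [Algebra.algebraMap_eq_smul_one]
        exact Submodule.smul_mem _ _ isSuperCommAlgebra.one_mem)
    rw [hD.leibniz hm, map_sub, h, hc, sub_zero, zero_mul, zero_add, map_smul, map_mul, map_sub,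
      AlgHom.commutes, coord_inl, evalAt_tmul]
    have : (smoothCoord Ω i).1 a • (1 : ExteriorAlgebra ℝ (ν → ℝ)) - algebraMap ℝ _ (a.1 i) = 0 := by
      rw [Algebra.algebraMap_eq_smul_one]
      exact sub_self _
    rw [this, zero_mul, smul_zero]
  have hw : ∀ w : ExteriorAlgebra ℝ (ν → ℝ), D (tmul 1 w) = 0 := by
    intro w
    induction w using CliffordAlgebra.left_induction with
    | algebraMap r => rw [Algebra.algebraMap_eq_smul_one, tmul_smul, map_smul, ← one_eq_tmul, h1,
        smul_zero]
    | add x y hx hy => rw [tmul_add, map_add, hx, hy, add_zero]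
    | ι_mul x m hx =>
      have e : tmul (1 : smooth Ω) (CliffordAlgebra.ι 0 m * x) =
          tmul 1 (ExteriorAlgebra.ι ℝ m) * tmul 1 x := by
        rw [tmul_mul_tmul, one_mul]
      rw [e, hD.leibniz (tmul_mem 1 (CliffordAlgebra.ι_mem_evenOdd_one _ m)), hx, tmul_one_ι, map_sum]
      simp [h]
  refine linearMap_ext fun f w => ?_
  rw [tmul_eq_mul, hD.leibniz (tmul_mem f isSuperCommAlgebra_exterior.one_mem), hf, hw]
  simp

/-- A superderivation is determined by its values on the coordinates. -/
theorem derivation_ext {d : ZMod 2} {D D' : Module.End ℝ (SuperFun Ω ν)}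
    (hD : IsSuperDerivation (gr Ω ν) d D) (hD' : IsSuperDerivation (gr Ω ν) d D')
    (h : ∀ i, D (coord Ω ν i) = D' (coord Ω ν i)) : D = D' :=
  sub_eq_zero.1 (derivation_eq_zero (hD.sub hD') fun i => by
    rw [LinearMap.sub_apply, h, sub_self])

/-- A homomorphism is determined by its values on the coordinates. -/
theorem algHom_ext {φ ψ : SuperFun Ω ν →ₐ[ℝ] SuperFun Ω' ν'}
    (hφ : ∀ b : Ω', ∃ a : Ω, ∀ i, evalAt ν' b (φ (coord Ω ν (Sum.inl i))) = algebraMap ℝ _ (a.1 i))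
    (h : ∀ i, φ (coord Ω ν i) = ψ (coord Ω ν i)) : φ = ψ := by
  have hf : ∀ f : smooth Ω, φ (tmul f 1) = ψ (tmul f 1) := by
    intro f
    refine sub_eq_zero.1 (eq_zero_of_evalAt fun b => ?_)
    -- At `b` the images of the even coordinates take the values of `a`, without nilpotent part. The
    -- Hadamard remainder at `a` is therefore killed by `φ` and `ψ` alike.
    obtain ⟨a, ha⟩ := hφ b
    obtain ⟨g, hg⟩ := tmul_one_hadamard (ν := ν) f a
    rw [hg]
    simp only [map_add, map_sub, map_sum, map_mul, ← h, ha, AlgHom.commutes, sub_self, zero_mul]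
  have hw : ∀ w : ExteriorAlgebra ℝ (ν → ℝ), φ (tmul 1 w) = ψ (tmul 1 w) := by
    intro w
    induction w using CliffordAlgebra.left_induction with
    | algebraMap r =>
      rw [Algebra.algebraMap_eq_smul_one, tmul_smul, map_smul, ← one_eq_tmul, map_one, map_smul,
        map_one]
    | add x y hx hy => rw [tmul_add, map_add, map_add, hx, hy]
    | ι_mul x m hx =>
      have e : tmul (1 : smooth Ω) (CliffordAlgebra.ι 0 m * x) =
          tmul 1 (ExteriorAlgebra.ι ℝ m) * tmul 1 x := by
        rw [tmul_mul_tmul, one_mul]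
      rw [e, map_mul, map_mul, hx, tmul_one_ι, map_sum, map_sum]
      simp only [map_smul, h]
  refine AlgHom.ext fun x => ?_
  induction x using SuperFun.induction with
  | zero => simp
  | add x y hx hy => rw [map_add, map_add, hx, hy]
  | tmul f w => rw [tmul_eq_mul, map_mul, map_mul, hf, hw]

end SuperFun

end Uniqueness

/-! ### Functions on the total space: pull-back from the base and restriction to the zero section.
-/

section TotalSpace

variable {p q r s : ℕ} {Ω : Opens (Fin p → ℝ)}

theorem coordParity_eq_idxParity {m n : ℕ} (i : Fin m ⊕ Fin n) :
    coordParity i = SuperFun.idxParity i := by cases i <;> rfl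

theorem idxParity_fibreIdx (α : Fin s ⊕ Fin r) :
    SuperFun.idxParity (fibreIdx (p := p) (q := q) α) = coordParity α := by cases α <;> rfl

theorem idxParity_baseIdx (A : Fin p ⊕ Fin q) :
    SuperFun.idxParity (baseIdx (s := s) (r := r) A) = coordParity A := by cases A <;> rfl

/-- The grading of functions on the base. -/
abbrev baseGr (q : ℕ) (Ω : Opens (Fin p → ℝ)) : ZMod 2 → Submodule ℝ (SuperFun Ω (Fin q)) :=
  SuperFun.gr Ω (Fin q)

/-- The grading of functions on the total space. -/
abbrev totalGr (q r s : ℕ) (Ω : Opens (Fin p → ℝ)) :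
    ZMod 2 → Submodule ℝ (TotalFun q r s Ω) :=
  SuperFun.gr (tube s Ω) (Fin q ⊕ Fin r)

theorem fromBase_tmul (f : smooth Ω) (w : ExteriorAlgebra ℝ (Fin q → ℝ)) :
    (fromBase (SuperFun.tmul f w) : TotalFun q r s Ω) =
      SuperFun.tmul (smoothPullback (LinearMap.funLeft ℝ ℝ Sum.inl) (fun _ hy => hy) f)
        (ExteriorAlgebra.map (extendByZero q r) w) := rfl

theorem toZeroSection_tmul (f : smooth (tube s Ω))
    (w : ExteriorAlgebra ℝ (Fin q ⊕ Fin r → ℝ)) :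
    (toZeroSection (SuperFun.tmul f w : TotalFun q r s Ω)) =
      SuperFun.tmul (smoothPullback (extendByZero p s)
        (fun y hy => by simpa [tube, extendByZero] using hy) f)
        (ExteriorAlgebra.map (LinearMap.funLeft ℝ ℝ Sum.inl) w) := rfl

theorem isSuperDerivation_fibreD (α : Fin s ⊕ Fin r) :
    IsSuperDerivation (totalGr q r s Ω) (coordParity α) (fibreD α) := by
  rw [← idxParity_fibreIdx (p := p) (q := q)]
  exact SuperFun.isSuperDerivation_partialD _

theorem isSuperDerivation_baseD (A : Fin p ⊕ Fin q) :
    IsSuperDerivation (totalGr q r s Ω) (coordParity A) (baseD A) := by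
  rw [← idxParity_baseIdx (s := s) (r := r)]
  exact SuperFun.isSuperDerivation_partialD _

theorem isSuperDerivation_partialD_base (A : Fin p ⊕ Fin q) :
    IsSuperDerivation (baseGr q Ω) (coordParity A) (SuperFun.partialD Ω (Fin q) A) := by
  rw [coordParity_eq_idxParity]
  exact SuperFun.isSuperDerivation_partialD _

theorem fibreCoord_mem (α : Fin s ⊕ Fin r) :
    fibreCoord α ∈ totalGr q r s Ω (coordParity α) := by
  rw [← idxParity_fibreIdx (p := p) (q := q)]
  exact SuperFun.coord_mem _

theorem fibreD_fibreD (α β : Fin s ⊕ Fin r) (x : TotalFun q r s Ω) :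
    fibreD α (fibreD β x) = sgn (coordParity α * coordParity β) • fibreD β (fibreD α x) := by
  rw [← idxParity_fibreIdx (p := p) (q := q), ← idxParity_fibreIdx (p := p) (q := q)]
  exact SuperFun.partialD_comm _ _ x

theorem baseD_fibreD (A : Fin p ⊕ Fin q) (α : Fin s ⊕ Fin r) (x : TotalFun q r s Ω) :
    baseD A (fibreD α x) = sgn (coordParity A * coordParity α) • fibreD α (baseD A x) := by
  have := SuperFun.partialD_comm (Ω := tube s Ω) (ν := Fin q ⊕ Fin r) (baseIdx A) (fibreIdx α) x
  rwa [idxParity_baseIdx, idxParity_fibreIdx] at this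

open scoped Classical in
theorem fibreD_fibreCoord (α β : Fin s ⊕ Fin r) :
    fibreD α (fibreCoord β : TotalFun q r s Ω) = if α = β then 1 else 0 := by
  have hinj : Function.Injective (fibreIdx (p := p) (q := q) (s := s) (r := r)) :=
    Sum.map_injective.2 ⟨Sum.inr_injective, Sum.inr_injective⟩
  rw [fibreD, fibreCoord, SuperFun.partialD_coord]
  simp only [hinj.eq_iff]

theorem baseD_fibreCoord (A : Fin p ⊕ Fin q) (β : Fin s ⊕ Fin r) :
    baseD A (fibreCoord β : TotalFun q r s Ω) = 0 := by
  rw [baseD, fibreCoord, SuperFun.partialD_coord, if_neg]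
  rcases A with i | i <;> rcases β with j | j <;> simp [baseIdx, fibreIdx]

theorem fromBase_mem {i : ZMod 2} {f : SuperFun Ω (Fin q)} (hf : f ∈ baseGr q Ω i) :
    fromBase f ∈ totalGr q r s Ω i :=
  SuperFun.pullback_mem hf

theorem toZeroSection_mem {i : ZMod 2} {f : TotalFun q r s Ω} (hf : f ∈ totalGr q r s Ω i) :
    toZeroSection f ∈ baseGr q Ω i :=
  SuperFun.pullback_mem hf

theorem fibreD_fromBase (α : Fin s ⊕ Fin r) (f : SuperFun Ω (Fin q)) :
    fibreD α (fromBase f : TotalFun q r s Ω) = 0 := by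
  classical
  rcases α with i | b
  · exact SuperFun.partialD_inl_pullback_of_zero (by ext j; simp [LinearMap.funLeft]) f
  · exact SuperFun.partialD_inr_pullback_of_zero (by ext j; simp [extendByZero]) f

theorem baseD_fromBase (A : Fin p ⊕ Fin q) (f : SuperFun Ω (Fin q)) :
    baseD A (fromBase f : TotalFun q r s Ω) = fromBase (SuperFun.partialD Ω (Fin q) A f) := by
  classical
  rcases A with i | b
  · exact SuperFun.partialD_inl_pullback
      (by ext j; simp [LinearMap.funLeft, Pi.single_apply]) f
  · exact SuperFun.partialD_inr_pullback (by ext j; simp [extendByZero]) f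

theorem partialD_toZeroSection (A : Fin p ⊕ Fin q) (x : TotalFun q r s Ω) :
    SuperFun.partialD Ω (Fin q) A (toZeroSection x) = toZeroSection (baseD A x) := by
  classical
  rcases A with i | b
  · exact SuperFun.partialD_inl_pullback
      (by ext (j | j) <;> simp [extendByZero, Pi.single_apply]) x
  · exact SuperFun.partialD_inr_pullback (by ext j; simp [LinearMap.funLeft]) x

theorem fromBase_coord (A : Fin p ⊕ Fin q) :
    fromBase (SuperFun.coord Ω (Fin q) A) =
      (SuperFun.coord (tube s Ω) (Fin q ⊕ Fin r) (baseIdx A) : TotalFun q r s Ω) := by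
  classical
  rcases A with i | b
  · rw [SuperFun.coord_inl, fromBase_tmul, map_one]
    rfl
  · rw [SuperFun.coord_inr, fromBase_tmul, map_one, ExteriorAlgebra.map_apply_ι]
    refine congrArg (fun v => SuperFun.tmul 1 (ExteriorAlgebra.ι ℝ v)) ?_
    ext (j | j) <;> simp [extendByZero, Pi.single_apply]

theorem toZeroSection_fromBase (f : SuperFun Ω (Fin q)) :
    toZeroSection (fromBase f : TotalFun q r s Ω) = f := by
  induction f using SuperFun.induction with
  | zero => simp
  | add x y hx hy => rw [map_add, map_add, hx, hy]
  | tmul f w =>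
    rw [fromBase_tmul, toZeroSection_tmul]
    have h1 : (LinearMap.funLeft ℝ ℝ (Sum.inl : Fin q → Fin q ⊕ Fin r)) ∘ₗ extendByZero q r =
        LinearMap.id := by
      ext i j
      simp [LinearMap.funLeft, extendByZero, Pi.single_apply]
    have h2 : ExteriorAlgebra.map (LinearMap.funLeft ℝ ℝ (Sum.inl : Fin q → Fin q ⊕ Fin r))
        (ExteriorAlgebra.map (extendByZero q r) w) = w := by
      rw [← AlgHom.comp_apply, ExteriorAlgebra.map_comp_map, h1, ExteriorAlgebra.map_id]
      rfl
    rw [h2]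
    rfl

theorem toZeroSection_fibreCoord (α : Fin s ⊕ Fin r) :
    toZeroSection (fibreCoord α : TotalFun q r s Ω) = 0 := by
  classical
  rcases α with i | b
  · have e : (fibreCoord (Sum.inl i) : TotalFun q r s Ω) =
        SuperFun.tmul (smoothCoord (tube s Ω) (Sum.inr i)) 1 := rfl
    have : smoothPullback (extendByZero p s) (fun y hy => by simpa [tube, extendByZero] using hy)
        (smoothCoord (tube s Ω) (Sum.inr i)) = (0 : smooth Ω) := smooth_ext fun y => rfl
    rw [e, toZeroSection_tmul, this, SuperFun.zero_tmul]
  · have e : (fibreCoord (Sum.inr b) : TotalFun q r s Ω) =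
        SuperFun.tmul 1 (ExteriorAlgebra.ι ℝ (Pi.single (Sum.inr b) 1)) := by
      rw [fibreCoord, fibreIdx, Sum.map_inr, SuperFun.coord_inr]
      congr
      exact Subsingleton.elim _ _
    have : (LinearMap.funLeft ℝ ℝ (Sum.inl : Fin q → Fin q ⊕ Fin r))
        (Pi.single (Sum.inr b) 1) = 0 := by
      ext j
      simp [LinearMap.funLeft]
    rw [e, toZeroSection_tmul, ExteriorAlgebra.map_apply_ι, this, map_zero, SuperFun.tmul_zero]

/-- The coordinates on the total space are the ones on the base and those along the fibre. -/
theorem coord_total_cases {motive : TotalFun q r s Ω → Prop}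
    (base : ∀ A, motive (fromBase (SuperFun.coord Ω (Fin q) A))) (fibre : ∀ α, motive (fibreCoord α))
    (i : (Fin p ⊕ Fin s) ⊕ (Fin q ⊕ Fin r)) :
    motive (SuperFun.coord (tube s Ω) (Fin q ⊕ Fin r) i) := by
  rcases i with (i | i) | (i | i)
  · have := base (Sum.inl i); rwa [fromBase_coord] at this
  · exact fibre (Sum.inl i)
  · have := base (Sum.inr i); rwa [fromBase_coord] at this
  · exact fibre (Sum.inr i)

/-- A superderivation of functions on the total space is determined by its values on functions
on the base and on the fibre coordinates. -/
theorem total_derivation_ext {d : ZMod 2} {D D' : Module.End ℝ (TotalFun q r s Ω)}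
    (hD : IsSuperDerivation (totalGr q r s Ω) d D) (hD' : IsSuperDerivation (totalGr q r s Ω) d D')
    (hb : ∀ f, D (fromBase f) = D' (fromBase f)) (hf : ∀ α, D (fibreCoord α) = D' (fibreCoord α)) :
    D = D' :=
  SuperFun.derivation_ext hD hD' (coord_total_cases (motive := fun x => D x = D' x)
    (fun _ => hb _) hf)

/-- The restriction to the zero section is determined by its values on functions on the base and on
the fibre coordinates. -/
theorem eq_toZeroSection {φ : TotalFun q r s Ω →ₐ[ℝ] SuperFun Ω (Fin q)}
    (hb : ∀ f, φ (fromBase f) = f) (hf : ∀ α, φ (fibreCoord α) = 0) : φ = toZeroSection := by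
  refine SuperFun.algHom_ext (fun b => ⟨⟨extendByZero p s b.1, ?_⟩, ?_⟩)
    (coord_total_cases (motive := fun x => φ x = toZeroSection x) (fun A => ?_) fun α => ?_)
  · simp [tube, extendByZero]
  · rintro (i | i)
    · have e : SuperFun.coord (tube s Ω) (Fin q ⊕ Fin r) (Sum.inl (Sum.inl i)) =
          fromBase (SuperFun.coord Ω (Fin q) (Sum.inl i)) := (fromBase_coord (Sum.inl i)).symm
      rw [e, hb, SuperFun.coord_inl, SuperFun.evalAt_tmul, Algebra.algebraMap_eq_smul_one]
      rfl
    · have e : SuperFun.coord (tube s Ω) (Fin q ⊕ Fin r) (Sum.inl (Sum.inr i)) =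
          fibreCoord (Sum.inl i) := rfl
      rw [e, hf, map_zero]
      exact (map_zero _).symm
  · rw [hb, toZeroSection_fromBase]
  · rw [hf, toZeroSection_fibreCoord]

section Restriction

variable {U V : Opens (Fin p → ℝ)} (h : V ≤ U)

theorem res_fromBase (f : SuperFun U (Fin q)) :
    SuperFun.res (tube_mono s h) (fromBase f : TotalFun q r s U) =
      fromBase (SuperFun.res h f) := by
  induction f using SuperFun.induction with
  | zero => simp
  | add x y hx hy => simp only [map_add, hx, hy]
  | tmul f w =>
    simp only [SuperFun.res, fromBase_tmul, SuperFun.pullback_tmul, ExteriorAlgebra.map_id,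
      AlgHom.id_apply]
    rfl

theorem res_toZeroSection (x : TotalFun q r s U) :
    SuperFun.res h (toZeroSection x) = toZeroSection (SuperFun.res (tube_mono s h) x) := by
  induction x using SuperFun.induction with
  | zero => simp
  | add x y hx hy => simp only [map_add, hx, hy]
  | tmul f w =>
    simp only [SuperFun.res, toZeroSection_tmul, SuperFun.pullback_tmul, ExteriorAlgebra.map_id,
      AlgHom.id_apply]
    rfl

theorem res_fibreD (α : Fin s ⊕ Fin r) (x : TotalFun q r s U) :
    SuperFun.res (tube_mono s h) (fibreD α x) = fibreD α (SuperFun.res (tube_mono s h) x) :=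
  SuperFun.res_partialD _ _ x

theorem res_baseD (A : Fin p ⊕ Fin q) (x : TotalFun q r s U) :
    SuperFun.res (tube_mono s h) (baseD A x) = baseD A (SuperFun.res (tube_mono s h) x) :=
  SuperFun.res_partialD _ _ x

theorem res_fibreCoord (α : Fin s ⊕ Fin r) :
    SuperFun.res (tube_mono s h) (fibreCoord α : TotalFun q r s U) = fibreCoord α :=
  SuperFun.res_coord _ _

end Restriction

end TotalSpace

/-! ### Supercommuting elements of an algebra. -/

section SuperCommute

variable {R : Type*} [Ring R] [Algebra ℝ R]

/-- `a` and `b`, of parities `i` and `j`, supercommute. -/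
def SuperCommute (i j : ZMod 2) (a b : R) : Prop := a * b = sgn (i * j) • (b * a)

namespace SuperCommute

variable {i j k : ZMod 2} {a b c : R}

theorem symm (h : SuperCommute i j a b) : SuperCommute j i b a := by
  rw [SuperCommute, h, smul_smul, mul_comm j i, sgn_mul_self, one_smul]

theorem mul_right (h : SuperCommute i j a b) (h' : SuperCommute i k a c) :
    SuperCommute i (j + k) a (b * c) := by
  rw [SuperCommute, ← mul_assoc, h, smul_mul_assoc, mul_assoc, h', mul_smul_comm, smul_smul,
    mul_add, sgn_add, mul_assoc]

theorem mul_left (h : SuperCommute i k a c) (h' : SuperCommute j k b c) :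
    SuperCommute (i + j) k (a * b) c :=
  (h.symm.mul_right h'.symm).symm

theorem smul_right (r : ℝ) (h : SuperCommute i j a b) : SuperCommute i j a (r • b) := by
  rw [SuperCommute, mul_smul_comm, h, smul_mul_assoc, smul_comm]

theorem sum_right {ι : Type*} (s : Finset ι) {f : ι → R} (h : ∀ l ∈ s, SuperCommute i j a (f l)) :
    SuperCommute i j a (∑ l ∈ s, f l) := by
  rw [SuperCommute, Finset.mul_sum, Finset.sum_mul, Finset.smul_sum]
  exact Finset.sum_congr rfl h

theorem commute (h : SuperCommute 0 j a b) : a * b = b * a := by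
  rw [h, zero_mul, sgn_zero, one_smul]

end SuperCommute

end SuperCommute

/-! ### The interior product as a multiplicative map into operators on forms. -/

section Jets

variable {p q r s : ℕ} {Ω : Opens (Fin p → ℝ)}

/-- Multiplication by a function on the base. -/
def mulBase (f : SuperFun Ω (Fin q)) : Module.End ℝ (TotalFun q r s Ω) :=
  LinearMap.mulLeft ℝ (fromBase f)

/-- The interior product with the `k`-th Taylor component of a function on `ΠE*`. -/
def jet : ℕ → TotalFun q r s Ω →ₗ[ℝ] Module.End ℝ (TotalFun q r s Ω)
  | 0 => LinearMap.mul ℝ _ ∘ₗ (fromBase : SuperFun Ω (Fin q) →ₐ[ℝ] TotalFun q r s Ω).toLinearMap ∘ₗ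
      (toZeroSection : TotalFun q r s Ω →ₐ[ℝ] _).toLinearMap
  | k + 1 => (1 / ((k : ℝ) + 1)) • ∑ α : Fin s ⊕ Fin r,
      LinearMap.mulLeft ℝ (fibreD α : Module.End ℝ (TotalFun q r s Ω)) ∘ₗ jet k ∘ₗ fibreD α

theorem jet_zero (X : TotalFun q r s Ω) : jet 0 X = mulBase (toZeroSection X) := rfl

/-- One fibre derivative is taken of `X` on `ΠE*` while the matching `∂/∂ξ^α` is put on the left.
The coefficient thus stays rightmost, which avoids the reordering signs of `taylorCoeff`; the
factors `1 / (k + 1)` accumulate to `1 / k!`. -/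
theorem jet_succ (k : ℕ) (X : TotalFun q r s Ω) :
    jet (k + 1) X = (1 / ((k : ℝ) + 1)) • ∑ α : Fin s ⊕ Fin r, fibreD α * jet k (fibreD α X) := by
  simp [jet]

theorem succ_smul_jet_succ (k : ℕ) (X : TotalFun q r s Ω) :
    ((k : ℝ) + 1) • jet (k + 1) X = ∑ α : Fin s ⊕ Fin r, fibreD α * jet k (fibreD α X) := by
  rw [jet_succ, smul_smul, mul_one_div_cancel (by positivity), one_smul]

theorem superCommute_fibreD_mulBase (α : Fin s ⊕ Fin r) {i : ZMod 2} {f : SuperFun Ω (Fin q)}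
    (hf : f ∈ baseGr q Ω i) :
    SuperCommute (coordParity α) i (fibreD α : Module.End ℝ (TotalFun q r s Ω)) (mulBase f) := by
  ext x
  simp [mulBase, (isSuperDerivation_fibreD α).leibniz (fromBase_mem hf), fibreD_fromBase]

theorem superCommute_fibreD_fibreD (α β : Fin s ⊕ Fin r) :
    SuperCommute (coordParity α) (coordParity β)
      (fibreD α : Module.End ℝ (TotalFun q r s Ω)) (fibreD β) := by
  ext x
  exact fibreD_fibreD α β x

theorem superCommute_baseD_fibreD (A : Fin p ⊕ Fin q) (α : Fin s ⊕ Fin r) :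
    SuperCommute (coordParity A) (coordParity α)
      (baseD A : Module.End ℝ (TotalFun q r s Ω)) (fibreD α) := by
  ext x
  exact baseD_fibreD A α x

theorem superCommute_mulBase {i j : ZMod 2} {f g : SuperFun Ω (Fin q)}
    (hf : f ∈ baseGr q Ω i) (hg : g ∈ baseGr q Ω j) :
    SuperCommute i j (mulBase f : Module.End ℝ (TotalFun q r s Ω)) (mulBase g) := by
  ext x
  simp only [mulBase, Module.End.mul_apply, LinearMap.mulLeft_apply, LinearMap.smul_apply,
    ← mul_assoc, SuperFun.isSuperCommAlgebra.supercomm (fromBase_mem hf) (fromBase_mem hg),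
    smul_mul_assoc]

/-- `jet k X` is built from fibre derivatives and multiplications by base functions only, so
whatever supercommutes with these supercommutes with it. The parities of the two derivatives
introduced at each step of the recursion cancel. -/
theorem superCommute_jet {j : ZMod 2} {T : Module.End ℝ (TotalFun q r s Ω)}
    (hD : ∀ α, SuperCommute j (coordParity α) T (fibreD α))
    (hB : ∀ {i : ZMod 2} {f : SuperFun Ω (Fin q)}, f ∈ baseGr q Ω i → SuperCommute j i T (mulBase f)) :
    ∀ (k : ℕ) {x : ZMod 2} {X : TotalFun q r s Ω}, X ∈ totalGr q r s Ω x →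
      SuperCommute j x T (jet k X)
  | 0, x, X, hX => hB (toZeroSection_mem hX)
  | k + 1, x, X, hX => by
    rw [jet_succ]
    refine (SuperCommute.sum_right _ fun α _ => ?_).smul_right _
    have := (hD α).mul_right (superCommute_jet hD hB k ((isSuperDerivation_fibreD α).mem hX))
    rwa [show coordParity α + (x + coordParity α) = x by
      rw [add_left_comm, CharTwo.add_self_eq_zero, add_zero]] at this

theorem superCommute_fibreD_jet (α : Fin s ⊕ Fin r) (k : ℕ) {x : ZMod 2} {X : TotalFun q r s Ω}
    (hX : X ∈ totalGr q r s Ω x) : SuperCommute (coordParity α) x (fibreD α) (jet k X) :=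
  superCommute_jet (superCommute_fibreD_fibreD α) (superCommute_fibreD_mulBase α) k hX

theorem superCommute_mulBase_jet {i : ZMod 2} {f : SuperFun Ω (Fin q)} (hf : f ∈ baseGr q Ω i)
    (k : ℕ) {x : ZMod 2} {X : TotalFun q r s Ω} (hX : X ∈ totalGr q r s Ω x) :
    SuperCommute i x (mulBase f) (jet k X) :=
  superCommute_jet (fun α => (superCommute_fibreD_mulBase α hf).symm)
    (fun hg => superCommute_mulBase hf hg) k hX

theorem superCommute_jet_jet (k l : ℕ) {x y : ZMod 2} {X Y : TotalFun q r s Ω}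
    (hX : X ∈ totalGr q r s Ω x) (hY : Y ∈ totalGr q r s Ω y) :
    SuperCommute x y (jet k X) (jet l Y) :=
  superCommute_jet (fun α => (superCommute_fibreD_jet α k hX).symm)
    (fun hg => (superCommute_mulBase_jet hg k hX).symm) l hY

theorem mulBase_mul (f g : SuperFun Ω (Fin q)) :
    (mulBase (f * g) : Module.End ℝ (TotalFun q r s Ω)) = mulBase f * mulBase g := by
  ext x
  simp [mulBase]

/-- Distributing the factor `n + 1 = a + b` over the two indices, as in Euler's identity, matches
the denominators in the recursion for `jet` in each factor of a product. -/
theorem sum_antidiagonal_weighted {V : Type*} [AddCommGroup V] [Module ℝ V] (n : ℕ)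
    (F : ℕ → ℕ → V) :
    ((n : ℝ) + 1) • ∑ ab ∈ Finset.HasAntidiagonal.antidiagonal (n + 1), F ab.1 ab.2 =
      ∑ ab ∈ Finset.HasAntidiagonal.antidiagonal n, (((ab.1 : ℝ) + 1) • F (ab.1 + 1) ab.2 +
        ((ab.2 : ℝ) + 1) • F ab.1 (ab.2 + 1)) := by
  have h1 : ∑ ab ∈ Finset.HasAntidiagonal.antidiagonal (n + 1), (ab.1 : ℝ) • F ab.1 ab.2 =
      ∑ ab ∈ Finset.HasAntidiagonal.antidiagonal n, ((ab.1 : ℝ) + 1) • F (ab.1 + 1) ab.2 := by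
    rw [Finset.Nat.sum_antidiagonal_succ]
    simp
  have h2 : ∑ ab ∈ Finset.HasAntidiagonal.antidiagonal (n + 1), (ab.2 : ℝ) • F ab.1 ab.2 =
      ∑ ab ∈ Finset.HasAntidiagonal.antidiagonal n, ((ab.2 : ℝ) + 1) • F ab.1 (ab.2 + 1) := by
    rw [Finset.Nat.sum_antidiagonal_succ']
    simp
  rw [Finset.sum_add_distrib, ← h1, ← h2, ← Finset.sum_add_distrib, Finset.smul_sum]
  refine Finset.sum_congr rfl fun ab hab => ?_
  rw [Finset.HasAntidiagonal.mem_antidiagonal] at hab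
  rw [← add_smul]
  congr 1
  exact_mod_cast hab.symm

/-- Induction by the Leibniz rule for `∂/∂η_α`. When the derivative falls on `Y`, the operator
`∂/∂ξ^α` must pass `jet a X`, and the sign from supercommuting them cancels the Leibniz sign. -/
theorem jet_mul : ∀ (n : ℕ) {x : ZMod 2} {X : TotalFun q r s Ω} (_ : X ∈ totalGr q r s Ω x)
    (Y : TotalFun q r s Ω),
    jet n (X * Y) = ∑ ab ∈ Finset.HasAntidiagonal.antidiagonal n, jet ab.1 X * jet ab.2 Y
  | 0, x, X, hX, Y => by simp [jet_zero, mulBase_mul]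
  | n + 1, x, X, hX, Y => by
    have hn : ((n : ℝ) + 1) ≠ 0 := by positivity
    refine smul_right_injective _ hn ?_
    simp only
    rw [succ_smul_jet_succ, sum_antidiagonal_weighted n fun a b => jet a X * jet b Y]
    have e : ∀ α : Fin s ⊕ Fin r, fibreD α * jet n (fibreD α (X * Y)) =
        ∑ ab ∈ Finset.HasAntidiagonal.antidiagonal n, (fibreD α * jet ab.1 (fibreD α X) * jet ab.2 Y +
          jet ab.1 X * (fibreD α * jet ab.2 (fibreD α Y))) := by
      intro α
      rw [(isSuperDerivation_fibreD α).leibniz hX, map_add, map_smul,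
        jet_mul n ((isSuperDerivation_fibreD α).mem hX) Y, jet_mul n hX, mul_add, mul_smul_comm,
        Finset.mul_sum, Finset.mul_sum, Finset.smul_sum, ← Finset.sum_add_distrib]
      refine Finset.sum_congr rfl fun ab _ => ?_
      rw [← mul_assoc, ← mul_assoc (fibreD α) (jet ab.1 X), superCommute_fibreD_jet α ab.1 hX,
        smul_mul_assoc, smul_smul, sgn_mul_self, one_smul, mul_assoc (jet ab.1 X)]
    rw [Finset.sum_congr rfl fun α _ => e α, Finset.sum_comm]
    refine Finset.sum_congr rfl fun ab _ => ?_
    rw [Finset.sum_add_distrib, ← smul_mul_assoc, succ_smul_jet_succ, ← mul_smul_comm,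
      succ_smul_jet_succ, Finset.sum_mul, Finset.mul_sum]

/-- Multiplication by a fibre coordinate. -/
def mulFibre (α : Fin s ⊕ Fin r) : Module.End ℝ (TotalFun q r s Ω) :=
  LinearMap.mulLeft ℝ (fibreCoord α)

theorem superCommute_mulFibre_mulBase (α : Fin s ⊕ Fin r) {i : ZMod 2} {f : SuperFun Ω (Fin q)}
    (hf : f ∈ baseGr q Ω i) :
    SuperCommute (coordParity α) i (mulFibre α : Module.End ℝ (TotalFun q r s Ω)) (mulBase f) := by
  ext x
  simp only [mulBase, mulFibre, Module.End.mul_apply, LinearMap.mulLeft_apply,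
    LinearMap.smul_apply, ← mul_assoc,
    SuperFun.isSuperCommAlgebra.supercomm (fibreCoord_mem α) (fromBase_mem hf), smul_mul_assoc]

open scoped Classical in
theorem fibreD_mul_mulFibre (α β : Fin s ⊕ Fin r) :
    (fibreD α * mulFibre β : Module.End ℝ (TotalFun q r s Ω)) =
      (if α = β then 1 else 0) + sgn (coordParity α * coordParity β) • (mulFibre β * fibreD α) := by
  ext x
  simp only [mulFibre, Module.End.mul_apply, LinearMap.mulLeft_apply,
    (isSuperDerivation_fibreD α).leibniz (fibreCoord_mem β), fibreD_fibreCoord, LinearMap.add_apply,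
    LinearMap.smul_apply]
  split_ifs <;> simp

theorem jet_zero_mul_mulFibre {x : ZMod 2} {X : TotalFun q r s Ω} (hX : X ∈ totalGr q r s Ω x)
    (β : Fin s ⊕ Fin r) :
    jet 0 X * mulFibre β = sgn (x * coordParity β) • (mulFibre β * jet 0 X) :=
  (superCommute_mulFibre_mulBase β (toZeroSection_mem hX)).symm

/-- The canonical commutation relation: multiplication by `ξ^β` passes the fibre derivatives except
for one contraction, which lowers the order by one and replaces `X` by `∂X/∂η_β`. -/
theorem jet_succ_mul_mulFibre : ∀ (k : ℕ) {x : ZMod 2} {X : TotalFun q r s Ω}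
    (_ : X ∈ totalGr q r s Ω x) (β : Fin s ⊕ Fin r),
    jet (k + 1) X * mulFibre β = sgn (x * coordParity β) • (mulFibre β * jet (k + 1) X) +
      sgn (coordParity β * (x + coordParity β)) • jet k (fibreD β X) := by
  classical
  intro k
  induction k with
  | zero =>
    intro x X hX β
    have e : ∀ α : Fin s ⊕ Fin r, fibreD α * jet 0 (fibreD α X) * mulFibre β =
        sgn (x * coordParity β) • (mulFibre β * (fibreD α * jet 0 (fibreD α X))) +
        if α = β then sgn (coordParity β * (x + coordParity β)) • jet 0 (fibreD β X) else 0 := by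
      intro α
      have hx := (isSuperDerivation_fibreD α).mem hX
      rw [mul_assoc, jet_zero_mul_mulFibre hx, mul_smul_comm, ← mul_assoc, fibreD_mul_mulFibre,
        add_mul (@ite _ _ _ _ _), smul_add, smul_mul_assoc, smul_smul, ← sgn_add,
        mul_assoc (mulFibre β), add_comm]
      congr 1
      · congr 2
        generalize coordParity α = i
        generalize coordParity β = j
        clear hx hX; revert x i j; decide
      · split_ifs with h
        · subst h
          rw [one_mul, mul_comm]
        · simp
    rw [jet_succ, Nat.cast_zero, zero_add, div_one, one_smul, Finset.sum_mul,
      Finset.sum_congr rfl fun α _ => e α, Finset.sum_add_distrib, ← Finset.smul_sum,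
      ← Finset.mul_sum]
    simp
  | succ k ih =>
    intro x X hX β
    -- The three terms: `ξ^β` passes everything; it is contracted inside by the induction
    -- hypothesis; it is contracted with the outer derivative. Summed over `α`, the second gives `k
    -- + 1` copies of the contraction and the third one more, in total the factor by which the goal
    -- is multiplied.
    have e : ∀ α : Fin s ⊕ Fin r, fibreD α * jet (k + 1) (fibreD α X) * mulFibre β =
        sgn (x * coordParity β) • (mulFibre β * (fibreD α * jet (k + 1) (fibreD α X))) +
        sgn (coordParity β * (x + coordParity β)) • (fibreD α * jet k (fibreD α (fibreD β X))) +
        if α = β then sgn (coordParity β * (x + coordParity β)) • jet (k + 1) (fibreD β X)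
        else 0 := by
      intro α
      have hx := (isSuperDerivation_fibreD α).mem hX
      rw [mul_assoc, ih hx, mul_add, mul_smul_comm, mul_smul_comm, ← mul_assoc,
        fibreD_mul_mulFibre, add_mul (@ite _ _ _ _ _), smul_add, smul_mul_assoc, smul_smul,
        ← sgn_add, mul_assoc (mulFibre β), fibreD_fibreD β α, map_smul, mul_smul_comm, smul_smul,
        ← sgn_add, add_comm (_ • (@ite _ _ _ _ _ * _)),
        add_right_comm]
      clear hx hX ih
      congr 1
      · congr 3
        · generalize coordParity α = i
          generalize coordParity β = j
          revert x i j; decide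
        · generalize coordParity α = i
          generalize coordParity β = j
          revert x i j; decide
      · split_ifs with h
        · subst h
          rw [one_mul, mul_comm]
        · simp
    have hn : (((k + 1 : ℕ) : ℝ) + 1) ≠ 0 := by positivity
    refine smul_right_injective _ hn ?_
    simp only
    rw [smul_add, ← smul_mul_assoc, smul_comm _ (sgn _), ← mul_smul_comm, succ_smul_jet_succ,
      Finset.sum_mul, Finset.sum_congr rfl fun α _ => e α, Finset.sum_add_distrib,
      Finset.sum_add_distrib, ← Finset.smul_sum, ← Finset.smul_sum, ← Finset.mul_sum,
      ← succ_smul_jet_succ k (fibreD β X)]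
    simp only [Finset.sum_ite_eq', Finset.mem_univ, if_true]
    push_cast
    module

/-- Base derivatives supercommute with fibre derivatives, so only the coefficient of `jet k X` is
differentiated. -/
theorem baseD_mul_jet : ∀ (k : ℕ) {x : ZMod 2} {X : TotalFun q r s Ω}
    (_ : X ∈ totalGr q r s Ω x) (A : Fin p ⊕ Fin q),
    baseD A * jet k X = jet k (baseD A X) + sgn (coordParity A * x) • (jet k X * baseD A)
  | 0, x, X, hX, A => by
    ext y
    simp only [jet_zero, mulBase, Module.End.mul_apply, LinearMap.mulLeft_apply,
      (isSuperDerivation_baseD A).leibniz (fromBase_mem (toZeroSection_mem hX)), baseD_fromBase,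
      partialD_toZeroSection, LinearMap.add_apply, LinearMap.smul_apply]
  | k + 1, x, X, hX, A => by
    have e : ∀ α : Fin s ⊕ Fin r, baseD A * (fibreD α * jet k (fibreD α X)) =
        fibreD α * jet k (fibreD α (baseD A X)) +
          sgn (coordParity A * x) • (fibreD α * jet k (fibreD α X) * baseD A) := by
      intro α
      rw [← mul_assoc, superCommute_baseD_fibreD, smul_mul_assoc, mul_assoc,
        baseD_mul_jet k ((isSuperDerivation_fibreD α).mem hX), baseD_fibreD, map_smul, mul_add,
        smul_add, mul_smul_comm, smul_smul, sgn_mul_self, one_smul, mul_smul_comm, smul_smul,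
        mul_add, sgn_add, mul_left_comm, sgn_mul_self, mul_one, mul_assoc]
    rw [jet_succ, jet_succ, mul_smul_comm, Finset.mul_sum, Finset.sum_congr rfl fun α _ => e α,
      Finset.sum_add_distrib, smul_add, ← Finset.smul_sum, ← Finset.sum_mul, smul_comm _ (sgn _),
      smul_mul_assoc]

end Jets

/-! ### Comparison of `jet` with the interior product. -/

section Interior

variable {p q r s : ℕ} {Ω : Opens (Fin p → ℝ)}

theorem superCommute_prod_fibreD_mulBase {i : ZMod 2} {f : SuperFun Ω (Fin q)}
    (hf : f ∈ baseGr q Ω i) : ∀ l : List (Fin s ⊕ Fin r),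
      SuperCommute (l.map coordParity).sum i
        (l.map (fibreD : _ → Module.End ℝ (TotalFun q r s Ω))).prod (mulBase f)
  | [] => by simp [SuperCommute]
  | α :: l => by
    rw [List.map_cons, List.map_cons, List.sum_cons, List.prod_cons]
    exact (superCommute_fibreD_mulBase α hf).mul_left (superCommute_prod_fibreD_mulBase hf l)

theorem prod_fibreD_mem {x : ZMod 2} {X : TotalFun q r s Ω} (hX : X ∈ totalGr q r s Ω x) :
    ∀ l : List (Fin s ⊕ Fin r),
      (l.map (fibreD : _ → Module.End ℝ (TotalFun q r s Ω))).prod X ∈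
        totalGr q r s Ω (x + (l.map coordParity).sum)
  | [] => by simpa using hX
  | α :: l => by
    rw [List.map_cons, List.map_cons, List.sum_cons, List.prod_cons, add_left_comm, add_comm,
      Module.End.mul_apply]
    exact (isSuperDerivation_fibreD α).mem (prod_fibreD_mem hX l)

theorem jet_eq_sum : ∀ (k : ℕ) (X : TotalFun q r s Ω),
    jet k X = (1 / (k.factorial : ℝ)) • ∑ α : Fin k → Fin s ⊕ Fin r,
      ((List.ofFn α).reverse.map fibreD).prod *
        mulBase (toZeroSection (((List.ofFn α).map fibreD).prod X))
  | 0, X => by simp [jet_zero]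
  | k + 1, X => by
    rw [jet_succ, Finset.sum_congr rfl fun α _ => by rw [jet_eq_sum k (fibreD α X), mul_smul_comm],
      ← Finset.smul_sum, smul_smul, Nat.factorial_succ]
    congr 1
    · push_cast
      rw [one_div_mul_one_div]
    -- The recursion differentiates `X` by the new index before the others and puts its `∂/∂ξ`
    -- leftmost; both amount to appending the index at the end of `α`.
    · rw [← Fintype.sum_equiv (Fin.snocEquiv fun _ : Fin (k + 1) => Fin s ⊕ Fin r) _ _
        fun _ => rfl, Fintype.sum_prod_type]
      refine Finset.sum_congr rfl fun a _ => ?_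
      rw [Finset.mul_sum]
      refine Finset.sum_congr rfl fun α _ => ?_
      have h : List.ofFn ((Fin.snocEquiv fun _ : Fin (k + 1) => Fin s ⊕ Fin r) (a, α)) =
          List.ofFn α ++ [a] := by
        rw [List.ofFn_succ_last]
        simp [Fin.snocEquiv]
      rw [h]
      simp [mul_assoc]

/-- For even `X` a coefficient has the same parity `i` as the string of derivatives it accompanies.
Moving it to the left costs `sgn (i * i) = sgn i`, which is exactly the sign built into
`taylorCoeff`. -/
theorem interior_eq_jet {X : TotalFun q r s Ω} (hX : X ∈ totalGr q r s Ω 0) (k : ℕ) :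
    interior X k = jet k X := by
  rw [jet_eq_sum, interior]
  congr 1
  refine Finset.sum_congr rfl fun α _ => ?_
  have h := toZeroSection_mem (prod_fibreD_mem hX (List.ofFn α))
  have hs : ((List.ofFn α).map coordParity).sum = ∑ i, coordParity (α i) := by
    rw [List.map_ofFn, List.sum_ofFn]; rfl
  have hc := superCommute_prod_fibreD_mulBase (r := r) (s := s) h (List.ofFn α).reverse
  rw [List.map_reverse, List.sum_reverse, hs, zero_add] at hc
  rw [hc, taylorCoeff, map_smul, mulBase]
  have e : ∀ i : ZMod 2, sgn (i * i) = sgn i := by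
    intro i; congr 1; revert i; decide
  rw [e]
  ext y
  simp

end Interior

/-! ### Commutators and double commutators in an associative algebra. -/

section Commutator

variable {R : Type*} [Ring R] [Algebra ℝ R]

/-- The commutator with `F`. -/
def ad (F : R) : R →ₗ[ℝ] R := LinearMap.mulLeft ℝ F - LinearMap.mulRight ℝ F

theorem ad_apply (F T : R) : ad F T = F * T - T * F := rfl

theorem ad_mul (F a b : R) : ad F (a * b) = ad F a * b + a * ad F b := by
  simp only [ad_apply]; noncomm_ring

theorem ad_eq_zero {F T : R} (h : F * T = T * F) : ad F T = 0 := by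
  rw [ad_apply, h, sub_self]

/-- The commutator with `F` of a differential `d` squares to zero if it commutes with `F`. -/
theorem commutator_sq_eq_zero {d F : R} (hd : d * d = 0) (h : ad F (ad F d) = 0) :
    ad F d * ad F d = 0 := by
  refine eq_zero_of_eq_neg ?_
  have h' : F * (F * d - d * F) = (F * d - d * F) * F := sub_eq_zero.1 h
  have h1 : (F * d - d * F) * d = -(d * (F * d - d * F)) := by
    rw [sub_mul, mul_sub, mul_assoc, hd, ← mul_assoc d d, hd, mul_assoc d F]
    simp
  rw [ad_apply]
  set K := F * d - d * F with hK
  -- `K` commutes with `F` by `h'` and anticommutes with `d` by `h1`, so expanding one factor `K`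
  -- turns `K * K` into its negative.
  calc K * K = K * (F * d - d * F) := by rw [← hK]
    _ = (K * F) * d - (K * d) * F := by noncomm_ring
    _ = -(F * (d * K)) + d * (F * K) := by
      rw [← h', mul_assoc F K d, h1, h', mul_neg, neg_mul, sub_neg_eq_add, mul_assoc]
    _ = -((F * d - d * F) * K) := by noncomm_ring
    _ = -(K * K) := by rw [← hK]

section Twice

variable {F t x x' q D G G' H w : R} {i i' : ZMod 2} (ht : ∀ T, ad F (t * T) = t * ad F T)
  (hx : ad F x = sgn i • (t * G)) (hG : ad F G = 0)
include ht hx hG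

/-- Models an anchor term `ξ q ∂/∂x` of the differential. `F` commutes with `q` and with the
commutators `t G` and `H`, so two applications of `ad F` must hit `x` and `D` once each; the two
orders give the factor `2`. The next lemma treats `ξ ξ' w` in the same way. -/
theorem ad_ad_mul_mul (hq : ad F q = 0) (hD : ad F D = -H) (hH : ad F H = 0) :
    ad F (ad F (x * q * D)) = (-(2 * sgn i)) • (t * (G * q * H)) := by
  simp only [ad_mul, map_add, map_smul, map_neg, ht, hx, hG, hq, hD, hH, smul_mul_assoc, mul_neg,
    mul_zero, zero_mul, add_zero, zero_add, mul_assoc]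
  module

theorem ad_ad_mul_mul_mul (hx' : ad F x' = sgn i' • (t * G')) (hG' : ad F G' = 0)
    (hw : ad F w = 0) (ht' : ∀ T, t * T = T * t) :
    ad F (ad F (x * x' * w)) = (2 * sgn (i + i')) • (t * (t * (G * G' * w))) := by
  have h : G * (t * (G' * w)) = t * (G * (G' * w)) := by rw [← mul_assoc, ← ht', mul_assoc]
  simp only [ad_mul, map_add, map_smul, ht, hx, hG, hx', hG', hw, smul_mul_assoc, mul_smul_comm,
    mul_zero, zero_mul, add_zero, zero_add, mul_assoc, sgn_add, h]
  module

end Twice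

/-- For `X = Y` even, the two anchor terms of the Schouten bracket agree after reordering; this
supplies the `2` produced by the double commutator. -/
theorem anchor_term_eq {i j : ZMod 2} {q G H : R}
    (hqG : SuperCommute (i + j + 1) i q G) (hHG : SuperCommute j i H G) :
    sgn (i + 1) • q * (sgn ((0 + 1) * (j + 1) + j * (i + 1)) • (G * H) -
      sgn (0 * (i + 1)) • (H * G)) = (2 * sgn i) • (G * q * H) := by
  rw [SuperCommute] at hqG hHG
  simp only [hHG, mul_sub, smul_mul_assoc, mul_smul_comm, ← mul_assoc, hqG]
  rcases eq_zero_or_one i with rfl | rfl <;> rcases eq_zero_or_one j with rfl | rfl <;>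
    simp only [mul_zero, mul_one, zero_add, add_zero, CharTwo.add_self_eq_zero,
      sgn_zero, sgn_one] <;> module

theorem bracket_term_eq {i j l : ZMod 2} {t w D G G' : R} (ht : ∀ T, t * T = T * t)
    (hw : SuperCommute (i + j + l + 1) i w G) (hw' : SuperCommute (i + j + l + 1) j w G')
    (hD : SuperCommute l i D G) (hD' : SuperCommute l j D G') :
    sgn (0 * (i + 1)) • (sgn ((i + 1) + (j + 1)) • w * (t * D) * G' * G) =
      sgn (i + j) • (t * (G' * G * (w * D))) := by
  have h := (hw'.mul_left hD').mul_right (hw.mul_left hD)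
  rw [SuperCommute] at h
  rw [smul_mul_assoc, ← mul_assoc w, ← ht w, mul_assoc t, smul_mul_assoc, smul_mul_assoc,
    mul_assoc t, mul_assoc t, mul_assoc (w * D), h, mul_smul_comm, smul_smul, smul_smul, ← sgn_add,
    ← sgn_add]
  congr 2
  clear hw hw' hD hD' h
  revert i j l; decide

end Commutator

/-! ### The generating series of interior products and its double commutator with the differential.
-/

section JetSeries

variable {p q r s : ℕ} {Ω : Opens (Fin p → ℝ)}

/-- The generating series of the interior products with the Taylor components. -/
def jetSeries : TotalFun q r s Ω →ₗ[ℝ] PowerSeries (Module.End ℝ (TotalFun q r s Ω)) where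
  toFun X := PowerSeries.mk fun k => jet k X
  map_add' X Y := by ext1 n; simp
  map_smul' a X := by
    ext1 n
    rw [PowerSeries.coeff_mk, map_smul]
    exact congrArg (a • ·) (PowerSeries.coeff_mk n fun k => jet k X).symm

theorem coeff_jetSeries (k : ℕ) (X : TotalFun q r s Ω) :
    PowerSeries.coeff k (jetSeries X) = jet k X :=
  PowerSeries.coeff_mk _ fun k => jet k X

theorem coeff_real_smul {R : Type*} [Ring R] [Algebra ℝ R] (a : ℝ) (n : ℕ) (F : PowerSeries R) :
    PowerSeries.coeff n (a • F) = a • PowerSeries.coeff n F := rfl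

theorem C_real_smul {R : Type*} [Ring R] [Algebra ℝ R] (a : ℝ) (b : R) :
    PowerSeries.C (a • b) = a • PowerSeries.C b := by
  ext1 n
  rw [coeff_real_smul, PowerSeries.coeff_C, PowerSeries.coeff_C]
  split_ifs <;> simp

theorem jetSeries_mul {x : ZMod 2} {X : TotalFun q r s Ω} (hX : X ∈ totalGr q r s Ω x)
    (Y : TotalFun q r s Ω) : jetSeries (X * Y) = jetSeries X * jetSeries Y := by
  ext1 n
  rw [coeff_jetSeries, jet_mul n hX, PowerSeries.coeff_mul]
  simp only [coeff_jetSeries]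

theorem jetSeries_fromBase (f : SuperFun Ω (Fin q)) :
    jetSeries (fromBase f : TotalFun q r s Ω) = PowerSeries.C (mulBase f) := by
  ext1 n
  rw [coeff_jetSeries, PowerSeries.coeff_C]
  cases n with
  | zero => rw [jet_zero, toZeroSection_fromBase, if_pos rfl]
  | succ n => simp [jet_succ, fibreD_fromBase]

theorem jetSeries_one : jetSeries (1 : TotalFun q r s Ω) = 1 := by
  have h := jetSeries_fromBase (r := r) (s := s) (1 : SuperFun Ω (Fin q))
  rw [map_one] at h
  rw [h, show (mulBase 1 : Module.End ℝ (TotalFun q r s Ω)) = 1 by ext; simp [mulBase], map_one]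

/-- A fibre coordinate has weight one and vanishes on the zero section, so only the coefficient of
order one survives. -/
theorem jetSeries_fibreCoord (γ : Fin s ⊕ Fin r) :
    jetSeries (fibreCoord γ : TotalFun q r s Ω) = PowerSeries.X * PowerSeries.C (fibreD γ) := by
  classical
  ext1 n
  rw [coeff_jetSeries, PowerSeries.coeff_mul_C]
  cases n with
  | zero => simp [jet_zero, toZeroSection_fibreCoord, mulBase]
  | succ n =>
    have h1 : jet n (1 : TotalFun q r s Ω) = if n = 0 then 1 else 0 := by
      rw [← coeff_jetSeries, jetSeries_one, PowerSeries.coeff_one]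
    rw [jet_succ, PowerSeries.coeff_X, Finset.sum_eq_single γ
      (fun β _ hβ => by rw [fibreD_fibreCoord, if_neg hβ, map_zero, mul_zero]) (by simp),
      fibreD_fibreCoord, if_pos rfl, h1]
    cases n <;> simp

theorem superCommute_C_jetSeries {j x : ZMod 2} {T : Module.End ℝ (TotalFun q r s Ω)}
    {X : TotalFun q r s Ω} (h : ∀ k, SuperCommute j x T (jet k X)) :
    SuperCommute j x (PowerSeries.C T) (jetSeries X) := by
  rw [SuperCommute]
  ext1 n
  rw [coeff_real_smul, PowerSeries.coeff_C_mul, PowerSeries.coeff_mul_C, coeff_jetSeries, h n]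

theorem superCommute_jetSeries {x y : ZMod 2} {X Y : TotalFun q r s Ω}
    (hX : X ∈ totalGr q r s Ω x) (hY : Y ∈ totalGr q r s Ω y) :
    SuperCommute x y (jetSeries X) (jetSeries Y) := by
  rw [SuperCommute]
  ext1 n
  rw [coeff_real_smul, PowerSeries.coeff_mul, PowerSeries.coeff_mul, Finset.smul_sum,
    ← Finset.Nat.sum_antidiagonal_swap]
  refine Finset.sum_congr rfl fun ab _ => ?_
  simp only [Prod.fst_swap, Prod.snd_swap, coeff_jetSeries]
  exact superCommute_jet_jet _ _ hX hY

/-- The contraction in `jet_succ_mul_mulFibre` lowers the order by one, which the formal variable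
compensates; the term of order zero commutes with `ξ^α`. -/
theorem ad_jetSeries_mulFibre {X : TotalFun q r s Ω} (hX : X ∈ totalGr q r s Ω 0)
    (α : Fin s ⊕ Fin r) :
    ad (jetSeries X) (PowerSeries.C (mulFibre α)) =
      sgn (coordParity α) • (PowerSeries.X * jetSeries (fibreD α X)) := by
  ext1 n
  rw [ad_apply, map_sub, coeff_real_smul, PowerSeries.coeff_C_mul, PowerSeries.coeff_mul_C,
    coeff_jetSeries]
  cases n with
  | zero =>
    rw [jet_zero_mul_mulFibre hX]
    simp
  | succ n =>
    rw [jet_succ_mul_mulFibre n hX, PowerSeries.coeff_succ_X_mul, coeff_jetSeries]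
    have : sgn (coordParity α * coordParity α) = sgn (coordParity α) := by
      generalize coordParity α = i; congr 1; revert i; decide
    simp [this]

theorem ad_jetSeries_baseD {X : TotalFun q r s Ω} (hX : X ∈ totalGr q r s Ω 0)
    (A : Fin p ⊕ Fin q) :
    ad (jetSeries X) (PowerSeries.C (baseD A)) = -jetSeries (baseD A X) := by
  ext1 n
  rw [ad_apply, map_sub, PowerSeries.coeff_C_mul, PowerSeries.coeff_mul_C, map_neg,
    coeff_jetSeries, coeff_jetSeries, baseD_mul_jet n hX]
  simp

/-- The structure functions of a Lie algebroid are homogeneous. -/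
structure StructureFunctions.IsHomogeneous (c : StructureFunctions q r s Ω) : Prop where
  anchor : ∀ α A, c.anchor α A ∈ baseGr q Ω (coordParity α + coordParity A + 1)
  bracket : ∀ α β γ,
    c.bracket α β γ ∈ baseGr q Ω (coordParity α + coordParity β + coordParity γ + 1)

theorem deRham_eq (c : StructureFunctions q r s Ω) :
    deRham c = (∑ α, ∑ A, mulFibre α * mulBase (c.anchor α A) * baseD A) +
      (1 / 2 : ℝ) • ∑ α, ∑ β, ∑ γ,
        mulFibre α * mulFibre β * mulBase (c.bracket β α γ) * fibreD γ := by
  rw [deRham]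
  congr 2
  · simp only [LinearMap.mulLeft_mul, mulFibre, mulBase]; rfl
  · simp only [LinearMap.mulLeft_mul, mulFibre, mulBase]; rfl

theorem ad_X_mul {R : Type*} [Ring R] [Algebra ℝ R] (F T : PowerSeries R) :
    ad F (PowerSeries.X * T) = PowerSeries.X * ad F T := by
  rw [ad_mul, ad_eq_zero (PowerSeries.commute_X _).eq, zero_mul, zero_add]

section Even

variable {P : TotalFun q r s Ω} (hP : P ∈ totalGr q r s Ω 0)
include hP

theorem fibreD_mem_of_even (α : Fin s ⊕ Fin r) :
    fibreD α P ∈ totalGr q r s Ω (coordParity α) := by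
  simpa using (isSuperDerivation_fibreD α).mem hP

theorem baseD_mem_of_even (A : Fin p ⊕ Fin q) :
    baseD A P ∈ totalGr q r s Ω (coordParity A) := by
  simpa using (isSuperDerivation_baseD A).mem hP

theorem ad_jetSeries_mulBase {i : ZMod 2} {f : SuperFun Ω (Fin q)} (hf : f ∈ baseGr q Ω i) :
    ad (jetSeries P) (PowerSeries.C (mulBase f)) = 0 :=
  ad_eq_zero (superCommute_C_jetSeries fun k => superCommute_mulBase_jet hf k hP).symm.commute

theorem ad_jetSeries_fibreD (γ : Fin s ⊕ Fin r) :
    ad (jetSeries P) (PowerSeries.C (fibreD γ)) = 0 :=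
  ad_eq_zero (superCommute_C_jetSeries fun k => superCommute_fibreD_jet γ k hP).symm.commute

theorem ad_jetSeries_jetSeries {i : ZMod 2} {X : TotalFun q r s Ω} (hX : X ∈ totalGr q r s Ω i) :
    ad (jetSeries P) (jetSeries X) = 0 :=
  ad_eq_zero (superCommute_jetSeries hP hX).commute

theorem ad_ad_anchor_term {c : StructureFunctions q r s Ω} (hc : c.IsHomogeneous)
    (α : Fin s ⊕ Fin r) (A : Fin p ⊕ Fin q) :
    ad (jetSeries P) (ad (jetSeries P)
      (PowerSeries.C (mulFibre α * mulBase (c.anchor α A) * baseD A))) =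
      (-1 : ℝ) • (PowerSeries.X * jetSeries (fromBase (sgn (frameParity α) • c.anchor α A) *
        (sgn ((0 + 1) * (coordParity A + 1) + coordParity A * frameParity α) •
          (fibreD α P * baseD A P) - sgn (0 * frameParity α) • (baseD A P * fibreD α P)))) := by
  have hF := fibreD_mem_of_even hP α
  have hB := baseD_mem_of_even hP A
  have hq := hc.anchor α A
  have hqG := superCommute_C_jetSeries fun k =>
    superCommute_mulBase_jet (r := r) (s := s) hq k hF
  rw [jetSeries_mul (fromBase_mem (Submodule.smul_mem _ _ hq)), map_sub, map_smul jetSeries,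
    map_smul jetSeries, jetSeries_mul hF, jetSeries_mul hB, map_smul fromBase, map_smul jetSeries,
    jetSeries_fromBase]
  have e := anchor_term_eq hqG (superCommute_jetSeries hB hF)
  rw [frameParity, e, map_mul PowerSeries.C, map_mul PowerSeries.C,
    ad_ad_mul_mul (ad_X_mul _) (ad_jetSeries_mulFibre hP α)
    (ad_jetSeries_jetSeries hP hF) (ad_jetSeries_mulBase hP hq) (ad_jetSeries_baseD hP A)
    (ad_jetSeries_jetSeries hP hB), mul_smul_comm, smul_smul, neg_one_mul]

theorem ad_ad_bracket_term {c : StructureFunctions q r s Ω} (hc : c.IsHomogeneous)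
    (α β γ : Fin s ⊕ Fin r) :
    ad (jetSeries P) (ad (jetSeries P)
      (PowerSeries.C (mulFibre β * mulFibre α * mulBase (c.bracket α β γ) * fibreD γ))) =
      (2 : ℝ) • (PowerSeries.X * jetSeries (sgn (0 * frameParity α) •
      (fromBase (sgn (frameParity α + frameParity β) • c.bracket α β γ) * fibreCoord γ *
        fibreD β P * fibreD α P))) := by
  have hF := fibreD_mem_of_even hP
  have hq := hc.bracket α β γ
  have hqG := fun δ => superCommute_C_jetSeries fun k =>
    superCommute_mulBase_jet (r := r) (s := s) hq k (hF δ)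
  have hδG := fun δ => superCommute_C_jetSeries fun k =>
    superCommute_fibreD_jet (r := r) (s := s) γ k (hF δ)
  have hX : ∀ T : PowerSeries (Module.End ℝ (TotalFun q r s Ω)),
    PowerSeries.X * T = T * PowerSeries.X := fun T => (PowerSeries.commute_X T).eq.symm
  have hb := fromBase_mem (r := r) (s := s) (Submodule.smul_mem _
    (sgn (frameParity α + frameParity β)) hq)
  have hb' := SuperFun.isSuperCommAlgebra.mul_mem hb (fibreCoord_mem γ)
  rw [map_smul jetSeries, jetSeries_mul (SuperFun.isSuperCommAlgebra.mul_mem hb' (hF β)),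
    jetSeries_mul hb', jetSeries_mul hb, jetSeries_fibreCoord, map_smul fromBase,
    map_smul jetSeries, jetSeries_fromBase]
  have e := bracket_term_eq hX (hqG α) (hqG β) (hδG α) (hδG β)
  have hw : ad (jetSeries P) (PowerSeries.C (mulBase (c.bracket α β γ)) *
      PowerSeries.C (fibreD γ)) = 0 := by
    rw [ad_mul, ad_jetSeries_mulBase hP hq, ad_jetSeries_fibreD hP, mul_zero, zero_mul, add_zero]
  rw [frameParity, frameParity, e, mul_assoc (mulFibre β * mulFibre α), map_mul PowerSeries.C,
    map_mul PowerSeries.C, map_mul PowerSeries.C,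
    ad_ad_mul_mul_mul (ad_X_mul _) (ad_jetSeries_mulFibre hP β) (ad_jetSeries_jetSeries hP (hF β))
    (ad_jetSeries_mulFibre hP α) (ad_jetSeries_jetSeries hP (hF α)) hw hX, mul_smul_comm, smul_smul,
    add_comm (coordParity α)]

/-- The Schouten bracket is the double commutator of the interior product with the differential,
term by term: anchor with anchor and bracket with bracket. The formal variable appears because the
components of weights `k` and `l` contribute to weight `k + l - 1`. -/
theorem ad_ad_deRham {c : StructureFunctions q r s Ω} (hc : c.IsHomogeneous) :
    ad (jetSeries P) (ad (jetSeries P) (PowerSeries.C (deRham c))) =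
      (-1 : ℝ) • (PowerSeries.X * jetSeries (schouten c 0 P P)) := by
  rw [deRham_eq, map_add, C_real_smul, schouten, map_sub, mul_sub]
  simp only [map_sum, map_add, map_smul (ad (jetSeries P)), ad_ad_anchor_term hP hc, Finset.mul_sum]
  -- The differential contains `ξ^α ξ^β Q_{βα}`, the Schouten bracket `Q_{αβ}`, so the two summation
  -- indices are exchanged. The factor `2` of each bracket term is then absorbed by the `1 / 2` in
  -- the differential.
  rw [Finset.sum_comm (γ := Fin s ⊕ Fin r) (f := fun α β => ∑ γ, _)]
  simp only [ad_ad_bracket_term hP hc]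
  simp only [← Finset.smul_sum]
  rw [smul_smul, show (1 / 2 : ℝ) * 2 = 1 by norm_num, one_smul, smul_sub, sub_eq_add_neg,
    ← neg_smul, neg_neg, one_smul]

/-- The coefficients of `[F, d_E]` are the negatives of the `L_{P_k}`, and the square of this series
vanishes. -/
theorem sum_lieDerivative_mul_lieDerivative {c : StructureFunctions q r s Ω}
    (hc : c.IsHomogeneous) (hd : deRham c * deRham c = 0) (hS : schouten c 0 P P = 0) (n : ℕ) :
    ∑ kl ∈ Finset.HasAntidiagonal.antidiagonal n,
      lieDerivative c P kl.1 * lieDerivative c P kl.2 = 0 := by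
  have h := commutator_sq_eq_zero (F := jetSeries P) (d := PowerSeries.C (deRham c))
    (by rw [← map_mul, hd, map_zero])
    (by rw [ad_ad_deRham hP hc, hS, map_zero, mul_zero, smul_zero])
  have hk : ∀ k, PowerSeries.coeff k (ad (jetSeries P) (PowerSeries.C (deRham c))) =
      -lieDerivative c P k := fun k => by
    rw [ad_apply, map_sub, PowerSeries.coeff_C_mul, PowerSeries.coeff_mul_C, coeff_jetSeries,
      lieDerivative, interior_eq_jet hP, neg_sub]
  have h' := congrArg (PowerSeries.coeff n) h
  rw [PowerSeries.coeff_mul, map_zero] at h'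
  rw [← h']
  refine Finset.sum_congr rfl fun kl _ => ?_
  rw [hk, hk]
  exact (neg_mul_neg (lieDerivative c P kl.1) (lieDerivative c P kl.2)).symm

end Even

end JetSeries

/-! ### Abstract trivialisations and the differential on generators. -/

/-- An identification of an algebra `O` and an `O`-algebra `F` with the functions on a superdomain and
on the total space of a trivial bundle over it. -/
structure TotalChart {O F : Type*} [Ring O] [Algebra ℝ O] [Ring F] [Algebra ℝ F]
    (grO : ZMod 2 → Submodule ℝ O) (grF : ZMod 2 → Submodule ℝ F) (π : O →ₐ[ℝ] F) {p : ℕ}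
    (q r s : ℕ) (Ω : Opens (Fin p → ℝ)) where
  base : O ≃ₐ[ℝ] SuperFun Ω (Fin q)
  total : F ≃ₐ[ℝ] TotalFun q r s Ω
  base_mem : ∀ i f, base f ∈ baseGr q Ω i ↔ f ∈ grO i
  total_mem : ∀ i f, total f ∈ totalGr q r s Ω i ↔ f ∈ grF i
  total_pullback : ∀ f, total (π f) = fromBase (base f)

namespace TotalChart

variable {O F : Type*} [Ring O] [Algebra ℝ O] [Ring F] [Algebra ℝ F]
  {grO : ZMod 2 → Submodule ℝ O} {grF : ZMod 2 → Submodule ℝ F} {π : O →ₐ[ℝ] F} {p q r s : ℕ}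
  {Ω : Opens (Fin p → ℝ)} (χ : TotalChart grO grF π q r s Ω)

/-- The fibre coordinates. -/
def xi (α : Fin s ⊕ Fin r) : F := χ.total.symm (fibreCoord α)

/-- The operator on `F` with the coordinate expression `D`. -/
def lift (D : Module.End ℝ (TotalFun q r s Ω)) : Module.End ℝ F :=
  χ.total.toLinearEquiv.symm.conj D

theorem lift_apply (D : Module.End ℝ (TotalFun q r s Ω)) (x : F) :
    χ.lift D x = χ.total.symm (D (χ.total x)) := rfl

theorem total_lift (D : Module.End ℝ (TotalFun q r s Ω)) (x : F) :
    χ.total (χ.lift D x) = D (χ.total x) := by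
  rw [lift_apply, AlgEquiv.apply_symm_apply]

theorem lift_mul (D D' : Module.End ℝ (TotalFun q r s Ω)) :
    χ.lift (D * D') = χ.lift D * χ.lift D' := by
  ext x
  simp [lift_apply]

theorem total_xi (α : Fin s ⊕ Fin r) : χ.total (χ.xi α) = fibreCoord α :=
  AlgEquiv.apply_symm_apply _ _

theorem xi_mem (α : Fin s ⊕ Fin r) : χ.xi α ∈ grF (coordParity α) := by
  rw [← χ.total_mem, total_xi]
  exact fibreCoord_mem α

include χ in
theorem pullback_mem {i : ZMod 2} {f : O} (hf : f ∈ grO i) : π f ∈ grF i := by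
  rw [← χ.total_mem, total_pullback]
  exact fromBase_mem ((χ.base_mem i f).2 hf)

theorem isSuperDerivation_lift {d : ZMod 2} {D : Module.End ℝ (TotalFun q r s Ω)}
    (hD : IsSuperDerivation (totalGr q r s Ω) d D) : IsSuperDerivation grF d (χ.lift D) :=
  hD.conj χ.total χ.total_mem

theorem derivation_ext {d : ZMod 2} {D D' : Module.End ℝ F} (hD : IsSuperDerivation grF d D)
    (hD' : IsSuperDerivation grF d D') (hb : ∀ f, D (π f) = D' (π f))
    (hf : ∀ α, D (χ.xi α) = D' (χ.xi α)) : D = D' := by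
  have hm : ∀ i b, χ.total.symm b ∈ grF i ↔ b ∈ totalGr q r s Ω i := fun i b => by
    rw [← χ.total_mem, AlgEquiv.apply_symm_apply]
  have h := total_derivation_ext (hD.conj χ.total.symm hm) (hD'.conj χ.total.symm hm)
    (fun f => ?_) fun α => ?_
  · ext x
    have := LinearMap.congr_fun h (χ.total x)
    simpa [LinearEquiv.conj_apply] using this
  · have : χ.total.symm (fromBase f) = π (χ.base.symm f) := by
      rw [AlgEquiv.symm_apply_eq, total_pullback, AlgEquiv.apply_symm_apply]
    simp [LinearEquiv.conj_apply, this, hb]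
  · have := hf α
    rw [xi] at this
    simp [LinearEquiv.conj_apply, this]

/-- The structure functions with the anchors `a α` of the basis sections and the structure functions
`C` of their brackets. -/
def structureFunctions (a : Fin s ⊕ Fin r → Module.End ℝ O)
    (C : Fin s ⊕ Fin r → Fin s ⊕ Fin r → Fin s ⊕ Fin r → O) : StructureFunctions q r s Ω where
  anchor α A := χ.base (a α (χ.base.symm (SuperFun.coord _ _ A)))
  bracket α β γ := sgn (frameParity β) • χ.base (C α β γ)

variable {a : Fin s ⊕ Fin r → Module.End ℝ O}
  {C : Fin s ⊕ Fin r → Fin s ⊕ Fin r → Fin s ⊕ Fin r → O}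

theorem isHomogeneous (ha : ∀ α, IsSuperDerivation grO (frameParity α) (a α))
    (hC : ∀ α β γ, C α β γ ∈ grO (frameParity α + frameParity β + frameParity γ)) :
    (χ.structureFunctions a C).IsHomogeneous where
  anchor α A := by
    have h : χ.base.symm (SuperFun.coord _ _ A) ∈ grO (coordParity A) := by
      rw [← χ.base_mem, AlgEquiv.apply_symm_apply, coordParity_eq_idxParity]
      exact SuperFun.coord_mem A
    have := (χ.base_mem _ _).2 ((ha α).mem h)
    rwa [frameParity, ← add_assoc, add_comm (coordParity A)] at this
  bracket α β γ := by
    refine Submodule.smul_mem _ _ ?_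
    have := (χ.base_mem _ _).2 (hC α β γ)
    have e : ∀ i j k : ZMod 2, i + 1 + (j + 1) + (k + 1) = i + j + k + 1 := by decide
    rwa [frameParity, frameParity, frameParity, e] at this

/-- A derivation is recovered from its components on the coordinates, since both sides are
derivations that agree there. -/
theorem base_derivation {D : Module.End ℝ O} {d : ZMod 2} (hD : IsSuperDerivation grO d D) (f : O) :
    χ.base (D f) = ∑ A, χ.base (D (χ.base.symm (SuperFun.coord _ _ A))) *
      SuperFun.partialD Ω (Fin q) A (χ.base f) := by
  have hm : ∀ i b, χ.base.symm b ∈ grO i ↔ b ∈ baseGr q Ω i := fun i b => by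
    rw [← χ.base_mem, AlgEquiv.apply_symm_apply]
  have h := SuperFun.derivation_ext (hD.conj χ.base.symm hm)
    (D' := ∑ A, LinearMap.mulLeft ℝ (χ.base (D (χ.base.symm (SuperFun.coord _ _ A)))) *
      SuperFun.partialD Ω (Fin q) A) (IsSuperDerivation.sum _ fun A _ => ?_) (fun B => ?_)
  · have := LinearMap.congr_fun h (χ.base f)
    simpa [LinearEquiv.conj_apply] using this
  · have hc : SuperFun.coord Ω (Fin q) A ∈ baseGr q Ω (coordParity A) := by
      rw [coordParity_eq_idxParity]
      exact SuperFun.coord_mem A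
    have h1 := (isSuperDerivation_partialD_base A).mulLeft_mul SuperFun.isSuperCommAlgebra
      ((χ.base_mem _ _).2 (hD.mem ((hm _ _).2 hc)))
    rwa [add_right_comm, CharTwo.add_self_eq_zero, zero_add] at h1
  · simp [LinearEquiv.conj_apply, SuperFun.partialD_coord, -Fintype.sum_sum_type]

theorem isSuperDerivation_deRham {c : StructureFunctions q r s Ω} (hc : c.IsHomogeneous) :
    IsSuperDerivation (totalGr q r s Ω) 1 (deRham c) := by
  refine (IsSuperDerivation.sum _ fun α _ => IsSuperDerivation.sum _ fun A _ => ?_).add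
    (IsSuperDerivation.smul _ (IsSuperDerivation.sum _ fun α _ => IsSuperDerivation.sum _ fun β _ =>
      IsSuperDerivation.sum _ fun γ _ => ?_))
  · have h := (isSuperDerivation_baseD A).mulLeft_mul SuperFun.isSuperCommAlgebra
      (SuperFun.isSuperCommAlgebra.mul_mem (fibreCoord_mem α) (fromBase_mem (hc.anchor α A)))
    have e : ∀ i j : ZMod 2, i + (i + j + 1) + j = 1 := by decide
    rwa [e] at h
  · have h := (isSuperDerivation_fibreD γ).mulLeft_mul SuperFun.isSuperCommAlgebra
      (SuperFun.isSuperCommAlgebra.mul_mem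
        (SuperFun.isSuperCommAlgebra.mul_mem (fibreCoord_mem α) (fibreCoord_mem β))
        (fromBase_mem (hc.bracket β α γ)))
    have e : ∀ i j k : ZMod 2, i + j + (j + i + k + 1) + k = 1 := by decide
    rwa [e] at h

/-- This value and the one in `deRham_xi` determine the differential. They no longer mention the
base coordinates, so `d_E² = 0` and the change of trivialisation are computed from them. -/
theorem deRham_pullback (ha : ∀ α, IsSuperDerivation grO (frameParity α) (a α)) (f : O) :
    χ.lift (deRham (χ.structureFunctions a C)) (π f) = ∑ α, χ.xi α * π (a α f) := by
  apply χ.total.injective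
  rw [total_lift]
  simp [deRham, total_pullback, baseD_fromBase, fibreD_fromBase, total_xi,
    χ.base_derivation (ha _) f, Finset.mul_sum, mul_assoc, structureFunctions,
    -Fintype.sum_sum_type]

theorem deRham_xi (γ : Fin s ⊕ Fin r) :
    χ.lift (deRham (χ.structureFunctions a C)) (χ.xi γ) =
      (1 / 2 : ℝ) • ∑ α, ∑ β, sgn (frameParity α) • (χ.xi α * χ.xi β * π (C β α γ)) := by
  classical
  apply χ.total.injective
  rw [total_lift]
  simp [deRham, total_pullback, baseD_fibreCoord, fibreD_fibreCoord, total_xi,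
    structureFunctions, -Fintype.sum_sum_type]

end TotalChart

theorem eq_zero_of_eq_neg_two_smul {V : Type*} [AddCommGroup V] [Module ℝ V] {x : V}
    (h : x = (-2 : ℝ) • x) : x = 0 := by
  have h3 : (3 : ℝ) • x = 0 := by
    calc (3 : ℝ) • x = x - (-2 : ℝ) • x := by module
      _ = 0 := by rw [← h, sub_self]
  exact (smul_eq_zero.1 h3).resolve_left (by norm_num)

theorem sum_sum_sum_rotate {ι V : Type*} [Fintype ι] [AddCommMonoid V] (f : ι → ι → ι → V) :
    ∑ a, ∑ b, ∑ c, f a b c = ∑ a, ∑ b, ∑ c, f c a b := by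
  rw [Finset.sum_comm]
  exact Finset.sum_congr rfl fun a _ => Finset.sum_comm

theorem sum_pairs_comm {ι V : Type*} [Fintype ι] [AddCommMonoid V] (f : ι → ι → ι → ι → V) :
    ∑ a, ∑ b, ∑ c, ∑ d, f a b c d = ∑ c, ∑ d, ∑ a, ∑ b, f a b c d := by
  rw [← sum_sum_sum_rotate fun c a b => ∑ d, f a b c d]
  exact Finset.sum_congr rfl fun c _ => (sum_sum_sum_rotate fun d a b => f a b c d).symm

/-! ### The Lie algebroid axioms in a frame and `d_E² = 0`. -/

section Frame

variable {O : Type*} [Ring O] [Algebra ℝ O] {r s : ℕ}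

/-- The structure functions of the brackets of basis sections and the derivations by which the basis
sections act on functions satisfy the axioms of a Lie algebroid. -/
structure IsLocalLieAlgebroid (grO : ZMod 2 → Submodule ℝ O) (a : Fin s ⊕ Fin r → Module.End ℝ O)
    (C : Fin s ⊕ Fin r → Fin s ⊕ Fin r → Fin s ⊕ Fin r → O) : Prop where
  derivation : ∀ α, IsSuperDerivation grO (frameParity α) (a α)
  mem : ∀ α β γ, C α β γ ∈ grO (frameParity α + frameParity β + frameParity γ)
  skew : ∀ α β γ, C α β γ = -(sgn (frameParity α * frameParity β) • C β α γ)
  anchor : ∀ α β f, ∑ γ, C α β γ * a γ f =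
    a α (a β f) - sgn (frameParity α * frameParity β) • a β (a α f)
  jacobi : ∀ α β γ δ,
    a α (C β γ δ) + ∑ ε, sgn ((frameParity β + frameParity γ + frameParity ε) * frameParity α) •
      (C β γ ε * C α ε δ) =
    -(sgn ((frameParity α + frameParity β) * frameParity γ) • (a γ (C α β δ) +
      ∑ ε, sgn ((frameParity α + frameParity β + frameParity ε) * frameParity γ) •
        (C α β ε * C γ ε δ))) +
    sgn (frameParity α * frameParity β) • (a β (C α γ δ) +
      ∑ ε, sgn ((frameParity α + frameParity γ + frameParity ε) * frameParity β) •
        (C α γ ε * C β ε δ))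

end Frame

namespace TotalChart

variable {O F : Type*} [Ring O] [Algebra ℝ O] [Ring F] [Algebra ℝ F]
  {grO : ZMod 2 → Submodule ℝ O} {grF : ZMod 2 → Submodule ℝ F} {π : O →ₐ[ℝ] F} {p q r s : ℕ}
  {Ω : Opens (Fin p → ℝ)} (χ : TotalChart grO grF π q r s Ω)
  {a : Fin s ⊕ Fin r → Module.End ℝ O}
  {C : Fin s ⊕ Fin r → Fin s ⊕ Fin r → Fin s ⊕ Fin r → O}

section Square

variable (hF : IsSuperCommAlgebra grF) (h : IsLocalLieAlgebroid grO a C)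

include hF in
theorem xi_mul_xi (α β : Fin s ⊕ Fin r) :
    χ.xi α * χ.xi β = sgn (coordParity α * coordParity β) • (χ.xi β * χ.xi α) :=
  hF.supercomm (χ.xi_mem α) (χ.xi_mem β)

include hF in
theorem pullback_mul_xi {i : ZMod 2} {f : O} (hf : f ∈ grO i) (α : Fin s ⊕ Fin r) :
    π f * χ.xi α = sgn (i * coordParity α) • (χ.xi α * π f) :=
  hF.supercomm (χ.pullback_mem hf) (χ.xi_mem α)

include h in
theorem isSuperDerivation_lift_deRham :
    IsSuperDerivation grF 1 (χ.lift (deRham (χ.structureFunctions a C))) :=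
  χ.isSuperDerivation_lift (isSuperDerivation_deRham (χ.isHomogeneous h.derivation h.mem))

include hF h

/-- The bracket part of `d_E` yields `∑ C a(s)`, which the anchor identity turns into commutators of
anchors. Contracted with `ξ ξ` and halved, these cancel the second derivatives coming from the
anchor part. -/
theorem deRham_deRham_pullback (f : O) :
    χ.lift (deRham (χ.structureFunctions a C)) (χ.lift (deRham (χ.structureFunctions a C)) (π f)) =
      0 := by
  have hd := χ.isSuperDerivation_lift_deRham h
  have e1 : ∀ α, χ.lift (deRham (χ.structureFunctions a C)) (χ.xi α * π (a α f)) =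
      (1 / 2 : ℝ) • (∑ μ, ∑ ν, sgn (frameParity μ) • (χ.xi μ * χ.xi ν * π (C ν μ α * a α f))) -
      ∑ ν, sgn (frameParity α) • (χ.xi α * χ.xi ν * π (a ν (a α f))) := by
    intro α
    have hs : sgn (1 * coordParity α) = -sgn (frameParity α) := by
      rw [one_mul, frameParity, sgn_add_one, neg_neg]
    rw [hd.leibniz (χ.xi_mem α), deRham_xi, deRham_pullback _ h.derivation, hs, neg_smul,
      ← sub_eq_add_neg]
    simp only [smul_mul_assoc, Finset.sum_mul, mul_assoc, map_mul, Finset.mul_sum, Finset.smul_sum]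
  rw [deRham_pullback _ h.derivation, map_sum, Finset.sum_congr rfl fun α _ => e1 α,
    Finset.sum_sub_distrib, ← Finset.smul_sum, Finset.sum_comm,
    Finset.sum_congr rfl fun μ _ => Finset.sum_comm]
  have e2 : ∀ μ ν, ∑ α, sgn (frameParity μ) • (χ.xi μ * χ.xi ν * π (C ν μ α * a α f)) =
      sgn (frameParity μ) • (χ.xi μ * χ.xi ν * π (a ν (a μ f))) +
        sgn (frameParity ν) • (χ.xi ν * χ.xi μ * π (a μ (a ν f))) := by
    intro μ ν
    rw [← Finset.smul_sum, ← Finset.mul_sum, ← map_sum, h.anchor, map_sub, mul_sub, smul_sub,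
      map_smul, mul_smul_comm, smul_smul, χ.xi_mul_xi hF ν μ, smul_mul_assoc, smul_smul,
      sub_eq_add_neg, ← neg_smul]
    congr 2
    rw [← sgn_add, ← sgn_add, ← sgn_add_one]
    simp only [frameParity]
    congr 1
    generalize coordParity μ = i
    generalize coordParity ν = j
    revert i j; decide
  rw [Finset.sum_congr rfl fun μ _ => Finset.sum_congr rfl fun ν _ => e2 μ ν]
  simp only [Finset.sum_add_distrib]
  rw [Finset.sum_comm (f := fun μ ν => sgn (frameParity ν) • _), ← two_smul ℝ, smul_smul]
  norm_num

/-- `J κ ρ μ` is the coefficient at `s_γ` of `[s_κ, [s_ρ, s_μ]]`, and `G` is its contraction with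
three `ξ`'s. The terms `N`, quadratic in the structure functions, arise halved from either `ξ` and
compensate the difference between `J` and the derivative of `C`. What is left is the sum of `G`,
zero by the Jacobi identity. -/
theorem deRham_deRham_xi (γ : Fin s ⊕ Fin r) :
    χ.lift (deRham (χ.structureFunctions a C)) (χ.lift (deRham (χ.structureFunctions a C)) (χ.xi γ)) =
      0 := by
  have hd := χ.isSuperDerivation_lift_deRham h
  set J : Fin s ⊕ Fin r → Fin s ⊕ Fin r → Fin s ⊕ Fin r → O := fun κ ρ μ =>
    a κ (C ρ μ γ) + ∑ ε, sgn ((frameParity ρ + frameParity μ + frameParity ε) * frameParity κ) •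
      (C ρ μ ε * C κ ε γ) with hJ
  set G : Fin s ⊕ Fin r → Fin s ⊕ Fin r → Fin s ⊕ Fin r → F := fun α β ν =>
    sgn (frameParity β) • (χ.xi α * χ.xi β * χ.xi ν * π (J ν β α)) with hG
  have hZ0 : ∑ α, ∑ β, ∑ ν, G α β ν = 0 := by
    -- The Jacobi identity and reordering of the `ξ`'s express `G` by two of its permutations with
    -- sign `-1`, so the total is `-2` times itself.
    refine eq_zero_of_eq_neg_two_smul ?_
    have e : ∀ α β ν, G α β ν = -G β ν α - G α ν β := by
      intro α β ν
      have h1 : χ.xi β * χ.xi ν * χ.xi α =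
          sgn ((coordParity β + coordParity ν) * coordParity α) • (χ.xi α * χ.xi β * χ.xi ν) := by
        rw [mul_assoc (χ.xi α)]
        exact hF.supercomm (hF.mul_mem (χ.xi_mem β) (χ.xi_mem ν)) (χ.xi_mem α)
      have h2 : χ.xi α * χ.xi ν * χ.xi β =
          sgn (coordParity ν * coordParity β) • (χ.xi α * χ.xi β * χ.xi ν) := by
        rw [mul_assoc, χ.xi_mul_xi hF ν β, mul_smul_comm, mul_assoc]
      have h3 : J ν β α = -(sgn ((frameParity ν + frameParity β) * frameParity α) • J α ν β) +
          sgn (frameParity ν * frameParity β) • J β ν α := h.jacobi ν β α γ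
      simp only [hG]
      rw [h1, h2, h3]
      simp only [map_add, map_smul, mul_add, mul_smul_comm, smul_mul_assoc,
        smul_add, smul_smul, ← sgn_add, sub_eq_add_neg, ← neg_smul, ← sgn_add_one]
      simp only [frameParity]
      congr 3
      · generalize coordParity α = i
        generalize coordParity β = j
        generalize coordParity ν = k
        revert i j k; decide
      · generalize coordParity α = i
        generalize coordParity β = j
        generalize coordParity ν = k
        revert i j k; decide
    conv_lhs => rw [Finset.sum_congr rfl fun α _ => Finset.sum_congr rfl fun β _ =>
      Finset.sum_congr rfl fun ν _ => e α β ν]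
    simp only [Finset.sum_sub_distrib, Finset.sum_neg_distrib]
    rw [sum_sum_sum_rotate fun α β ν => G β ν α,
      Finset.sum_congr rfl fun α _ => Finset.sum_comm (f := fun β ν => G α ν β)]
    module
  set N : Fin s ⊕ Fin r → Fin s ⊕ Fin r → Fin s ⊕ Fin r → Fin s ⊕ Fin r → F := fun μ ν κ ε =>
    sgn (frameParity ν + (frameParity ν + frameParity μ + frameParity ε) * frameParity κ) •
      (χ.xi μ * χ.xi ν * χ.xi κ * π (C ν μ ε * C κ ε γ)) with hN
  -- In `hA` and `hB` the differential falls on the first or the second `ξ`, in `hD` on the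
  -- coefficient `C`. Skew symmetry of `C` brings `hB` to the same form as `hA`.
  have hA : ∀ α β, sgn (frameParity α) •
      (χ.lift (deRham (χ.structureFunctions a C)) (χ.xi α) * (χ.xi β * π (C β α γ))) =
      (1 / 2 : ℝ) • ∑ μ, ∑ ν, N μ ν β α := by
    intro α β
    rw [deRham_xi, smul_mul_assoc, smul_comm, Finset.sum_mul, Finset.smul_sum]
    congr 1
    refine Finset.sum_congr rfl fun μ _ => ?_
    rw [Finset.sum_mul, Finset.smul_sum]
    refine Finset.sum_congr rfl fun ν _ => ?_
    simp only [hN]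
    rw [smul_mul_assoc, mul_assoc (χ.xi μ * χ.xi ν), ← mul_assoc (π _),
      χ.pullback_mul_xi hF (h.mem ν μ α), smul_mul_assoc, mul_smul_comm, smul_smul, smul_smul,
      ← sgn_add, ← sgn_add, map_mul]
    simp only [mul_assoc, frameParity]
    congr 2
    generalize coordParity α = i
    generalize coordParity β = j
    generalize coordParity μ = k
    generalize coordParity ν = l
    revert i j k l; decide
  have hB : ∀ α β, sgn (frameParity α) • sgn (coordParity α) •
      (χ.xi α * (χ.lift (deRham (χ.structureFunctions a C)) (χ.xi β) * π (C β α γ))) =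
      (1 / 2 : ℝ) • ∑ μ, ∑ ν, N μ ν α β := by
    intro α β
    rw [deRham_xi, smul_mul_assoc, mul_smul_comm, smul_smul, smul_comm, Finset.sum_mul,
      Finset.mul_sum, Finset.smul_sum]
    congr 1
    refine Finset.sum_congr rfl fun μ _ => ?_
    rw [Finset.sum_mul, Finset.mul_sum, Finset.smul_sum]
    refine Finset.sum_congr rfl fun ν _ => ?_
    have h1 : χ.xi α * (χ.xi μ * χ.xi ν) =
        sgn (coordParity α * (coordParity μ + coordParity ν)) • (χ.xi μ * χ.xi ν * χ.xi α) :=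
      hF.supercomm (χ.xi_mem α) (hF.mul_mem (χ.xi_mem μ) (χ.xi_mem ν))
    simp only [hN]
    rw [smul_mul_assoc, mul_smul_comm, mul_assoc (χ.xi μ * χ.xi ν), ← mul_assoc (χ.xi α), h1,
      h.skew β α γ, map_neg, map_smul, mul_neg, mul_neg, mul_smul_comm, mul_smul_comm,
      smul_mul_assoc, ← map_mul]
    simp only [smul_smul, ← sgn_add, ← neg_smul, ← sgn_add_one, frameParity]
    congr 2
    generalize coordParity α = i
    generalize coordParity β = j
    generalize coordParity μ = k
    generalize coordParity ν = l
    revert i j k l; decide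
  have hD : ∀ α β, sgn (frameParity α) • sgn (coordParity α) •
      (χ.xi α * sgn (coordParity β) • (χ.xi β *
        χ.lift (deRham (χ.structureFunctions a C)) (π (C β α γ)))) =
      ∑ ν, (G α β ν - ∑ ε, N α β ν ε) := by
    intro α β
    rw [deRham_pullback _ h.derivation, Finset.mul_sum, Finset.smul_sum, Finset.mul_sum,
      Finset.smul_sum, Finset.smul_sum]
    refine Finset.sum_congr rfl fun ν _ => ?_
    simp only [hG, hN, hJ, map_add, map_sum, map_smul, mul_add, Finset.mul_sum, mul_smul_comm,
      smul_add, Finset.smul_sum, smul_smul, sgn_add]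
    rw [add_sub_cancel_right]
    simp only [mul_assoc, ← sgn_add, frameParity]
    congr 2
    generalize coordParity α = i
    generalize coordParity β = j
    revert i j; decide
  have e : ∀ α β, sgn (frameParity α) • χ.lift (deRham (χ.structureFunctions a C))
      (χ.xi α * χ.xi β * π (C β α γ)) =
      (1 / 2 : ℝ) • (∑ μ, ∑ ν, N μ ν β α) + (1 / 2 : ℝ) • (∑ μ, ∑ ν, N μ ν α β) +
        ∑ ν, (G α β ν - ∑ ε, N α β ν ε) := by
    intro α β
    rw [← hA, ← hB, ← hD, mul_assoc, hd.leibniz (χ.xi_mem α), hd.leibniz (χ.xi_mem β), one_mul,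
      one_mul, mul_add, smul_add, smul_add, smul_add, add_assoc]
  rw [deRham_xi, map_smul, map_sum, Finset.sum_congr rfl fun α _ => (map_sum _ _ _).trans
    (Finset.sum_congr rfl fun β _ => (map_smul _ _ _).trans (e α β))]
  simp only [Finset.sum_add_distrib, ← Finset.smul_sum, Finset.sum_sub_distrib]
  rw [hZ0, sum_pairs_comm fun α β μ ν => N μ ν β α, sum_pairs_comm fun α β μ ν => N μ ν α β,
    Finset.sum_congr rfl fun μ _ => Finset.sum_congr rfl fun ν _ =>
      Finset.sum_comm (f := fun α β => N μ ν β α)]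
  module

theorem deRham_mul_deRham :
    deRham (χ.structureFunctions a C) * deRham (χ.structureFunctions a C) = 0 := by
  have hd := (χ.isSuperDerivation_lift_deRham h).sq
  have h0 := χ.derivation_ext hd IsSuperDerivation.zero (fun f => χ.deRham_deRham_pullback hF h f)
    fun α => χ.deRham_deRham_xi hF h α
  ext x
  have := LinearMap.congr_fun h0 (χ.total.symm x)
  simpa [lift_apply] using this

end Square

end TotalChart

/-! ### Independence of the trivialisation. -/

theorem jet_fromBase_mul {p q r s : ℕ} {Ω : Opens (Fin p → ℝ)} {i : ZMod 2}
    {f : SuperFun Ω (Fin q)} (hf : f ∈ baseGr q Ω i) (k : ℕ) (X : TotalFun q r s Ω) :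
    jet k (fromBase f * X) = mulBase f * jet k X := by
  rw [← coeff_jetSeries, jetSeries_mul (fromBase_mem hf), jetSeries_fromBase,
    PowerSeries.coeff_C_mul, coeff_jetSeries]

namespace TotalChart

variable {O F : Type*} [Ring O] [Algebra ℝ O] [Ring F] [Algebra ℝ F]
  {grO : ZMod 2 → Submodule ℝ O} {grF : ZMod 2 → Submodule ℝ F} {π : O →ₐ[ℝ] F} {p q r s : ℕ}
  {Ω Ω' : Opens (Fin p → ℝ)} (χ : TotalChart grO grF π q r s Ω)
  (χ' : TotalChart grO grF π q r s Ω')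
  {a a' : Fin s ⊕ Fin r → Module.End ℝ O}
  {C C' : Fin s ⊕ Fin r → Fin s ⊕ Fin r → Fin s ⊕ Fin r → O}

/-- The derivative along a fibre coordinate. -/
def fib (α : Fin s ⊕ Fin r) : Module.End ℝ F := χ.lift (fibreD α)

theorem isSuperDerivation_fib (α : Fin s ⊕ Fin r) :
    IsSuperDerivation grF (coordParity α) (χ.fib α) :=
  χ.isSuperDerivation_lift (isSuperDerivation_fibreD α)

theorem fib_pullback (α : Fin s ⊕ Fin r) (f : O) : χ.fib α (π f) = 0 := by
  rw [fib, lift_apply, total_pullback, fibreD_fromBase, map_zero]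

open scoped Classical in
theorem fib_xi (α β : Fin s ⊕ Fin r) : χ.fib α (χ.xi β) = if α = β then 1 else 0 := by
  rw [fib, lift_apply, total_xi, fibreD_fibreCoord]
  split_ifs <;> simp

/-- The restriction to the zero section. -/
def zeroSection : F →ₐ[ℝ] O :=
  χ.base.symm.toAlgHom.comp (toZeroSection.comp χ.total.toAlgHom)

theorem base_zeroSection (x : F) : χ.base (χ.zeroSection x) = toZeroSection (χ.total x) := by
  simp [zeroSection]

theorem zeroSection_pullback (f : O) : χ.zeroSection (π f) = f := by
  apply χ.base.injective
  rw [base_zeroSection, total_pullback, toZeroSection_fromBase]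

theorem zeroSection_xi (α : Fin s ⊕ Fin r) : χ.zeroSection (χ.xi α) = 0 := by
  apply χ.base.injective
  rw [base_zeroSection, total_xi, toZeroSection_fibreCoord, map_zero]

theorem eq_zeroSection {φ : F →ₐ[ℝ] O} (hb : ∀ f, φ (π f) = f) (hf : ∀ α, φ (χ.xi α) = 0) :
    φ = χ.zeroSection := by
  have h : (χ.base.toAlgHom.comp φ).comp χ.total.symm.toAlgHom = toZeroSection := by
    refine eq_toZeroSection (fun f => ?_) fun α => ?_
    · have : χ.total.symm (fromBase f) = π (χ.base.symm f) := by
        rw [AlgEquiv.symm_apply_eq, total_pullback, AlgEquiv.apply_symm_apply]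
      simp [this, hb]
    · have := hf α
      rw [xi] at this
      simp [this]
  ext x
  apply χ.base.injective
  have := AlgHom.congr_fun h (χ.total x)
  rw [base_zeroSection, ← this]
  simp

section Transition

variable {T : Fin s ⊕ Fin r → Fin s ⊕ Fin r → O}

/-- The differential does not depend on the trivialisation. -/
theorem lift_deRham_eq (hF : IsSuperCommAlgebra grF) (h : IsLocalLieAlgebroid grO a C)
    (h' : IsLocalLieAlgebroid grO a' C')
    (hT : ∀ β α, T β α ∈ grO (frameParity β + frameParity α))
    (hxi : ∀ α, χ'.xi α = ∑ β, χ.xi β * π (T β α))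
    (ha : ∀ β f, a β f = ∑ α, T β α * a' α f)
    (hC : ∀ ν μ γ, ∑ δ, C ν μ δ * T δ γ =
      a ν (T μ γ) - sgn (frameParity ν * frameParity μ) • a μ (T ν γ) -
        ∑ β, ∑ α, sgn (frameParity ν * frameParity μ +
          (frameParity ν + frameParity α) * frameParity β) • (T μ β * T ν α * C' β α γ)) :
    χ.lift (deRham (χ.structureFunctions a C)) = χ'.lift (deRham (χ'.structureFunctions a' C')) := by
  have hd := χ.isSuperDerivation_lift_deRham h
  refine χ'.derivation_ext hd (χ'.isSuperDerivation_lift_deRham h') (fun f => ?_) fun γ => ?_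
  · rw [deRham_pullback _ h.derivation, deRham_pullback _ h'.derivation]
    simp only [ha, hxi, map_sum, map_mul, Finset.mul_sum, Finset.sum_mul, mul_assoc]
    rw [Finset.sum_comm]
  -- `U` is the inhomogeneous part of the transformation law `hC` and `V` the tensorial part. The
  -- contributions of `U` to the bracket terms cancel the derivatives of `T` in `d_E (ξ T)`, leaving
  -- `V`, which is the differential in the other frame.
  · set U : Fin s ⊕ Fin r → Fin s ⊕ Fin r → F := fun μ ν =>
      sgn (frameParity μ) • (χ.xi μ * χ.xi ν * π (a ν (T μ γ))) with hU
    set V : Fin s ⊕ Fin r → Fin s ⊕ Fin r → Fin s ⊕ Fin r → Fin s ⊕ Fin r → F := fun μ ν β α =>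
      sgn (frameParity α) • (χ.xi ν * π (T ν α) * (χ.xi μ * π (T μ β)) * π (C' β α γ)) with hV
    have e1 : ∀ μ ν, sgn (frameParity μ) • (χ.xi μ * χ.xi ν * π (∑ δ, C ν μ δ * T δ γ)) =
        U μ ν + U ν μ + ∑ β, ∑ α, V μ ν β α := by
      intro μ ν
      rw [hC, map_sub, map_sub, mul_sub, mul_sub, smul_sub, smul_sub, sub_eq_add_neg,
        sub_eq_add_neg]
      congr 2
      · simp only [hU]
        rw [map_smul, mul_smul_comm, smul_smul, χ.xi_mul_xi hF ν μ, smul_mul_assoc, smul_smul,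
          ← neg_smul, ← sgn_add, ← sgn_add, ← sgn_add_one]
        simp only [frameParity]
        congr 2
        generalize coordParity μ = i
        generalize coordParity ν = j
        revert i j; decide
      · simp only [map_sum, Finset.mul_sum, Finset.smul_sum, ← Finset.sum_neg_distrib]
        refine Finset.sum_congr rfl fun β _ => Finset.sum_congr rfl fun α _ => ?_
        have h1 : χ.xi ν * π (T ν α) * (χ.xi μ * π (T μ β)) =
            sgn ((frameParity ν + frameParity α) * coordParity μ + coordParity ν * coordParity μ +
              (frameParity ν + frameParity α) * (frameParity μ + frameParity β)) •
              (χ.xi μ * χ.xi ν * (π (T μ β) * π (T ν α))) := by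
          rw [mul_assoc (χ.xi ν), ← mul_assoc (π _), χ.pullback_mul_xi hF (hT ν α), smul_mul_assoc,
            mul_smul_comm, mul_assoc (χ.xi μ), ← mul_assoc (χ.xi ν), χ.xi_mul_xi hF ν μ,
            hF.supercomm (χ.pullback_mem (hT ν α)) (χ.pullback_mem (hT μ β)), smul_mul_assoc,
            mul_smul_comm, smul_smul, smul_smul, sgn_add, sgn_add]
        simp only [hV]
        rw [h1, map_smul, mul_smul_comm, smul_smul, smul_mul_assoc, smul_smul, map_mul, map_mul,
          ← mul_assoc (χ.xi μ * χ.xi ν), ← neg_smul, ← sgn_add, ← sgn_add, ← sgn_add_one]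
        simp only [frameParity]
        congr 2
        generalize coordParity μ = i
        generalize coordParity ν = j
        generalize coordParity α = k
        generalize coordParity β = l
        revert i j k l; decide
    have e2 : ∀ μ, χ.lift (deRham (χ.structureFunctions a C)) (χ.xi μ * π (T μ γ)) =
        (1 / 2 : ℝ) • (∑ κ, ∑ ν, sgn (frameParity κ) • (χ.xi κ * χ.xi ν * π (C ν κ μ * T μ γ))) -
          ∑ ν, U μ ν := by
      intro μ
      have hs : sgn (1 * coordParity μ) = -sgn (frameParity μ) := by
        rw [one_mul, frameParity, sgn_add_one, neg_neg]
      rw [hd.leibniz (χ.xi_mem μ), deRham_xi, deRham_pullback _ h.derivation, hs, neg_smul,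
        ← sub_eq_add_neg]
      simp only [hU, smul_mul_assoc, Finset.sum_mul, mul_assoc, map_mul, Finset.mul_sum,
        Finset.smul_sum]
    have e3 : χ'.lift (deRham (χ'.structureFunctions a' C')) (χ'.xi γ) =
        (1 / 2 : ℝ) • ∑ μ, ∑ ν, ∑ β, ∑ α, V μ ν β α := by
      rw [deRham_xi, sum_pairs_comm fun μ ν β α => V μ ν β α, Finset.sum_comm]
      congr 1
      refine Finset.sum_congr rfl fun β _ => Finset.sum_congr rfl fun α _ => ?_
      rw [hxi, hxi, Finset.sum_comm]
      simp only [hV, Finset.sum_mul, Finset.mul_sum, Finset.smul_sum]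
      exact Finset.sum_comm
    rw [e3, hxi, map_sum, Finset.sum_congr rfl fun μ _ => e2 μ, Finset.sum_sub_distrib,
      ← Finset.smul_sum, Finset.sum_comm, Finset.sum_congr rfl fun κ _ => Finset.sum_comm]
    rw [Finset.sum_congr rfl fun μ _ => Finset.sum_congr rfl fun ν _ =>
      show _ = U μ ν + U ν μ + ∑ β, ∑ α, V μ ν β α by
        rw [← e1, map_sum, Finset.mul_sum, Finset.smul_sum]]
    simp only [Finset.sum_add_distrib]
    rw [Finset.sum_comm (f := fun μ ν => U ν μ)]
    module

theorem fib_eq_sum (hF : IsSuperCommAlgebra grF)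
    (hT : ∀ β α, T β α ∈ grO (frameParity β + frameParity α))
    (hxi : ∀ α, χ'.xi α = ∑ β, χ.xi β * π (T β α)) (β : Fin s ⊕ Fin r) :
    χ.fib β = ∑ α, LinearMap.mulLeft ℝ (π (T β α)) * χ'.fib α := by
  classical
  refine χ'.derivation_ext (χ.isSuperDerivation_fib β) (IsSuperDerivation.sum _ fun α _ => ?_)
    (fun f => ?_) fun γ => ?_
  · have := (χ'.isSuperDerivation_fib α).mulLeft_mul hF (χ.pullback_mem (hT β α))
    have e : ∀ i j : ZMod 2, i + 1 + (j + 1) + j = i := by decide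
    rwa [frameParity, frameParity, e] at this
  · simp [fib_pullback, -Fintype.sum_sum_type]
  · rw [hxi, map_sum]
    simp only [(χ.isSuperDerivation_fib β).leibniz (χ.xi_mem _), fib_pullback, fib_xi]
    rw [← hxi]
    simp [fib_xi, -Fintype.sum_sum_type]

/-- The chain rule on `ΠE*`, whose fibre coordinates transform oppositely to those of `ΠE`. The same
`T` therefore occurs here and in `fib_eq_sum`, which makes the pairing of `∂/∂ξ^α` with `∂/∂η_α` in
`jet` invariant. -/
theorem fib_eq_sum' (hF : IsSuperCommAlgebra grF)
    (hT : ∀ β α, T β α ∈ grO (frameParity β + frameParity α))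
    (heta : ∀ β, χ.xi β = ∑ α, π (T β α) * χ'.xi α) (α : Fin s ⊕ Fin r) :
    χ'.fib α = ∑ β, sgn (coordParity α * (frameParity β + frameParity α)) •
      (LinearMap.mulLeft ℝ (π (T β α)) * χ.fib β) := by
  classical
  refine χ.derivation_ext (χ'.isSuperDerivation_fib α)
    (IsSuperDerivation.sum _ fun β _ => IsSuperDerivation.smul _ ?_) (fun f => ?_) fun γ => ?_
  · have := (χ.isSuperDerivation_fib β).mulLeft_mul hF (χ.pullback_mem (hT β α))
    have e : ∀ i j : ZMod 2, i + 1 + (j + 1) + i = j := by decide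
    rwa [frameParity, frameParity, e] at this
  · simp [fib_pullback, -Fintype.sum_sum_type]
  · rw [heta, map_sum]
    simp only [(χ'.isSuperDerivation_fib α).leibniz (χ.pullback_mem (hT γ _)), fib_pullback, fib_xi]
    rw [← heta]
    simp [fib_xi, -Fintype.sum_sum_type]

theorem zeroSection_eq (heta : ∀ β, χ.xi β = ∑ α, π (T β α) * χ'.xi α) :
    χ'.zeroSection = χ.zeroSection := by
  refine χ.eq_zeroSection χ'.zeroSection_pullback fun β => ?_
  rw [heta, map_sum]
  simp [zeroSection_xi, -Fintype.sum_sum_type]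

end Transition

section Jet

variable {G : Type*} [Ring G] [Algebra ℝ G] {grG : ZMod 2 → Submodule ℝ G} {πG : O →ₐ[ℝ] G}
  (ψ : TotalChart grO grG πG q r s Ω) (ψ' : TotalChart grO grG πG q r s Ω')

theorem lift_jet_zero (hb : χ.base = ψ.base) (X : G) :
    χ.lift (jet 0 (ψ.total X)) = LinearMap.mulLeft ℝ (π (ψ.zeroSection X)) := by
  ext x
  apply χ.total.injective
  rw [total_lift, jet_zero, mulBase, LinearMap.mulLeft_apply, LinearMap.mulLeft_apply, map_mul,
    total_pullback, hb, base_zeroSection]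

theorem lift_jet_succ (k : ℕ) (X : G) :
    χ.lift (jet (k + 1) (ψ.total X)) =
      (1 / ((k : ℝ) + 1)) • ∑ α, χ.fib α * χ.lift (jet k (ψ.total (ψ.fib α X))) := by
  rw [jet_succ, lift, map_smul, map_sum]
  congr 1
  refine Finset.sum_congr rfl fun α _ => ?_
  rw [fib, fib, ← lift_mul, total_lift]
  rfl

theorem lift_jet_pullback_mul (hb : χ.base = ψ.base) {i : ZMod 2} {f : O} (hf : f ∈ grO i) (k : ℕ)
    (X : G) : χ.lift (jet k (ψ.total (πG f * X))) =
      LinearMap.mulLeft ℝ (π f) * χ.lift (jet k (ψ.total X)) := by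
  rw [map_mul, total_pullback, jet_fromBase_mul ((ψ.base_mem i f).2 hf), lift_mul]
  congr 1
  ext x
  apply χ.total.injective
  rw [total_lift, mulBase, LinearMap.mulLeft_apply, LinearMap.mulLeft_apply, map_mul,
    total_pullback, hb]

/-- The interior product does not depend on the trivialisation. -/
theorem lift_jet_eq {T : Fin s ⊕ Fin r → Fin s ⊕ Fin r → O} (hF : IsSuperCommAlgebra grF)
    (hG : IsSuperCommAlgebra grG) (hb : χ.base = ψ.base) (hb' : χ'.base = ψ'.base)
    (hT : ∀ β α, T β α ∈ grO (frameParity β + frameParity α))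
    (hxi : ∀ α, χ'.xi α = ∑ β, χ.xi β * π (T β α))
    (heta : ∀ β, ψ.xi β = ∑ α, πG (T β α) * ψ'.xi α) :
    ∀ (k : ℕ) (X : G), χ.lift (jet k (ψ.total X)) = χ'.lift (jet k (ψ'.total X))
  | 0, X => by rw [lift_jet_zero _ _ hb, lift_jet_zero _ _ hb', ψ.zeroSection_eq ψ' heta]
  | k + 1, X => by
    rw [lift_jet_succ, lift_jet_succ]
    congr 1
    -- The chain rule on `ΠE*` produces `T`, which is pulled out of the lower jet and moved left
    -- past `∂/∂ξ`. The sign of that move cancels the sign of the chain rule, and the chain rule on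
    -- `ΠE` then reassembles the sum.
    have e : ∀ α, χ'.fib α * χ'.lift (jet k (ψ'.total (ψ'.fib α X))) =
        ∑ β, LinearMap.mulLeft ℝ (π (T β α)) * χ'.fib α *
          χ.lift (jet k (ψ.total (ψ.fib β X))) := by
      intro α
      rw [← lift_jet_eq hF hG hb hb' hT hxi heta k, ψ.fib_eq_sum' ψ' hG hT heta α,
        LinearMap.sum_apply, map_sum, map_sum, lift, map_sum, Finset.mul_sum]
      refine Finset.sum_congr rfl fun β _ => ?_
      have h1 : χ'.fib α * LinearMap.mulLeft ℝ (π (T β α)) =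
          sgn (coordParity α * (frameParity β + frameParity α)) •
            (LinearMap.mulLeft ℝ (π (T β α)) * χ'.fib α) := by
        ext x
        simp [(χ'.isSuperDerivation_fib α).leibniz (χ'.pullback_mem (hT β α)), fib_pullback]
      have h2 := χ.lift_jet_pullback_mul ψ hb (hT β α) k (ψ.fib β X)
      rw [lift] at h2
      rw [LinearMap.smul_apply, map_smul, map_smul, map_smul, Module.End.mul_apply,
        LinearMap.mulLeft_apply, h2, mul_smul_comm, ← mul_assoc, h1, smul_mul_assoc, smul_smul,
        sgn_mul_self, one_smul]
    rw [Finset.sum_congr rfl fun α _ => e α, Finset.sum_comm]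
    refine Finset.sum_congr rfl fun β _ => ?_
    rw [χ.fib_eq_sum χ' hF hT hxi β, Finset.sum_mul]

end Jet

end TotalChart

theorem TotalChart.lift_commutator {O F : Type*} [Ring O] [Algebra ℝ O] [Ring F] [Algebra ℝ F]
    {grO : ZMod 2 → Submodule ℝ O} {grF : ZMod 2 → Submodule ℝ F} {π : O →ₐ[ℝ] F} {p q r s : ℕ}
    {Ω : Opens (Fin p → ℝ)} (χ : TotalChart grO grF π q r s Ω)
    (D D' : Module.End ℝ (TotalFun q r s Ω)) :
    χ.lift (D * D' - D' * D) = χ.lift D * χ.lift D' - χ.lift D' * χ.lift D := by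
  rw [← lift_mul, ← lift_mul]
  exact map_sub _ _ _

/-! ### Homogeneous components and coefficients in a frame. -/

section Parity

variable {V : Type*} [AddCommGroup V] [Module ℝ V] {gr : ZMod 2 → Submodule ℝ V}

theorem exists_parity_decomposition (h : IsCompl (gr 0) (gr 1)) (i : ZMod 2) (x : V) :
    ∃ y ∈ gr i, ∃ z ∈ gr (i + 1), y + z = x := by
  have hx : x ∈ gr 0 ⊔ gr 1 := by rw [h.sup_eq_top]; trivial
  obtain ⟨y, hy, z, hz, rfl⟩ := Submodule.mem_sup.1 hx
  rcases eq_zero_or_one i with rfl | rfl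
  · exact ⟨y, hy, z, by simpa using hz, rfl⟩
  · exact ⟨z, hz, y, by rwa [CharTwo.add_self_eq_zero], add_comm _ _⟩

theorem eq_zero_of_mem_of_mem (h : IsCompl (gr 0) (gr 1)) {i : ZMod 2} {x : V} (hx : x ∈ gr i)
    (hx' : x ∈ gr (i + 1)) : x = 0 := by
  rcases eq_zero_or_one i with rfl | rfl
  · exact Submodule.disjoint_def.1 h.disjoint x hx (by simpa using hx')
  · exact Submodule.disjoint_def.1 h.disjoint x (by rwa [CharTwo.add_self_eq_zero] at hx') hx

end Parity

section Modules

variable {X : Type u} [TopologicalSpace X] {O : SuperSheaf.{u, v} X} (S : SuperModuleSheaf O)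
  {r s : ℕ} {W : Opens X} (b : Module.Basis (Fin s ⊕ Fin r) (O.sec W) (S.sec W))

/-- The coefficients of homogeneous sections are homogeneous. -/
theorem repr_mem (hb : ∀ α, b α ∈ S.gr W (frameParity α)) {i : ZMod 2} {w : S.sec W}
    (hw : w ∈ S.gr W i) (γ : Fin s ⊕ Fin r) : b.repr w γ ∈ O.gr W (i + frameParity γ) := by
  -- `z` is the part of each coefficient with the wrong parity. Its contribution to `w` has parities
  -- `i + 1` and `i` at once, hence is zero, and the basis property gives `z = 0`.
  choose y hy z hz hyz using fun γ =>
    exists_parity_decomposition (O.isSuperCommAlgebra W).isCompl (i + frameParity γ) (b.repr w γ)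
  have h1 : ∑ γ, y γ • b γ ∈ S.gr W i := Submodule.sum_mem _ fun γ _ => by
    have := S.smul_mem (hy γ) (hb γ)
    rwa [add_assoc, CharTwo.add_self_eq_zero, add_zero] at this
  have h2 : ∑ γ, z γ • b γ ∈ S.gr W (i + 1) := Submodule.sum_mem _ fun γ _ => by
    have := S.smul_mem (hz γ) (hb γ)
    rwa [add_right_comm, add_assoc i, CharTwo.add_self_eq_zero, add_zero] at this
  have h3 : ∑ γ, y γ • b γ + ∑ γ, z γ • b γ = w := by
    rw [← Finset.sum_add_distrib]
    simp only [← add_smul, hyz]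
    exact b.sum_repr w
  have h4 : ∑ γ, z γ • b γ = 0 := by
    refine eq_zero_of_mem_of_mem (S.isCompl W) ?_ h2
    rw [← eq_sub_iff_add_eq'] at h3
    rw [h3]
    exact sub_mem hw h1
  have h5 : z γ = 0 := by
    have := congrArg (fun w => b.repr w γ) h4
    simpa only [Module.Basis.repr_sum_self, map_zero, Finsupp.coe_zero, Pi.zero_apply] using this
  rw [← hyz, h5, add_zero]
  exact hy γ

end Modules

/-! ### Structure functions of a Lie algebroid in a frame. -/

namespace LieAlgebroid

variable {X : Type u} [TopologicalSpace X] {p q r s : ℕ} {M : Supermanifold.{u, v} X p q}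
  {E : SuperVectorBundle M r s} (L : LieAlgebroid E) {W : Opens X}
  (b b' : Module.Basis (Fin s ⊕ Fin r) (M.functions.sec W) (E.sections.sec W))

/-- The action of the basis sections on functions. -/
def frameAnchor (α : Fin s ⊕ Fin r) : Module.End ℝ (M.functions.sec W) := L.anchor W (b α)

/-- The coefficients of the brackets of the basis sections. -/
def frameBracket (α β γ : Fin s ⊕ Fin r) : M.functions.sec W :=
  b.repr (L.bracket W (b α) (b β)) γ

theorem isSuperDerivation_anchor {i : ZMod 2} {w : E.sections.sec W} (hw : w ∈ E.sections.gr W i) :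
    IsSuperDerivation (M.functions.gr W) i (L.anchor W w) where
  mem hf := by rw [add_comm]; exact L.anchor_mem hw hf
  leibniz hf g := L.anchor_mul g hw hf

theorem anchor_eq_sum (w : E.sections.sec W) (f : M.functions.sec W) :
    L.anchor W w f = ∑ γ, b.repr w γ * L.anchor W (b γ) f := by
  conv_lhs => rw [← b.sum_repr w]
  rw [map_sum, LinearMap.sum_apply]
  exact Finset.sum_congr rfl fun γ _ => L.anchor_smul _ _ _

theorem smul_real_repr (t : ℝ) (w : E.sections.sec W) (γ : Fin s ⊕ Fin r) :
    b.repr (t • w) γ = t • b.repr w γ := by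
  rw [← algebraMap_smul (M.functions.sec W) t w, map_smul, Finsupp.smul_apply, smul_eq_mul,
    ← Algebra.smul_def]

/-- The coefficients of a bracket `[w, w']` in terms of those of `w'`. -/
theorem repr_bracket (hb : ∀ α, b α ∈ E.sections.gr W (frameParity α)) {i j : ZMod 2}
    {w w' : E.sections.sec W} (hw : w ∈ E.sections.gr W i) (hw' : w' ∈ E.sections.gr W j)
    (γ : Fin s ⊕ Fin r) :
    b.repr (L.bracket W w w') γ = L.anchor W w (b.repr w' γ) +
      ∑ ε, sgn ((j + frameParity ε) * i) • (b.repr w' ε * b.repr (L.bracket W w (b ε)) γ) := by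
  classical
  conv_lhs => rw [← b.sum_repr w']
  rw [map_sum, Finset.sum_congr rfl fun ε _ => L.leibniz hw (repr_mem E.sections b hb hw' ε),
    Finset.sum_add_distrib, map_add, Finsupp.add_apply, Module.Basis.repr_sum_self, map_sum,
    Finsupp.finsetSum_apply]
  congr 1
  refine Finset.sum_congr rfl fun ε _ => ?_
  rw [smul_real_repr, map_smul, Finsupp.smul_apply, smul_eq_mul]

theorem isLocalLieAlgebroid (hb : ∀ α, b α ∈ E.sections.gr W (frameParity α)) :
    IsLocalLieAlgebroid (M.functions.gr W) (L.frameAnchor b) (L.frameBracket b) where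
  derivation α := L.isSuperDerivation_anchor (hb α)
  mem α β γ := repr_mem E.sections b hb (L.bracket_mem (hb α) (hb β)) γ
  skew α β γ := by
    rw [frameBracket, L.skew (hb α) (hb β), map_neg, Finsupp.neg_apply, smul_real_repr]
    rfl
  anchor α β f := by
    refine (L.anchor_eq_sum b _ f).symm.trans (L.anchor_bracket f (hb α) (hb β))
  jacobi α β γ δ := by
    -- Skew symmetry brings all three double brackets of the Jacobi identity into the form `[s, [s,
    -- s]]`, whose coefficients are computed here.
    have key : ∀ α β γ, b.repr (L.bracket W (b α) (L.bracket W (b β) (b γ))) δ =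
        L.frameAnchor b α (L.frameBracket b β γ δ) +
          ∑ ε, sgn ((frameParity β + frameParity γ + frameParity ε) * frameParity α) •
            (L.frameBracket b β γ ε * L.frameBracket b α ε δ) := fun α β γ =>
      L.repr_bracket b hb (hb α) (L.bracket_mem (hb β) (hb γ)) δ
    rw [← key, ← key, ← key, L.jacobi (hb α) (hb β) (hb γ), L.skew (L.bracket_mem (hb α) (hb β)) (hb γ),
      map_add, Finsupp.add_apply, map_neg, Finsupp.neg_apply, smul_real_repr, smul_real_repr]

/-- The bracket is expanded in the second frame, one argument at a time, with skew symmetry in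
between. The Leibniz rule produces one derivative term for each argument, and these recombine to the
anchors of the first frame. -/
theorem frameBracket_transition (hb : ∀ α, b α ∈ E.sections.gr W (frameParity α))
    (hb' : ∀ α, b' α ∈ E.sections.gr W (frameParity α)) (ν μ γ : Fin s ⊕ Fin r) :
    ∑ δ, L.frameBracket b ν μ δ * b'.repr (b δ) γ =
      L.frameAnchor b ν (b'.repr (b μ) γ) -
        sgn (frameParity ν * frameParity μ) • L.frameAnchor b μ (b'.repr (b ν) γ) -
        ∑ β, ∑ α, sgn (frameParity ν * frameParity μ +
          (frameParity ν + frameParity α) * frameParity β) •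
            (b'.repr (b μ) β * b'.repr (b ν) α * L.frameBracket b' β α γ) := by
  have h1 : ∑ δ, L.frameBracket b ν μ δ * b'.repr (b δ) γ =
      b'.repr (L.bracket W (b ν) (b μ)) γ := by
    conv_rhs => rw [← b.sum_repr (L.bracket W (b ν) (b μ)), map_sum, Finsupp.finsetSum_apply]
    refine Finset.sum_congr rfl fun δ _ => ?_
    rw [map_smul, Finsupp.smul_apply, smul_eq_mul]
    rfl
  have h2 : ∀ β, sgn ((frameParity μ + frameParity β) * frameParity ν) •
      (b'.repr (b μ) β * b'.repr (L.bracket W (b ν) (b' β)) γ) =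
      -(sgn (frameParity ν * frameParity μ) •
        (b'.repr (b μ) β * L.anchor W (b' β) (b'.repr (b ν) γ))) -
      ∑ α, sgn (frameParity ν * frameParity μ +
          (frameParity ν + frameParity α) * frameParity β) •
            (b'.repr (b μ) β * b'.repr (b ν) α * L.frameBracket b' β α γ) := by
    intro β
    rw [L.skew (hb ν) (hb' β), map_neg, Finsupp.neg_apply, smul_real_repr,
      L.repr_bracket b' hb' (hb' β) (hb ν), mul_neg, mul_smul_comm, smul_neg, smul_smul, ← sgn_add,
      mul_add, smul_add, neg_add, ← sub_eq_add_neg,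
      show (frameParity μ + frameParity β) * frameParity ν + frameParity ν * frameParity β =
        frameParity ν * frameParity μ by
        rw [add_mul, mul_comm (frameParity β), add_assoc, CharTwo.add_self_eq_zero, add_zero,
          mul_comm], Finset.mul_sum, Finset.smul_sum]
    congr 1
    refine Finset.sum_congr rfl fun α _ => ?_
    rw [mul_smul_comm, smul_smul, ← sgn_add, mul_assoc]
    rfl
  rw [h1, L.repr_bracket b' hb' (hb ν) (hb μ), Finset.sum_congr rfl fun β _ => h2 β,
    Finset.sum_sub_distrib, Finset.sum_neg_distrib, ← Finset.smul_sum, ← L.anchor_eq_sum b',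
    ← add_sub_assoc, ← sub_eq_add_neg]
  rfl

end LieAlgebroid

/-! ### Lie derivatives over a trivialising open set. -/

namespace BundleChart

variable {X : Type u} [TopologicalSpace X] {p q r s : ℕ} {M : Supermanifold.{u, v} X p q}
  {sections : SuperModuleSheaf M.functions} {forms multivectors : SuperSheaf.{u, v} X}
  {pF : ∀ U : Opens X, M.functions.sec U →ₐ[ℝ] forms.sec U}
  {pM : ∀ U : Opens X, M.functions.sec U →ₐ[ℝ] multivectors.sec U}
  (c : BundleChart M r s sections forms multivectors pF pM) {W : Opens X} (hW : W ≤ c.source)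

/-- The local trivialisation of `ΠE` over an open subset. -/
def formsChart : TotalChart (M.functions.gr W) (forms.gr W) (pF W) q r s
    (chartImage c.base.body W) where
  base := c.base.model.iso W hW
  total := c.formsModel.iso W hW
  base_mem := c.base.model.iso_mem hW
  total_mem := c.formsModel.iso_mem hW
  total_pullback := c.formsModel_base hW

/-- The local trivialisation of `ΠE*` over an open subset. -/
def multivectorsChart : TotalChart (M.functions.gr W) (multivectors.gr W) (pM W) q r s
    (chartImage c.base.body W) where
  base := c.base.model.iso W hW
  total := c.multivectorsModel.iso W hW
  base_mem := c.base.model.iso_mem hW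
  total_mem := c.multivectorsModel.iso_mem hW
  total_pullback := c.multivectorsModel_base hW

end BundleChart

/-- The type of local trivialisations of a vector bundle. -/
abbrev SuperVectorBundle.Chart {X : Type u} [TopologicalSpace X] {p q r s : ℕ}
    {M : Supermanifold.{u, v} X p q} (E : SuperVectorBundle M r s) : Type _ :=
  BundleChart M r s E.sections E.forms E.multivectors E.formsPullback E.multivectorsPullback

namespace LieAlgebroid

variable {X : Type u} [TopologicalSpace X] {p q r s : ℕ} {M : Supermanifold.{u, v} X p q}
  {E : SuperVectorBundle M r s} (L : LieAlgebroid E) (c c' : E.Chart) {W : Opens X}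
  (hW : W ≤ c.source) (hW' : W ≤ c'.source)

/-- The structure functions over an open subset of a local trivialisation. -/
def structureFunctionsOn : StructureFunctions q r s (chartImage c.base.body W) :=
  (c.formsChart hW).structureFunctions (L.frameAnchor (c.frame W hW))
    (L.frameBracket (c.frame W hW))

theorem isHomogeneous_structureFunctionsOn : (L.structureFunctionsOn c hW).IsHomogeneous :=
  have h := L.isLocalLieAlgebroid (c.frame W hW) (c.frame_mem hW)
  (c.formsChart hW).isHomogeneous h.derivation h.mem

theorem deRham_mul_deRham :
    deRham (L.structureFunctionsOn c hW) * deRham (L.structureFunctionsOn c hW) = 0 :=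
  (c.formsChart hW).deRham_mul_deRham (E.forms.isSuperCommAlgebra W)
    (L.isLocalLieAlgebroid (c.frame W hW) (c.frame_mem hW))

/-- The `k`-th term of the Lie derivative over an open subset of a local trivialisation. -/
def lieDerivativeOn (P : E.multivectors.sec W) (k : ℕ) : Module.End ℝ (E.forms.sec W) :=
  (c.formsChart hW).lift
    (lieDerivative (L.structureFunctionsOn c hW) (c.multivectorsModel.iso W hW P) k)

theorem lieDerivativeOn_eq {P : E.multivectors.sec W} (hP : P ∈ E.multivectors.gr W 0) (k : ℕ)
    (hc : c ∈ E.atlas) (hc' : c' ∈ E.atlas) :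
    L.lieDerivativeOn c hW P k = L.lieDerivativeOn c' hW' P k := by
  obtain ⟨T, hT, hxi, heta⟩ := E.compatible c hc c' hc' W hW hW'
  -- The transition matrix consists of the coefficients of one frame in the other; its homogeneity
  -- follows from this and is not an extra assumption.
  have hT' : ∀ β α, T β α = (c'.frame W hW').repr (c.frame W hW β) α := fun β α => by
    rw [hT β, Module.Basis.repr_sum_self]
  have hTm : ∀ β α, T β α ∈ M.functions.gr W (frameParity β + frameParity α) := fun β α => by
    rw [hT']
    exact repr_mem E.sections _ (c'.frame_mem hW') (c.frame_mem hW β) α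
  have hd : (c.formsChart hW).lift (deRham (L.structureFunctionsOn c hW)) =
      (c'.formsChart hW').lift (deRham (L.structureFunctionsOn c' hW')) := by
    refine (c.formsChart hW).lift_deRham_eq (c'.formsChart hW') (E.forms.isSuperCommAlgebra W)
      (L.isLocalLieAlgebroid _ (c.frame_mem hW)) (L.isLocalLieAlgebroid _ (c'.frame_mem hW')) hTm
      hxi (fun β f => ?_) fun ν μ γ => ?_
    · simp only [hT']
      exact L.anchor_eq_sum _ _ _
    · simp only [hT']
      exact L.frameBracket_transition _ _ (c.frame_mem hW) (c'.frame_mem hW') ν μ γ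
  have hi : (c.formsChart hW).lift (interior (c.multivectorsModel.iso W hW P) k) =
      (c'.formsChart hW').lift (interior (c'.multivectorsModel.iso W hW' P) k) := by
    rw [interior_eq_jet ((c.multivectorsModel.iso_mem hW 0 P).2 hP),
      interior_eq_jet ((c'.multivectorsModel.iso_mem hW' 0 P).2 hP)]
    exact (c.formsChart hW).lift_jet_eq (c'.formsChart hW') (c.multivectorsChart hW)
      (c'.multivectorsChart hW') (E.forms.isSuperCommAlgebra W)
      (E.multivectors.isSuperCommAlgebra W) rfl rfl hTm hxi heta k P
  rw [lieDerivativeOn, lieDerivative, TotalChart.lift_commutator, hd, hi,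
    ← TotalChart.lift_commutator]
  rfl

end LieAlgebroid

/-! ### Compatibility of the local operators with restriction. -/

section Restriction

variable {p q r s : ℕ} {U V : Opens (Fin p → ℝ)} (h : V ≤ U)

/-- Restriction of structure functions to a smaller domain. -/
def StructureFunctions.res (c : StructureFunctions q r s U) : StructureFunctions q r s V where
  anchor α A := SuperFun.res h (c.anchor α A)
  bracket α β γ := SuperFun.res h (c.bracket α β γ)

theorem res_deRham (c : StructureFunctions q r s U) (x : TotalFun q r s U) :
    SuperFun.res (tube_mono s h) (deRham c x) =
      deRham (c.res h) (SuperFun.res (tube_mono s h) x) := by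
  simp [deRham, StructureFunctions.res, res_fromBase h, res_baseD h, res_fibreD h,
    res_fibreCoord h, -Fintype.sum_sum_type]

theorem res_prod_fibreD (l : List (Fin s ⊕ Fin r)) (x : TotalFun q r s U) :
    SuperFun.res (tube_mono s h) ((l.map fibreD).prod x) =
      (l.map fibreD).prod (SuperFun.res (tube_mono s h) x) := by
  induction l with
  | nil => simp
  | cons α l ih => simp [res_fibreD h, ih]

theorem res_taylorCoeff (X : TotalFun q r s U) {k : ℕ} (α : Fin k → Fin s ⊕ Fin r) :
    SuperFun.res h (taylorCoeff X α) = taylorCoeff (SuperFun.res (tube_mono s h) X) α := by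
  rw [taylorCoeff, taylorCoeff, map_smul, res_toZeroSection, res_prod_fibreD h]

theorem res_interior (X : TotalFun q r s U) (k : ℕ) (x : TotalFun q r s U) :
    SuperFun.res (tube_mono s h) (interior X k x) =
      interior (SuperFun.res (tube_mono s h) X) k (SuperFun.res (tube_mono s h) x) := by
  simp only [interior, LinearMap.smul_apply, LinearMap.sum_apply, Module.End.mul_apply,
    LinearMap.mulLeft_apply, map_smul, map_sum, map_mul, res_fromBase h,
    res_taylorCoeff h, res_prod_fibreD h]

theorem res_lieDerivative (c : StructureFunctions q r s U) (X : TotalFun q r s U) (k : ℕ)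
    (x : TotalFun q r s U) :
    SuperFun.res (tube_mono s h) (lieDerivative c X k x) =
      lieDerivative (c.res h) (SuperFun.res (tube_mono s h) X) k
        (SuperFun.res (tube_mono s h) x) := by
  simp only [lieDerivative, LinearMap.sub_apply, Module.End.mul_apply, map_sub, res_deRham h,
    res_interior h]

end Restriction

namespace LieAlgebroid

variable {X : Type u} [TopologicalSpace X] {p q r s : ℕ} {M : Supermanifold.{u, v} X p q}
  {E : SuperVectorBundle M r s} (L : LieAlgebroid E) (c : E.Chart) {W W' : Opens X}
  (hW : W ≤ c.source) (h : W' ≤ W)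

theorem repr_frame_res (w : E.sections.sec W) (γ : Fin s ⊕ Fin r) :
    (c.frame W' (h.trans hW)).repr (E.sections.res h w) γ =
      M.functions.res h ((c.frame W hW).repr w γ) := by
  conv_lhs => rw [← (c.frame W hW).sum_repr w]
  rw [map_sum, Finset.sum_congr rfl fun γ _ => (E.sections.res_smul h _ _).trans
    (by rw [← c.frame_res hW h γ]), Module.Basis.repr_sum_self]

theorem structureFunctionsOn_res :
    L.structureFunctionsOn c (h.trans hW) =
      (L.structureFunctionsOn c hW).res (chartImage_mono c.base.body h) := by
  have h1 : (L.structureFunctionsOn c (h.trans hW)).anchor =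
      ((L.structureFunctionsOn c hW).res (chartImage_mono c.base.body h)).anchor := by
    funext α A
    have hc : (c.base.model.iso W' (h.trans hW)).symm (SuperFun.coord _ _ A) =
        M.functions.res h ((c.base.model.iso W hW).symm (SuperFun.coord _ _ A)) := by
      rw [AlgEquiv.symm_apply_eq, c.base.model.iso_res hW h, AlgEquiv.apply_symm_apply]
      exact (SuperFun.res_coord _ _).symm
    refine Eq.trans ?_ (c.base.model.iso_res hW h _)
    change c.base.model.iso W' (h.trans hW) (L.anchor W' (c.frame W' (h.trans hW) α)
      ((c.base.model.iso W' (h.trans hW)).symm (SuperFun.coord _ _ A))) = _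
    rw [hc, c.frame_res hW h, ← L.anchor_res]
    rfl
  have h2 : (L.structureFunctionsOn c (h.trans hW)).bracket =
      ((L.structureFunctionsOn c hW).res (chartImage_mono c.base.body h)).bracket := by
    funext α β γ
    refine Eq.trans ?_ (map_smul (SuperFun.res (chartImage_mono c.base.body h)) _ _).symm
    change sgn (frameParity β) • c.base.model.iso W' (h.trans hW)
      ((c.frame W' (h.trans hW)).repr (L.bracket W' (c.frame W' (h.trans hW) α)
        (c.frame W' (h.trans hW) β)) γ) = _
    rw [c.frame_res hW h, c.frame_res hW h, ← L.bracket_res, repr_frame_res,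
      c.base.model.iso_res hW h]
    rfl
  cases hc : L.structureFunctionsOn c (h.trans hW)
  cases hc' : (L.structureFunctionsOn c hW).res (chartImage_mono c.base.body h)
  rw [hc, hc'] at h1 h2
  simp only at h1 h2
  rw [h1, h2]

theorem lieDerivativeOn_res (P : E.multivectors.sec W) (k : ℕ) (f : E.forms.sec W) :
    E.forms.res h (L.lieDerivativeOn c hW P k f) =
      L.lieDerivativeOn c (h.trans hW) (E.multivectors.res h P) k (E.forms.res h f) := by
  apply (c.formsModel.iso W' (h.trans hW)).injective
  refine Eq.trans (c.formsModel.iso_res hW h _) ?_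
  refine Eq.trans ?_ ((c.formsChart (h.trans hW)).total_lift _ _).symm
  have e := (c.formsChart hW).total_lift (lieDerivative (L.structureFunctionsOn c hW)
    (c.multivectorsModel.iso W hW P) k) f
  refine (congrArg (SuperFun.res _) e).trans ?_
  rw [res_lieDerivative, structureFunctionsOn_res L c hW h, c.multivectorsModel.iso_res hW h]
  refine congrArg _ ?_
  exact (c.formsModel.iso_res hW h f).symm

end LieAlgebroid

/-! ### Formal series of operators. -/

section FormalSums

variable {A : Type*} [Ring A] [Algebra ℝ A] {gr : ZMod 2 → Submodule ℝ A}

theorem isSuperCommAlgebra_formalGr (h : IsSuperCommAlgebra gr) :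
    IsSuperCommAlgebra (formalGr gr) where
  isCompl := by
    refine ⟨Submodule.disjoint_def.2 fun f h0 h1 => ?_, codisjoint_iff.2 (eq_top_iff.2 fun f _ => ?_)⟩
    · ext1 n
      rw [map_zero]
      exact Submodule.disjoint_def.1 h.isCompl.disjoint _ (h0 n) (h1 n)
    · choose y hy z hz hyz using fun n =>
        exists_parity_decomposition h.isCompl 0 (PowerSeries.coeff n f)
      refine Submodule.mem_sup.2 ⟨PowerSeries.mk y, fun n => ?_, PowerSeries.mk z, fun n => ?_, ?_⟩
      · rw [PowerSeries.coeff_mk]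
        exact hy n
      · rw [PowerSeries.coeff_mk]
        simpa using hz n
      · ext1 n
        rw [map_add, PowerSeries.coeff_mk, PowerSeries.coeff_mk, hyz]
  one_mem n := by
    rw [PowerSeries.coeff_one]
    split_ifs
    exacts [h.one_mem, zero_mem _]
  mul_mem ha hb n := by
    rw [PowerSeries.coeff_mul]
    exact Submodule.sum_mem _ fun kl _ => h.mul_mem (ha _) (hb _)
  supercomm {i j a b} ha hb := by
    ext1 n
    rw [coeff_real_smul, PowerSeries.coeff_mul, PowerSeries.coeff_mul, Finset.smul_sum,
      ← Finset.Nat.sum_antidiagonal_swap]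
    exact Finset.sum_congr rfl fun kl _ => h.supercomm (ha _) (hb _)

theorem coeff_formalSum (Δ : ℕ → Module.End ℝ A) (n : ℕ) (f : PowerSeries A) :
    PowerSeries.coeff n (formalSum Δ f) =
      ∑ kl ∈ Finset.HasAntidiagonal.antidiagonal n, Δ kl.1 (PowerSeries.coeff kl.2 f) :=
  PowerSeries.coeff_mk n fun n =>
    ∑ kl ∈ Finset.HasAntidiagonal.antidiagonal n, Δ kl.1 (PowerSeries.coeff kl.2 f)

theorem isHomogeneousOp_formalSum {Δ : ℕ → Module.End ℝ A} {d : ZMod 2}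
    (h : ∀ k, IsHomogeneousOp gr gr d (Δ k)) :
    IsHomogeneousOp (formalGr gr) (formalGr gr) d (formalSum Δ) := fun i f hf n => by
  rw [coeff_formalSum]
  exact Submodule.sum_mem _ fun kl _ => h _ _ _ (hf _)

theorem formalSum_mul_formalSum {Δ : ℕ → Module.End ℝ A}
    (h : ∀ n, ∑ kl ∈ Finset.HasAntidiagonal.antidiagonal n, Δ kl.1 * Δ kl.2 = 0) :
    formalSum Δ * formalSum Δ = 0 := by
  refine LinearMap.ext fun f => ?_
  ext1 n
  have e : PowerSeries.coeff n (formalSum Δ (formalSum Δ f)) =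
      ∑ kl ∈ Finset.HasAntidiagonal.antidiagonal n,
        (∑ ab ∈ Finset.HasAntidiagonal.antidiagonal kl.1, Δ ab.1 * Δ ab.2)
          (PowerSeries.coeff kl.2 f) := by
    simp only [coeff_formalSum, map_sum, LinearMap.sum_apply, Module.End.mul_apply,
      Finset.sum_sigma']
    -- Associativity of convolution: the decompositions `k + (l + j)` of `n` are matched with `(k +
    -- l) + j`.
    refine Finset.sum_nbij' (fun ⟨⟨k, _⟩, ⟨l, j⟩⟩ => ⟨(k + l, j), (k, l)⟩)
      (fun ⟨⟨_, j⟩, ⟨k, l⟩⟩ => ⟨(k, l + j), (l, j)⟩) ?_ ?_ ?_ ?_ ?_ <;>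
    · rintro ⟨⟨k, m⟩, ⟨l, j⟩⟩ hx
      simp only [Finset.mem_sigma, Finset.HasAntidiagonal.mem_antidiagonal] at hx
      obtain ⟨h1, rfl⟩ := hx
      simp [← h1, add_assoc]
  rw [Module.End.mul_apply, e]
  simp [h]

end FormalSums

/-! ### Local arguments in a sheaf and locally finite sums of operators. -/

namespace SuperSheaf

variable {X : Type u} [TopologicalSpace X] (F : SuperSheaf.{u, v} X)

theorem eq_of_locally_eq {U : Opens X} {f g : F.sec U}
    (h : ∀ x ∈ U, ∃ (W : Opens X) (hW : W ≤ U), x ∈ W ∧ F.res hW f = F.res hW g) : f = g := by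
  choose W hW hx he using fun x : U => h x.1 x.2
  exact F.locality U W hW (fun x hxU => ⟨⟨x, hxU⟩, hx _⟩) f g he

/-- The component of the wrong parity vanishes locally, hence globally. -/
theorem mem_of_locally_mem {U : Opens X} {f : F.sec U} {i : ZMod 2}
    (h : ∀ x ∈ U, ∃ (W : Opens X) (hW : W ≤ U), x ∈ W ∧ F.res hW f ∈ F.gr W i) : f ∈ F.gr U i := by
  obtain ⟨y, hy, z, hz, rfl⟩ :=
    exists_parity_decomposition (F.isSuperCommAlgebra U).isCompl i f
  have : z = 0 := F.eq_of_locally_eq fun x hx => by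
    obtain ⟨W, hW, hxW, hf⟩ := h x hx
    refine ⟨W, hW, hxW, ?_⟩
    rw [map_zero]
    refine eq_zero_of_mem_of_mem (F.isSuperCommAlgebra W).isCompl ?_ (F.res_mem hW hz)
    rw [map_add] at hf
    exact (add_mem_cancel_left (F.res_mem hW hy)).1 hf
  rw [this, add_zero]
  exact hy

/-- Linear maps into the sections over the sets of an open cover glue if they agree on overlaps. -/
theorem exists_glued_end (V : X → Opens X) (hV : ∀ x, x ∈ V x)
    (d : ∀ x, F.sec ⊤ →ₗ[ℝ] F.sec (V x))
    (h : ∀ x y f, F.res (inf_le_left : V x ⊓ V y ≤ V x) (d x f) =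
      F.res (inf_le_right : V x ⊓ V y ≤ V y) (d y f)) :
    ∃ D : Module.End ℝ (F.sec ⊤), ∀ x f, F.res (le_top : V x ≤ ⊤) (D f) = d x f := by
  choose D hD using fun f => F.gluing ⊤ V (fun _ => le_top) (fun x _ => ⟨x, hV x⟩)
    (fun x => d x f) fun x y => h x y f
  have hloc : ∀ f g : F.sec ⊤,
      (∀ x, F.res (le_top : V x ≤ ⊤) f = F.res le_top g) → f = g := fun f g =>
    F.locality ⊤ V (fun _ => le_top) (fun x _ => ⟨x, hV x⟩) f g
  exact ⟨{ toFun := D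
           map_add' := fun f g => hloc _ _ fun x => by rw [map_add, hD, hD, hD, map_add]
           map_smul' := fun c f => hloc _ _ fun x => by
             rw [RingHom.id_apply, map_smul, hD, hD, map_smul] }, fun x f => hD f x⟩

/-- The operators `Δ k` do not increase supports. -/
def IsLocalFamily (Δ : ℕ → Module.End ℝ (F.sec ⊤)) : Prop :=
  ∀ (k : ℕ) (W : Opens X) (f : F.sec ⊤), F.res (le_top : W ≤ ⊤) f = 0 →
    F.res (le_top : W ≤ ⊤) (Δ k f) = 0

variable {F}

theorem IsLocalFamily.res_congr {Δ : ℕ → Module.End ℝ (F.sec ⊤)} (hl : F.IsLocalFamily Δ) (k : ℕ)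
    {W : Opens X} {f g : F.sec ⊤} (h : F.res (le_top : W ≤ ⊤) f = F.res le_top g) :
    F.res (le_top : W ≤ ⊤) (Δ k f) = F.res le_top (Δ k g) := by
  rw [← sub_eq_zero, ← map_sub, ← map_sub]
  exact hl k W _ (by rw [map_sub, h, sub_self])

theorem res_top_of_le {W W' : Opens X} (h : W' ≤ W) {f g : F.sec ⊤}
    (hfg : F.res (le_top : W ≤ ⊤) f = F.res le_top g) :
    F.res (le_top : W' ≤ ⊤) f = F.res le_top g := by
  rw [← F.res_res le_top h, hfg, F.res_res]

/-- The square of indices is cut along antidiagonals, and the part of each antidiagonal outside the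
square contributes nothing. Two indices below `m` have a sum below `2 * m`. -/
theorem sum_range_sum_range_eq_zero {V : Type*} [AddCommGroup V] {B : ℕ → ℕ → V} {m : ℕ}
    (hB : ∀ k l, m ≤ k ∨ m ≤ l → B k l = 0)
    (h : ∀ n, ∑ kl ∈ Finset.HasAntidiagonal.antidiagonal n, B kl.1 kl.2 = 0) :
    ∑ k ∈ Finset.range m, ∑ l ∈ Finset.range m, B k l = 0 := by
  rw [← Finset.sum_product']
  rw [← Finset.sum_fiberwise_of_maps_to (t := Finset.range (2 * m)) (g := fun x => x.1 + x.2)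
    fun x hx => by
      simp only [Finset.mem_product, Finset.mem_range] at hx ⊢
      omega]
  refine Finset.sum_eq_zero fun n _ => ?_
  rw [← h n]
  refine Finset.sum_subset (fun x hx => ?_) fun x hx hx' => hB _ _ ?_
  · simp only [Finset.mem_filter] at hx
    exact Finset.HasAntidiagonal.mem_antidiagonal.2 hx.2
  · rw [Finset.HasAntidiagonal.mem_antidiagonal] at hx
    simp only [Finset.mem_filter, Finset.mem_product, Finset.mem_range, hx, and_true] at hx'
    omega

section LocallyFinite

variable {Δ : ℕ → Module.End ℝ (F.sec ⊤)} {D : Module.End ℝ (F.sec ⊤)}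

/-- From `N` on all partial sums agree with `g` on `W`, so the difference of two consecutive ones
vanishes. -/
theorem res_eq_zero_of_isLocallyFiniteSum {W : Opens X} {N : ℕ} {f g : F.sec ⊤}
    (h : ∀ n ≥ N, F.res (le_top : W ≤ ⊤) g = F.res le_top (∑ k ∈ Finset.range n, Δ k f)) {k : ℕ}
    (hk : N ≤ k) : F.res (le_top : W ≤ ⊤) (Δ k f) = 0 := by
  have h1 := h (k + 1) (by omega)
  rw [h k hk, Finset.sum_range_succ, map_add] at h1
  exact (left_eq_add.1 h1)

theorem isHomogeneousOp_of_isLocallyFiniteSum (hD : IsLocallyFiniteSum F Δ D) {d : ZMod 2}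
    (hΔ : ∀ k, IsHomogeneousOp (F.gr ⊤) (F.gr ⊤) d (Δ k)) :
    IsHomogeneousOp (F.gr ⊤) (F.gr ⊤) d D := fun i f hf => F.mem_of_locally_mem fun x _ => by
  obtain ⟨W, hxW, N, hN⟩ := hD f x
  refine ⟨W, le_top, hxW, ?_⟩
  rw [hN N le_rfl]
  exact F.res_mem _ (Submodule.sum_mem _ fun k _ => hΔ k i f hf)

/-- Local finiteness holds for each form separately; for the finitely many forms `Δ l f` a common
neighbourhood and bound exist. -/
theorem exists_res_eq_zero (hD : IsLocallyFiniteSum F Δ D) (f : F.sec ⊤) (x : X) (m : ℕ) :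
    ∃ W : Opens X, x ∈ W ∧ ∃ N : ℕ, ∀ l < m, ∀ k ≥ N,
      F.res (le_top : W ≤ ⊤) (Δ k (Δ l f)) = 0 := by
  induction m with
  | zero => exact ⟨⊤, trivial, 0, fun l hl => absurd hl (by omega)⟩
  | succ m ih =>
    obtain ⟨W, hxW, N, hN⟩ := ih
    obtain ⟨W', hxW', N', hN'⟩ := hD (Δ m f) x
    refine ⟨W ⊓ W', ⟨hxW, hxW'⟩, max N N', fun l hl k hk => ?_⟩
    have h0 : ∀ {W : Opens X}, F.res (le_top : W ≤ ⊤) 0 = 0 := map_zero _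
    rw [← h0]
    rcases Nat.lt_succ_iff_lt_or_eq.1 hl with hl | rfl
    · refine res_top_of_le inf_le_left ?_
      rw [h0, hN l hl k (le_trans (le_max_left _ _) hk)]
    · refine res_top_of_le inf_le_right ?_
      rw [h0, res_eq_zero_of_isLocallyFiniteSum hN' (le_trans (le_max_right _ _) hk)]

/-- Near a point, `D (D f)` is a finite sum of `Δ k (D f)`, and locality of `Δ k` permits replacing
`D f` by a finite partial sum. The resulting double sum over a square is regrouped along
antidiagonals, where it vanishes. -/
theorem mul_self_eq_zero_of_isLocallyFiniteSum (hD : IsLocallyFiniteSum F Δ D)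
    (hl : F.IsLocalFamily Δ)
    (h : ∀ n, ∑ kl ∈ Finset.HasAntidiagonal.antidiagonal n, Δ kl.1 * Δ kl.2 = 0) :
    D * D = 0 := by
  refine LinearMap.ext fun f => F.eq_of_locally_eq fun x _ => ?_
  have h0 : ∀ {W : Opens X}, F.res (le_top : W ≤ ⊤) 0 = 0 := map_zero _
  obtain ⟨W₁, hx₁, N₁, hN₁⟩ := hD f x
  obtain ⟨W₂, hx₂, N₂, hN₂⟩ := hD (D f) x
  obtain ⟨W₃, hx₃, N₃, hN₃⟩ := exists_res_eq_zero hD f x N₁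
  set W := W₁ ⊓ (W₂ ⊓ W₃)
  have hW₁ : W ≤ W₁ := inf_le_left
  have hW₂ : W ≤ W₂ := inf_le_right.trans inf_le_left
  have hW₃ : W ≤ W₃ := inf_le_right.trans inf_le_right
  refine ⟨W, le_top, ⟨hx₁, hx₂, hx₃⟩, ?_⟩
  -- Outside the square of side `m` all terms vanish on `W`: if `l ≥ N₁`, then `Δ l f` vanishes
  -- there; if `l < N₁`, then `k ≥ m ≥ N₃` and `W₃` was chosen for this case.
  set m := max N₁ (max N₂ N₃)
  have hm₁ : N₁ ≤ m := le_max_left _ _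
  have hm₂ : N₂ ≤ m := (le_max_left _ _).trans (le_max_right _ _)
  have hm₃ : N₃ ≤ m := (le_max_right _ _).trans (le_max_right _ _)
  have h1 : ∀ l ≥ N₁, F.res (le_top : W ≤ ⊤) (Δ l f) = F.res le_top 0 := fun l hlN =>
    res_top_of_le hW₁ (by rw [h0, res_eq_zero_of_isLocallyFiniteSum hN₁ hlN])
  rw [Module.End.mul_apply, LinearMap.zero_apply, res_top_of_le hW₂ (hN₂ m hm₂), map_sum, h0]
  have h2 : ∀ k, F.res (le_top : W ≤ ⊤) (Δ k (D f)) =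
      ∑ l ∈ Finset.range m, F.res (le_top : W ≤ ⊤) (Δ k (Δ l f)) := fun k => by
    rw [hl.res_congr k (res_top_of_le hW₁ (hN₁ m hm₁)), map_sum, map_sum]
  rw [Finset.sum_congr rfl fun k _ => h2 k]
  refine sum_range_sum_range_eq_zero (fun k l hkl => ?_) fun n => ?_
  · by_cases hlN : N₁ ≤ l
    · exact hl k W _ (by rw [h1 l hlN, h0])
    · have hk : m ≤ k := hkl.resolve_right (by omega)
      rw [← h0]
      exact res_top_of_le hW₃ (by rw [h0, hN₃ l (by omega) k (hm₃.trans hk)])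
  · rw [← map_sum]
    have := LinearMap.congr_fun (h n) f
    rw [LinearMap.sum_apply] at this
    exact (congrArg _ this).trans h0

theorem isLocallyFiniteSum_unique {D' : Module.End ℝ (F.sec ⊤)} (hD : IsLocallyFiniteSum F Δ D)
    (hD' : IsLocallyFiniteSum F Δ D') : D = D' := by
  refine LinearMap.ext fun f => F.eq_of_locally_eq fun x _ => ?_
  obtain ⟨W, hx, N, hN⟩ := hD f x
  obtain ⟨W', hx', N', hN'⟩ := hD' f x
  refine ⟨W ⊓ W', le_top, ⟨hx, hx'⟩, ?_⟩
  rw [res_top_of_le inf_le_left (hN _ (le_max_left N N')),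
    res_top_of_le inf_le_right (hN' _ (le_max_right N N'))]

/-- Near `x` one bound serves all sections, so a fixed partial sum is a linear operator there. Two
of these agree on overlaps, since both bounds may be raised to their maximum, and hence they glue.
-/
theorem existsUnique_isLocallyFiniteSum
    (h : ∀ x : X, ∃ W : Opens X, x ∈ W ∧ ∃ N : ℕ, ∀ k ≥ N, ∀ f : F.sec ⊤,
      F.res (le_top : W ≤ ⊤) (Δ k f) = 0) :
    ∃! D : Module.End ℝ (F.sec ⊤), IsLocallyFiniteSum F Δ D := by
  choose W hW N hN using h
  have hs : ∀ x (f : F.sec ⊤) n, N x ≤ n →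
      F.res (le_top : W x ≤ ⊤) (∑ k ∈ Finset.range (N x), Δ k f) =
      F.res le_top (∑ k ∈ Finset.range n, Δ k f) := by
    intro x f n hn
    rw [map_sum, map_sum]
    refine Finset.sum_subset (Finset.range_mono hn) fun k _ hk => hN x k (by simpa using hk) f
  obtain ⟨D, hD⟩ := F.exists_glued_end W hW
    (fun x => (F.res (le_top : W x ≤ ⊤)).toLinearMap ∘ₗ ∑ k ∈ Finset.range (N x), Δ k)
    fun x y f => by
      simp only [LinearMap.comp_apply, LinearMap.sum_apply, AlgHom.toLinearMap_apply]
      rw [hs x f _ (le_max_left (N x) (N y)), hs y f _ (le_max_right (N x) (N y)), F.res_res,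
        F.res_res]
  refine ⟨D, fun f x => ⟨W x, hW x, N x, fun n hn => ?_⟩, fun D' hD' =>
    isLocallyFiniteSum_unique hD' fun f x => ⟨W x, hW x, N x, fun n hn => ?_⟩⟩ <;>
  · rw [hD, ← hs x f n hn]
    simp

end LocallyFinite

end SuperSheaf

/-! ### Parity and vanishing of the Lie derivatives in coordinates. -/

section Parity

variable {p q r s : ℕ} {Ω : Opens (Fin p → ℝ)}

theorem isHomogeneousOp_jet : ∀ (k : ℕ) {x : ZMod 2} {X : TotalFun q r s Ω},
    X ∈ totalGr q r s Ω x → IsHomogeneousOp (totalGr q r s Ω) (totalGr q r s Ω) x (jet k X)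
  | 0, x, X, hX => fun i y hy => by
    rw [jet_zero, add_comm]
    exact SuperFun.isSuperCommAlgebra.mul_mem (fromBase_mem (toZeroSection_mem hX)) hy
  | k + 1, x, X, hX => fun i y hy => by
    rw [jet_succ, LinearMap.smul_apply, LinearMap.sum_apply]
    refine Submodule.smul_mem _ _ (Submodule.sum_mem _ fun α _ => ?_)
    have h := (isSuperDerivation_fibreD α).mem
      (isHomogeneousOp_jet k ((isSuperDerivation_fibreD α).mem hX) i y hy)
    rwa [add_assoc i, add_assoc x, CharTwo.add_self_eq_zero, add_zero] at h

theorem isHomogeneousOp_lieDerivative {c : StructureFunctions q r s Ω} (hc : c.IsHomogeneous)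
    {P : TotalFun q r s Ω} (hP : P ∈ totalGr q r s Ω 0) (k : ℕ) :
    IsHomogeneousOp (totalGr q r s Ω) (totalGr q r s Ω) 1 (lieDerivative c P k) := fun i y hy => by
  have hi := fun i => isHomogeneousOp_jet k hP i
  have hd := TotalChart.isSuperDerivation_deRham hc
  rw [lieDerivative, interior_eq_jet hP]
  have h1 := hd.mem (hi i y hy)
  have h2 := hi _ _ (hd.mem hy)
  rw [add_zero] at h1 h2
  exact sub_mem h1 h2

theorem lieDerivative_eq_zero (c : StructureFunctions q r s Ω) {P : TotalFun q r s Ω} {k : ℕ}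
    (h : ∀ α : Fin k → Fin s ⊕ Fin r, taylorCoeff P α = 0) : lieDerivative c P k = 0 := by
  have : interior P k = 0 := by
    rw [interior, Finset.sum_eq_zero fun α _ => by
      rw [h α, map_zero, LinearMap.mulLeft_zero_eq_zero, zero_mul], smul_zero]
  rw [lieDerivative, this, mul_zero, zero_mul, sub_zero]

end Parity

/-! ### The global operators `L_{P_k}`. -/

namespace LieAlgebroid

variable {X : Type u} [TopologicalSpace X] {p q r s : ℕ} {M : Supermanifold.{u, v} X p q}
  {E : SuperVectorBundle M r s} (L : LieAlgebroid E)

theorem isLieDerivative_iff {P : E.multivectors.sec ⊤} {k : ℕ} {D : Module.End ℝ (E.forms.sec ⊤)} :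
    L.IsLieDerivative P k D ↔ ∀ c ∈ E.atlas, ∀ f : E.forms.sec ⊤,
      E.forms.res (le_top : c.source ≤ ⊤) (D f) =
        L.lieDerivativeOn c le_rfl (E.multivectors.res le_top P) k (E.forms.res le_top f) := by
  refine forall₂_congr fun c _ => forall_congr' fun f => ?_
  rw [lieDerivativeOn, TotalChart.lift_apply]
  exact (AlgEquiv.eq_symm_apply (c.formsModel.iso c.source le_rfl)).symm

variable {L} {P : E.multivectors.sec ⊤} (hP : L.IsHigherPoisson P)

include hP

/-- One chart around each point suffices to glue an operator, because the local expressions agree on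
overlaps by `lieDerivativeOn_eq`. The same agreement gives the prescribed expression in every other
chart of the atlas. -/
theorem exists_isLieDerivative (k : ℕ) : ∃ D, L.IsLieDerivative P k D := by
  choose c hc hx using E.exists_mem_atlas
  have hPW : ∀ W : Opens X, E.multivectors.res (le_top : W ≤ ⊤) P ∈ E.multivectors.gr W 0 :=
    fun W => E.multivectors.res_mem _ hP.1
  have hres : ∀ (c : E.Chart) {W : Opens X} (hW : W ≤ c.source) (f : E.forms.sec ⊤),
      E.forms.res hW (L.lieDerivativeOn c le_rfl (E.multivectors.res le_top P) k
        (E.forms.res le_top f)) =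
      L.lieDerivativeOn c hW (E.multivectors.res le_top P) k (E.forms.res le_top f) := by
    intro c W hW f
    rw [L.lieDerivativeOn_res c le_rfl hW, E.multivectors.res_res, E.forms.res_res]
  obtain ⟨D, hD⟩ := E.forms.exists_glued_end (fun x => (c x).source) hx
    (fun x => L.lieDerivativeOn (c x) le_rfl (E.multivectors.res le_top P) k ∘ₗ
      (E.forms.res le_top).toLinearMap) fun x y f => by
        simp only [LinearMap.comp_apply, AlgHom.toLinearMap_apply]
        rw [hres, hres, L.lieDerivativeOn_eq _ _ _ _ (hPW _) k (hc x) (hc y)]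
  refine ⟨D, L.isLieDerivative_iff.2 fun c' hc' f => E.forms.eq_of_locally_eq fun x hxc => ?_⟩
  refine ⟨c'.source ⊓ (c x).source, inf_le_left, ⟨hxc, hx x⟩, ?_⟩
  rw [hres, E.forms.res_res, ← E.forms.res_res le_top inf_le_right, hD]
  simp only [LinearMap.comp_apply, AlgHom.toLinearMap_apply]
  rw [hres, L.lieDerivativeOn_eq _ _ _ _ (hPW _) k (hc x) hc']

omit hP in
theorem isLieDerivative_unique {k : ℕ} {D D' : Module.End ℝ (E.forms.sec ⊤)}
    (hD : L.IsLieDerivative P k D) (hD' : L.IsLieDerivative P k D') : D = D' := by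
  rw [isLieDerivative_iff] at hD hD'
  refine LinearMap.ext fun f => E.forms.eq_of_locally_eq fun x _ => ?_
  obtain ⟨c, hc, hx⟩ := E.exists_mem_atlas x
  exact ⟨c.source, le_top, hx, by rw [hD c hc, hD' c hc]⟩

omit hP in
theorem res_isLieDerivative {k : ℕ} {D : Module.End ℝ (E.forms.sec ⊤)}
    (hD : L.IsLieDerivative P k D) {c : E.Chart} (hc : c ∈ E.atlas) {W : Opens X}
    (hW : W ≤ c.source) (f : E.forms.sec ⊤) :
    E.forms.res (le_top : W ≤ ⊤) (D f) =
      L.lieDerivativeOn c hW (E.multivectors.res le_top P) k (E.forms.res le_top f) := by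
  rw [← E.forms.res_res le_top hW, L.isLieDerivative_iff.1 hD c hc, L.lieDerivativeOn_res c le_rfl hW,
    E.multivectors.res_res, E.forms.res_res]

theorem isHomogeneousOp_isLieDerivative {k : ℕ} {D : Module.End ℝ (E.forms.sec ⊤)}
    (hD : L.IsLieDerivative P k D) : IsHomogeneousOp (E.forms.gr ⊤) (E.forms.gr ⊤) 1 D :=
  fun i f hf => E.forms.mem_of_locally_mem fun x _ => by
    obtain ⟨c, hc, hx⟩ := E.exists_mem_atlas x
    refine ⟨c.source, le_top, hx, ?_⟩
    rw [L.isLieDerivative_iff.1 hD c hc, ← c.formsModel.iso_mem le_rfl]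
    have e := (c.formsChart le_rfl).total_lift (lieDerivative (L.structureFunctionsOn c le_rfl)
      (c.multivectorsModel.iso c.source le_rfl (E.multivectors.res le_top P)) k)
      (E.forms.res le_top f)
    refine (congrArg (· ∈ SuperFun.gr _ _ (i + 1)) e).mpr ?_
    exact isHomogeneousOp_lieDerivative (L.isHomogeneous_structureFunctionsOn c le_rfl)
      ((c.multivectorsModel.iso_mem le_rfl 0 _).2 (E.multivectors.res_mem _ hP.1)) k i _
      ((c.formsModel.iso_mem le_rfl i _).2 (E.forms.res_mem _ hf))

omit hP in
theorem isLocalFamily_isLieDerivative {Δ : ℕ → Module.End ℝ (E.forms.sec ⊤)}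
    (hΔ : ∀ k, L.IsLieDerivative P k (Δ k)) : E.forms.IsLocalFamily Δ := fun k W f hf =>
  E.forms.eq_of_locally_eq fun x hxW => by
    obtain ⟨c, hc, hx⟩ := E.exists_mem_atlas x
    refine ⟨W ⊓ c.source, inf_le_left, ⟨hxW, hx⟩, ?_⟩
    rw [E.forms.res_res, res_isLieDerivative (hΔ k) hc inf_le_right,
      ← E.forms.res_res le_top (inf_le_left : W ⊓ c.source ≤ W), hf, map_zero, map_zero]

/-- The identity is verified on the whole domain of each chart, where the Schouten bracket of `P`
with itself is zero by assumption and the operators have their coordinate form. -/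
theorem sum_antidiagonal_isLieDerivative {Δ : ℕ → Module.End ℝ (E.forms.sec ⊤)}
    (hΔ : ∀ k, L.IsLieDerivative P k (Δ k)) (n : ℕ) :
    ∑ kl ∈ Finset.HasAntidiagonal.antidiagonal n, Δ kl.1 * Δ kl.2 = 0 := by
  refine LinearMap.ext fun f => E.forms.eq_of_locally_eq fun x _ => ?_
  obtain ⟨c, hc, hx⟩ := E.exists_mem_atlas x
  refine ⟨c.source, le_top, hx, ?_⟩
  have h := sum_lieDerivative_mul_lieDerivative
    ((c.multivectorsModel.iso_mem le_rfl 0 _).2 (E.multivectors.res_mem le_top hP.1))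
    (L.isHomogeneous_structureFunctionsOn c le_rfl) (L.deRham_mul_deRham c le_rfl) (hP.2 c hc) n
  have h' := congrArg (fun D => (c.formsChart le_rfl).lift D (E.forms.res le_top f)) h
  rw [LinearMap.sum_apply, map_sum, LinearMap.zero_apply, map_zero]
  refine Eq.trans ?_ (h'.trans ?_)
  · rw [TotalChart.lift_apply, LinearMap.sum_apply, map_sum]
    refine Finset.sum_congr rfl fun kl _ => ?_
    rw [Module.End.mul_apply, L.isLieDerivative_iff.1 (hΔ _) c hc,
      L.isLieDerivative_iff.1 (hΔ _) c hc, lieDerivativeOn, lieDerivativeOn,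
      ← Module.End.mul_apply, ← TotalChart.lift_mul]
    rfl
  · rw [TotalChart.lift_apply, LinearMap.zero_apply, map_zero]

omit hP in
theorem exists_res_eq_zero {Δ : ℕ → Module.End ℝ (E.forms.sec ⊤)}
    (hΔ : ∀ k, L.IsLieDerivative P k (Δ k)) (hfin : HasLocallyFiniteExpansion E P) (x : X) :
    ∃ W : Opens X, x ∈ W ∧ ∃ N : ℕ, ∀ k ≥ N, ∀ f : E.forms.sec ⊤,
      E.forms.res (le_top : W ≤ ⊤) (Δ k f) = 0 := by
  obtain ⟨c, hc, W, hW, hx, N, hN⟩ := hfin x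
  refine ⟨W, hx, N, fun k hk f => ?_⟩
  rw [res_isLieDerivative (hΔ k) hc hW, lieDerivativeOn, lieDerivative_eq_zero _ (hN k hk),
    TotalChart.lift_apply, LinearMap.zero_apply, map_zero]

end LieAlgebroid

end HigherPoisson

end

/-! ### The theorem. -/

theorem mainTheorem3 {X : Type u} [TopologicalSpace X] {p q r s : ℕ}
    (M : HigherPoisson.Supermanifold.{u, v} X p q) (E : HigherPoisson.SuperVectorBundle M r s)
    (L : HigherPoisson.LieAlgebroid E) (P : E.multivectors.sec ⊤) (hP : L.IsHigherPoisson P) :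
    ∃ Δ : ℕ → Module.End ℝ (E.forms.sec ⊤),
      (∀ (k : ℕ) (D : Module.End ℝ (E.forms.sec ⊤)), L.IsLieDerivative P k D ↔ D = Δ k) ∧
      HigherPoisson.IsHomotopyBV (HigherPoisson.formalGr (E.forms.gr ⊤))
        (HigherPoisson.formalSum Δ) ∧
      (∀ D : Module.End ℝ (E.forms.sec ⊤), HigherPoisson.IsLocallyFiniteSum E.forms Δ D →
        HigherPoisson.IsHomotopyBV (E.forms.gr ⊤) D) ∧
      (HigherPoisson.HasLocallyFiniteExpansion E P →
        ∃! D : Module.End ℝ (E.forms.sec ⊤), HigherPoisson.IsLocallyFiniteSum E.forms Δ D) := by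
  choose Δ hΔ using fun k => HigherPoisson.LieAlgebroid.exists_isLieDerivative hP k
  have hodd := fun k => HigherPoisson.LieAlgebroid.isHomogeneousOp_isLieDerivative hP (hΔ k)
  have hsum := HigherPoisson.LieAlgebroid.sum_antidiagonal_isLieDerivative hP hΔ
  have hloc := HigherPoisson.LieAlgebroid.isLocalFamily_isLieDerivative hΔ
  refine ⟨Δ, fun k D => ⟨fun hD => HigherPoisson.LieAlgebroid.isLieDerivative_unique hD (hΔ k),
    fun hD => hD ▸ hΔ k⟩, ?_, fun D hD => ?_, fun hfin => ?_⟩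
  · exact HigherPoisson.isHomotopyBV_of_sq_zero
      (HigherPoisson.isSuperCommAlgebra_formalGr (E.forms.isSuperCommAlgebra ⊤))
      (HigherPoisson.isHomogeneousOp_formalSum hodd) (HigherPoisson.formalSum_mul_formalSum hsum)
  · exact HigherPoisson.isHomotopyBV_of_sq_zero (E.forms.isSuperCommAlgebra ⊤)
      (HigherPoisson.SuperSheaf.isHomogeneousOp_of_isLocallyFiniteSum hD hodd)
      (HigherPoisson.SuperSheaf.mul_self_eq_zero_of_isLocallyFiniteSum hD hloc hsum)
  · exact HigherPoisson.SuperSheaf.existsUnique_isLocallyFiniteSum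
      (HigherPoisson.LieAlgebroid.exists_res_eq_zero hΔ hfin)
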